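/- Let $F_3$ be the free group on $a_1,a_2,a_3$, let $\mathrm{Out}(F_3)=\mathrm{Aut}(F_3)/\mathrm{Inn}(F_3)$ (automorphisms act on the left), and let $\epsilon_i\in\mathrm{Out}(F_3)$ be the class of the automorphism $a_i\mapsto a_i^{-1}$, $a_j\mapsto a_j$ ($j\neq i$). For $i\neq j$ in $\{1,2,3\}$ let $\sigma_{ij}$ be the class of the automorphism interchanging $a_i$ and $a_j$ and fixing the third generator, and let $\sigma_{i4}$ be the class of $a_i\mapsto a_i^{-1}$, $a_j\mapsto a_ja_i^{-1}$ ($j\neq i$). The $\sigma_{ij}$ generate a subgroup $S_4<\mathrm{Out}(F_3)$, identified with the symmetric group of degree $4$ by letting $\sigma_{ij}$ correspond to the transposition $(i\,j)$. Let $\mathbb{K}$ be a field of characteristic other than $2$ or $3$, and let $V$ be a $5$-dimensional $\mathbb{K}$-linear representation of $\mathrm{Out}(F_3)$. For $I\subseteq\{1,2,3\}$ put \[E_I=\{v\in V \mid \epsilon_i v=-v \text{ for } i\in I,\ \epsilon_i v=v \text{ for } i\notin I\},\qquad V_k=\bigoplus_{|I|=k}E_I\quad(0\le k\le 3).\] Suppose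 that $V\neq V_0\oplus V_3$. Then $V=V_0\oplus V_1\oplus V_2\oplus V_3$, each $V_k$ is an $\mathrm{Out}(F_3)$-submodule, and, as $S_4$-modules, $V_0$ is a (possibly empty) direct sum of trivial representations, $V_1$ of standard representations, $V_2$ of signed standard representations, and $V_3$ of determinant representations. Here the determinant representation is the one-dimensional sign representation of $S_4$, the standard representation is $\{x\in\mathbb{K}^4\mid \sum_i x_i=0\}$ with $S_4$ permuting the coordinates, and the signed standard representation is its tensor product with the sign representation. -/

import Mathlib

namespace OutFree

/-- The subgroup of inner automorphisms of `G`. -/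
def Inn (G : Type*) [Group G] : Subgroup (MulAut G) := (MulAut.conj : G →* MulAut G).range

instance (G : Type*) [Group G] : (Inn G).Normal := by
  refine ⟨?_⟩
  rintro _ ⟨x, rfl⟩ f
  refine ⟨f x, ?_⟩
  ext y
  simp [MulAut.conj_apply]

/-- The outer automorphism group of the free group of rank `n`.
The product in `MulAut` is composition, so automorphisms act on the left. -/
abbrev OutF (n : ℕ) : Type := MulAut (FreeGroup (Fin n)) ⧸ Inn (FreeGroup (Fin n))

/-- The endomorphism of the free group that inverts the `i`-th generator and fixes the others. -/
def epsHom {n : ℕ} (i : Fin n) : FreeGroup (Fin n) →* FreeGroup (Fin n) :=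
  FreeGroup.lift fun j => if j = i then (FreeGroup.of j)⁻¹ else FreeGroup.of j

theorem epsHom_comp {n : ℕ} (i : Fin n) : (epsHom i).comp (epsHom i) = MonoidHom.id _ := by
  ext j
  by_cases h : j = i <;> simp [epsHom, h]

/-- The automorphism `ε_i`: `a_i ↦ a_i⁻¹` and `a_j ↦ a_j` for `j ≠ i`. -/
def epsAut {n : ℕ} (i : Fin n) : MulAut (FreeGroup (Fin n)) :=
  MonoidHom.toMulEquiv (epsHom i) (epsHom i) (epsHom_comp i) (epsHom_comp i)

/-- The class of `ε_i` in `Out(F_n)`. -/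
def eps {n : ℕ} (i : Fin n) : OutF n := QuotientGroup.mk (epsAut i)

/-- The generators `a_1, …, a_n` extended by `a_{n+1} = 1`. -/
def gen {n : ℕ} : Fin (n + 1) → FreeGroup (Fin n) :=
  Fin.lastCases 1 FreeGroup.of

/-- The endomorphism `a_j ↦ a_{π j} a_{π (n+1)}⁻¹` attached to a permutation `π`
of `{1, …, n+1}`, with the convention `a_{n+1} = 1`. -/
def symEnd {n : ℕ} (π : Equiv.Perm (Fin (n + 1))) : FreeGroup (Fin n) →* FreeGroup (Fin n) :=
  FreeGroup.lift fun j => gen (π j.castSucc) * (gen (π (Fin.last n)))⁻¹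

theorem symEnd_gen {n : ℕ} (π : Equiv.Perm (Fin (n + 1))) (i : Fin (n + 1)) :
    symEnd π (gen i) = gen (π i) * (gen (π (Fin.last n)))⁻¹ := by
  induction i using Fin.lastCases with
  | last => simp [gen]
  | cast j =>
    have h : (gen j.castSucc : FreeGroup (Fin n)) = FreeGroup.of j := by simp [gen]
    rw [h]
    simp [symEnd]

theorem symEnd_mul {n : ℕ} (π τ : Equiv.Perm (Fin (n + 1))) :
    (symEnd π).comp (symEnd τ) = symEnd (π * τ) := by
  ext j
  have h : (FreeGroup.of j : FreeGroup (Fin n)) = gen j.castSucc := by simp [gen]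
  simp only [MonoidHom.comp_apply, h, symEnd_gen, map_mul, map_inv, Equiv.Perm.mul_apply]
  group

theorem symEnd_one {n : ℕ} : symEnd (1 : Equiv.Perm (Fin (n + 1))) = MonoidHom.id _ := by
  ext j
  simp [symEnd, gen]

/-- The action of the symmetric group of degree `n + 1` on `F_n` whose transposition `(i j)`
acts as `σ_ij`; see the evaluation lemmas below. -/
def symAut (n : ℕ) : Equiv.Perm (Fin (n + 1)) →* MulAut (FreeGroup (Fin n)) where
  toFun π := MonoidHom.toMulEquiv (symEnd π) (symEnd π⁻¹)
    (by rw [symEnd_mul, inv_mul_cancel, symEnd_one])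
    (by rw [symEnd_mul, mul_inv_cancel, symEnd_one])
  map_one' := by
    ext x
    exact DFunLike.congr_fun symEnd_one x
  map_mul' π τ := by
    ext x
    exact (DFunLike.congr_fun (symEnd_mul π τ) x).symm

/-- For `i, j ≤ n`, the transposition `(i j)` acts by interchanging `a_i` and `a_j`. -/
theorem symAut_swap_castSucc {n : ℕ} (i j k : Fin n) :
    symAut n (Equiv.swap i.castSucc j.castSucc) (FreeGroup.of k)
      = FreeGroup.of (Equiv.swap i j k) := by
  have h : Equiv.swap i.castSucc j.castSucc k.castSucc = (Equiv.swap i j k).castSucc := by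
    simp only [Equiv.swap_apply_def, Fin.castSucc_inj]
    split_ifs <;> rfl
  have hl : Equiv.swap i.castSucc j.castSucc (Fin.last n) = Fin.last n :=
    Equiv.swap_apply_of_ne_of_ne (Fin.castSucc_lt_last i).ne' (Fin.castSucc_lt_last j).ne'
  simp [symAut, symEnd, h, hl, gen]

/-- The transposition `(i (n+1))` sends `a_i` to `a_i⁻¹`. -/
theorem symAut_swap_last_self {n : ℕ} (i : Fin n) :
    symAut n (Equiv.swap i.castSucc (Fin.last n)) (FreeGroup.of i) = (FreeGroup.of i)⁻¹ := by
  simp [symAut, symEnd, gen]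

/-- The transposition `(i (n+1))` sends `a_j` to `a_j a_i⁻¹` for `j ≠ i`. -/
theorem symAut_swap_last {n : ℕ} (i j : Fin n) (h : j ≠ i) :
    symAut n (Equiv.swap i.castSucc (Fin.last n)) (FreeGroup.of j)
      = FreeGroup.of j * (FreeGroup.of i)⁻¹ := by
  have hj : Equiv.swap i.castSucc (Fin.last n) j.castSucc = j.castSucc :=
    Equiv.swap_apply_of_ne_of_ne (by simpa using h) (Fin.castSucc_lt_last j).ne
  simp [symAut, symEnd, gen, hj]

/-- The subgroup `S_{n+1} < Out(F_n)` generated by the `σ_ij`, as a homomorphism from the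
symmetric group of degree `n + 1`. -/
def symOut (n : ℕ) : Equiv.Perm (Fin (n + 1)) →* OutF n :=
  (QuotientGroup.mk' (Inn (FreeGroup (Fin n)))).comp (symAut n)

section Levels

variable {K V : Type*} [Field K] [AddCommGroup V] [Module K V] {n : ℕ}

/-- The simultaneous eigenspace
`E_I = {v | ε_i v = -v for i ∈ I and ε_i v = v for i ∉ I}`. -/
def eigen (φ : Representation K (OutF n) V) (I : Finset (Fin n)) : Submodule K V where
  carrier := {v | ∀ i, φ (eps i) v = (if i ∈ I then (-1 : K) else 1) • v}
  add_mem' := by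
    intro v w hv hw i
    rw [map_add, hv i, hw i, smul_add]
  zero_mem' := by
    intro i
    rw [map_zero, smul_zero]
  smul_mem' := by
    intro c v hv i
    rw [map_smul, hv i, smul_comm]

/-- The sum `V_k` of all `E_I` with `|I| = k`. -/
def level (φ : Representation K (OutF n) V) (k : ℕ) : Submodule K V :=
  ⨆ I : {I : Finset (Fin n) // I.card = k}, eigen φ I

end Levels

section Symmetric

variable (K : Type*) [Field K] (m : ℕ)

/-- The sign of a permutation, as an element of `K`. -/
def signK : Equiv.Perm (Fin m) →* K :=
  ((Int.castRingHom K : ℤ →* K).comp (Units.coeHom ℤ)).comp Equiv.Perm.sign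

/-- The product of a representation of the symmetric group with the sign character. -/
def signTwist {K : Type*} [Field K] {m : ℕ} {W : Type*} [AddCommGroup W] [Module K W]
    (τ : Representation K (Equiv.Perm (Fin m)) W) :
    Representation K (Equiv.Perm (Fin m)) W where
  toFun g := signK K m g • τ g
  map_one' := by simp
  map_mul' g h := by
    rw [map_mul, map_mul, smul_mul_smul_comm]

/-- The trivial representation, of partition `(m)`. -/
def trivRep : Representation K (Equiv.Perm (Fin m)) K :=
  Representation.trivial K (Equiv.Perm (Fin m)) K

/-- The determinant (sign) representation, of partition `(1^m)`. -/
def detRep : Representation K (Equiv.Perm (Fin m)) K :=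
  signTwist (trivRep K m)

/-- The symmetric group permuting the coordinates of `K^m`: `g` sends the `i`-th standard basis
vector to the `g i`-th one. -/
def permRep : Representation K (Equiv.Perm (Fin m)) (Fin m → K) where
  toFun g := LinearMap.funLeft K K (g⁻¹ : Equiv.Perm (Fin m))
  map_one' := by
    ext
    simp
  map_mul' g h := by
    ext
    simp [LinearMap.funLeft_apply]

/-- The vectors of `K^m` whose coordinates sum to zero. -/
def sumZero : Submodule K (Fin m → K) := LinearMap.ker (∑ i, LinearMap.proj (R := K) (φ := fun _ => K) i)

theorem sumZero_le_comap (g : Equiv.Perm (Fin m)) :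
    sumZero K m ≤ (sumZero K m).comap (permRep K m g) := by
  intro v hv
  simp only [sumZero, Submodule.mem_comap, LinearMap.mem_ker, LinearMap.sum_apply,
    LinearMap.proj_apply] at hv ⊢
  rw [← hv]
  exact Equiv.sum_comp (g⁻¹ : Equiv.Perm (Fin m)) v

/-- The standard representation, of partition `(m-1, 1)`. -/
def stdRep : Representation K (Equiv.Perm (Fin m)) (sumZero K m) :=
  (permRep K m).subrepresentation (sumZero K m) (sumZero_le_comap K m)

/-- The signed standard representation, of partition `(2, 1^(m-2))`. -/
def signedStdRep : Representation K (Equiv.Perm (Fin m)) (sumZero K m) :=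
  signTwist (stdRep K m)

end Symmetric

/-- `σ` is isomorphic to a finite, possibly empty, direct sum of copies of `τ`. -/
def IsSumOf {K G V W : Type*} [Field K] [Group G] [AddCommGroup V] [Module K V]
    [AddCommGroup W] [Module K W] (σ : Representation K G V) (τ : Representation K G W) : Prop :=
  ∃ d : ℕ, Nonempty (σ.Equiv (Representation.directSum fun _ : Fin d => τ))

/-- The `S_{n+1}`-module structure on an `Out(F_n)`-invariant subspace `U`. -/
def symRestrict {K V : Type*} [Field K] [AddCommGroup V] [Module K V] {n : ℕ}
    (φ : Representation K (OutF n) V) (U : Submodule K V) (hU : ∀ g, U ≤ U.comap (φ g)) :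
    Representation K (Equiv.Perm (Fin (n + 1))) U :=
  MonoidHom.comp (φ.subrepresentation U hU) (symOut n)

end OutFree

/-! Write d_k for the common dimension of the E_I with |I| = k. Then d_0 + 3d_1 + 3d_2 + d_3 = 5,
and V ≠ V_0 ⊕ V_3 leaves only (d_1, d_2) = (1, 0) or (0, 1), with d_0 + d_3 = 2. Twisting by the
determinant character of Out(F_3) replaces I by its complement, so it exchanges V_k with V_{3-k}. On
S_4 this character is the sign. It therefore suffices to treat d_1 = 1, d_2 = 0 (`HasFirstLevel`).

In that case V_1 has a basis e_0, e_1, e_2 permuted by S_3 up to a sign z (`exists_isFrame`). Let T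
be the operator of the transvection a_0 ↦ a_0 a_1⁻¹. Its relations with the ε_i, with the
permutations and with other transvections determine T on V_1. `fixed_component_eq_zero` shows that T
e_1 has no component in V_0, and `top_component_eq_zero` that T e_2 has none in V_3. The result is z
= 1, T e_0 = e_0 + r e_1, T e_1 = q e_0 + e_1, T e_2 = e_2 with qr = 0 and r - q = -1. So V_1 is the
homology representation (q = 0) or its dual (q = 1), and both restrict to the standard
representation of S_4 (`IsFrame.symOut_frameMap`).

The dual of V satisfies the same hypotheses, and V_0 ⊕ V_3 is the annihilator of its first level,
hence invariant. All ε_i agree on this plane, and the relations then force T to act trivially there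
(`trans_apply_of_finrank_le_two`). Thus V_0 and V_3 are invariant, and the transposition (2 4),
which is T times a conjugate of T times ε_2 in the numbering of the statement, acts by 1 on V_0 and
by -1 on V_3.

Invariance is only ever checked on the ε_i, the permutations and T. These generate Out(F_3) by
Nielsen's theorem, which is proved by reducing tuples in the free group (`nielsen_generation`). -/

namespace OutFree

/-! ### Common prefixes of reduced words and the Gromov product. -/

section CommonPrefix

variable {β : Type*} [DecidableEq β]

/-- The length of the longest common prefix of two lists. -/
def commonPrefix : List β → List β → ℕ
  | a :: l, b :: m => if a = b then commonPrefix l m + 1 else 0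
  | _, _ => 0

theorem commonPrefix_comm (l m : List β) : commonPrefix l m = commonPrefix m l := by
  induction l generalizing m with
  | nil => cases m <;> simp [commonPrefix]
  | cons a l ih =>
    cases m with
    | nil => simp [commonPrefix]
    | cons b m => simp only [commonPrefix, ih m, eq_comm]

theorem commonPrefix_self (l : List β) : commonPrefix l l = l.length := by
  induction l with
  | nil => simp [commonPrefix]
  | cons a l ih => simp [commonPrefix, ih]

/-- The ultrametric inequality of a tree: what `l` and `k` both share with `m` they share with each
other. -/
theorem min_commonPrefix_le (l m k : List β) :
    min (commonPrefix l m) (commonPrefix m k) ≤ commonPrefix l k := by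
  induction l generalizing m k with
  | nil => simp [commonPrefix]
  | cons a l ih =>
    cases m with
    | nil => simp [commonPrefix]
    | cons b m =>
      cases k with
      | nil => simp [commonPrefix]
      | cons c k =>
        have := ih m k
        simp only [commonPrefix]
        split_ifs <;> first | omega | simp_all

theorem take_commonPrefix (l m : List β) :
    l.take (commonPrefix l m) = m.take (commonPrefix l m) := by
  induction l generalizing m with
  | nil => simp [commonPrefix]
  | cons a l ih =>
    cases m with
    | nil => simp [commonPrefix]
    | cons b m =>
      simp only [commonPrefix]
      split_ifs with h
      · simp [h, ih m]
      · simp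

end CommonPrefix

section GromovProduct

open FreeGroup

variable {α : Type*} [DecidableEq α]

/-- Cancellation in the product removes the common prefix from both words and then stops: once the
first letters differ, the concatenation is already reduced. -/
theorem norm_inv_mul_mk (l m : List (α × Bool)) (hl : IsReduced l) (hm : IsReduced m) :
    ((FreeGroup.mk l)⁻¹ * FreeGroup.mk m).norm + 2 * commonPrefix l m = l.length + m.length := by
  induction l generalizing m with
  | nil =>
    have : (FreeGroup.mk m).norm = m.length := by
      rw [FreeGroup.norm, toWord_mk, hm.reduce_eq]
    simp only [commonPrefix, List.length_nil, ← FreeGroup.one_eq_mk, inv_one, one_mul, this]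
    omega
  | cons a l ih =>
    cases m with
    | nil =>
      have : (FreeGroup.mk (a :: l)).norm = (a :: l).length := by
        rw [FreeGroup.norm, toWord_mk, hl.reduce_eq]
      simp only [commonPrefix, ← FreeGroup.one_eq_mk, mul_one, norm_inv_eq, this, List.length_nil]
    | cons b m =>
      simp only [commonPrefix]
      split_ifs with h
      · subst h
        have h1 := ih m (hl.infix ⟨[a], [], by simp⟩) (hm.infix ⟨[a], [], by simp⟩)
        have h2 : ∀ k : List (α × Bool),
            FreeGroup.mk (a :: k) = FreeGroup.mk [a] * FreeGroup.mk k := by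
          intro k
          rw [FreeGroup.mul_mk]
          rfl
        rw [h2 l, h2 m]
        simp only [mul_inv_rev, List.length_cons]
        rw [mul_assoc, inv_mul_cancel_left]
        omega
      · rw [FreeGroup.inv_mk, FreeGroup.mul_mk, FreeGroup.norm, toWord_mk, IsReduced.reduce_eq]
        · simp [invRev_length]
        · rw [FreeGroup.IsReduced, List.isChain_append]
          refine ⟨?_, hm, ?_⟩
          · have : IsReduced (invRev (a :: l)) := by
              rw [isReduced_iff_reduce_eq, reduce_invRev, hl.reduce_eq]
            exact this
          · intro x hx y hy hxy
            simp only [invRev, List.map_cons, List.reverse_cons, List.getLast?_append,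
              List.getLast?_singleton, Option.some_or, Option.mem_def, Option.some.injEq] at hx
            simp only [List.head?_cons, Option.mem_def, Option.some.injEq] at hy
            subst hx hy
            simp only at hxy ⊢
            by_contra hne
            apply h
            ext
            · exact hxy
            · cases ha : a.2 <;> cases hb : b.2 <;> simp_all

/-- The Gromov product of two elements of a free group: the length of the common prefix of their
reduced words. -/
def gromov (x y : FreeGroup α) : ℕ := commonPrefix x.toWord y.toWord

theorem gromov_comm (x y : FreeGroup α) : gromov x y = gromov y x := commonPrefix_comm _ _

theorem gromov_self (x : FreeGroup α) : gromov x x = x.norm := commonPrefix_self _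

theorem min_gromov_le (x y z : FreeGroup α) : min (gromov x y) (gromov y z) ≤ gromov x z :=
  min_commonPrefix_le _ _ _

theorem norm_inv_mul (x y : FreeGroup α) :
    (x⁻¹ * y).norm + 2 * gromov x y = x.norm + y.norm := by
  have := norm_inv_mul_mk x.toWord y.toWord isReduced_toWord isReduced_toWord
  rwa [FreeGroup.mk_toWord, FreeGroup.mk_toWord] at this

theorem norm_mul_add (x y : FreeGroup α) :
    (x * y).norm + 2 * gromov x⁻¹ y = x.norm + y.norm := by
  have := norm_inv_mul x⁻¹ y
  simpa [norm_inv_eq] using this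

/-- Otherwise each letter in the first half of `x` would be inverse to its mirror image. In the
middle this gives two adjacent inverse letters (even length) or a letter equal to its own inverse
(odd length). -/
theorem two_mul_gromov_inv_lt {x : FreeGroup α} (hx : x ≠ 1) : 2 * gromov x⁻¹ x < x.norm := by
  by_contra hcon
  push Not at hcon
  set A := x.toWord with hA
  have hred : IsReduced A := isReduced_toWord
  have hnorm : x.norm = A.length := rfl
  have hpos : 0 < A.length := by
    rw [← hnorm, Nat.pos_iff_ne_zero, Ne, FreeGroup.norm_eq_zero]
    exact hx
  have htake : ∀ i (hi : i < gromov x⁻¹ x) (h1 : i < A.length) (h2 : A.length - 1 - i < A.length),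
      A[i] = (A[A.length - 1 - i].1, !A[A.length - 1 - i].2) := by
    intro i hi h1 h2
    have h := take_commonPrefix x⁻¹.toWord x.toWord
    have h3 : ((x⁻¹.toWord).take (gromov x⁻¹ x))[i]? = ((x.toWord).take (gromov x⁻¹ x))[i]? := by
      rw [gromov, h]
    rw [List.getElem?_take_of_lt hi, List.getElem?_take_of_lt hi, toWord_inv, ← hA] at h3
    rw [List.getElem?_eq_getElem (by simpa [invRev_length] using h1),
      List.getElem?_eq_getElem h1] at h3
    simp only [Option.some.injEq] at h3
    rw [← h3]
    simp [invRev, List.getElem_reverse]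
  rcases Nat.even_or_odd' A.length with ⟨k, hk | hk⟩
  · have h := htake (k - 1) (by omega) (by omega) (by omega)
    have hidx : A.length - 1 - (k - 1) = k - 1 + 1 := by omega
    have hch := (List.isChain_iff_getElem.mp hred) (k - 1) (by omega)
    simp only [hidx] at h
    rw [h] at hch
    simp at hch
  · have h := htake k (by omega) (by omega) (by omega)
    have hidx : A.length - 1 - k = k := by omega
    simp only [hidx] at h
    have := congrArg Prod.snd h
    simp at this

end GromovProduct

/-! ### Nielsen reduction and generation of the automorphism group of a free group. -/

section Nielsen

open FreeGroup

variable {α : Type*}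

/-- The inverse of a letter. -/
def letterInv (y : α × Bool) : α × Bool := (y.1, !y.2)

theorem letterInv_letterInv (y : α × Bool) : letterInv (letterInv y) = y := by
  simp [letterInv]

theorem mk_letterInv (y : α × Bool) : FreeGroup.mk [letterInv y] = (FreeGroup.mk [y])⁻¹ := by
  simp [letterInv, FreeGroup.inv_mk, invRev]

theorem eq_or_eq_letterInv {y z : α × Bool} (h : y.1 = z.1) : y = z ∨ y = letterInv z := by
  obtain ⟨i, b⟩ := y
  obtain ⟨j, c⟩ := z
  simp only at h
  subst h
  cases b <;> cases c <;> simp [letterInv]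

/-- A product of at least two letters of a Nielsen reduced tuple has length at least two. -/
theorem two_le_norm_of_reduced [DecidableEq α] (g : FreeGroup α →* FreeGroup α)
    (h0 : ∀ y : α × Bool, g (FreeGroup.mk [y]) ≠ 1)
    (h1 : ∀ y z : α × Bool, z ≠ letterInv y →
      2 * gromov (g (FreeGroup.mk [y]))⁻¹ (g (FreeGroup.mk [z])) ≤ (g (FreeGroup.mk [y])).norm)
    (h1' : ∀ y z : α × Bool, z ≠ letterInv y →
      2 * gromov (g (FreeGroup.mk [y]))⁻¹ (g (FreeGroup.mk [z])) ≤ (g (FreeGroup.mk [z])).norm)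
    (h2 : ∀ x y z : α × Bool, y ≠ letterInv x → z ≠ letterInv y →
      gromov (g (FreeGroup.mk [x]))⁻¹ (g (FreeGroup.mk [y])) +
        gromov (g (FreeGroup.mk [y]))⁻¹ (g (FreeGroup.mk [z])) < (g (FreeGroup.mk [y])).norm)
    (y : α × Bool) (L : List (α × Bool)) (hL : IsReduced (y :: L)) :
    (∀ x, y ≠ letterInv x → gromov (g (FreeGroup.mk [x]))⁻¹ (g (FreeGroup.mk [y])) <
      gromov (g (FreeGroup.mk (y :: L))) (g (FreeGroup.mk [y]))) ∧
    (L ≠ [] → 2 ≤ (g (FreeGroup.mk (y :: L))).norm) := by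
  have hpos : ∀ y : α × Bool, 0 < (g (FreeGroup.mk [y])).norm := fun y => by
    rw [Nat.pos_iff_ne_zero, Ne, FreeGroup.norm_eq_zero]
    exact h0 y
  -- The first conjunct is the induction invariant: the image of the word keeps a longer part of the
  -- image of its first letter than any admissible preceding letter can cancel.
  induction L generalizing y with
  | nil =>
    refine ⟨fun x hx => ?_, fun h => absurd rfl h⟩
    rw [gromov_self]
    have := h1' x y hx
    have := hpos y
    omega
  | cons y' L ih =>
    have hL' : IsReduced (y' :: L) := hL.infix ⟨[y], [], by simp⟩
    have hy' : y' ≠ letterInv y := by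
      rintro rfl
      have := (FreeGroup.isReduced_cons_cons.mp hL).1
      simp [letterInv] at this
    obtain ⟨iha, ihc⟩ := ih y' hL'
    have iha' := iha y hy'
    set w' := g (FreeGroup.mk (y' :: L)) with hw'
    set Y := g (FreeGroup.mk [y]) with hY
    set Y' := g (FreeGroup.mk [y']) with hY'
    have hw : g (FreeGroup.mk (y :: y' :: L)) = Y * w' := by
      rw [hY, hw', ← _root_.map_mul, FreeGroup.mul_mk]
      rfl
    rw [hw]
    -- By the strict inequality in the invariant and the ultrametric inequality, `Y` cancels against
    -- the whole word exactly as much as against its first factor `Y'`.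
    have hc : gromov Y⁻¹ w' = gromov Y⁻¹ Y' := by
      have e1 := min_gromov_le Y⁻¹ Y' w'
      have e2 := min_gromov_le Y⁻¹ w' Y'
      rw [gromov_comm Y' w'] at e1
      omega
    have e1 := norm_mul_add Y w'
    have e2 := norm_inv_mul (Y * w') Y
    have e3 : ((Y * w')⁻¹ * Y).norm = w'.norm := by
      rw [mul_inv_rev, mul_assoc, inv_mul_cancel, mul_one, norm_inv_eq]
    have e4 := h1 y y' hy'
    rw [← hY, ← hY'] at e4
    refine ⟨fun x hx => ?_, fun _ => ?_⟩
    · have := h2 x y y' hx hy'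
      rw [← hY, ← hY'] at this
      omega
    · by_cases hLn : L = []
      · have hwY : w' = Y' := by rw [hw', hY', hLn]
        have e5 := h1' y y' hy'
        have e6 := hpos y
        have e7 := hpos y'
        rw [← hY] at e5 e6
        rw [← hY'] at e5 e7
        rw [hwY] at e1 hc ⊢
        omega
      · have := ihc hLn
        omega

section Weight

variable [Fintype α]

/-- A numerical code of a word, injective on words of given length. -/
noncomputable def wordCode (L : List (α × Bool)) : ℕ :=
  Nat.ofDigits (Fintype.card (α × Bool) + 2)
    (L.map fun y => (Fintype.equivFin (α × Bool) y : ℕ))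

theorem wordCode_append (L M : List (α × Bool)) :
    wordCode (L ++ M) = wordCode L + (Fintype.card (α × Bool) + 2) ^ L.length * wordCode M := by
  simp [wordCode, Nat.ofDigits_append]

theorem wordCode_inj {L M : List (α × Bool)} (hlen : L.length = M.length)
    (h : wordCode L = wordCode M) : L = M := by
  have hb : ∀ (N : List (α × Bool)),
      ∀ l ∈ N.map fun y => (Fintype.equivFin (α × Bool) y : ℕ), l < Fintype.card (α × Bool) + 2 := by
    intro N l hl
    rw [List.mem_map] at hl
    obtain ⟨y, -, rfl⟩ := hl
    have := (Fintype.equivFin (α × Bool) y).isLt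
    omega
  -- The summand 2 in the base keeps it above 1 even for an empty alphabet.
  have := Nat.ofDigits_inj_of_len_eq (by omega) (by simpa using hlen) (hb L) (hb M) h
  refine List.map_injective_iff.mpr ?_ this
  intro a b hab
  exact (Fintype.equivFin (α × Bool)).injective (Fin.ext hab)

variable [DecidableEq α]

/-- The code of the initial half of the reduced word of `x`. -/
noncomputable def halfCode (x : FreeGroup α) : ℕ :=
  wordCode (x.toWord.take ((x.norm + 1) / 2))

/-- The sum of the codes of the initial halves of `x` and of its inverse. -/
noncomputable def weight (x : FreeGroup α) : ℕ := halfCode x + halfCode x⁻¹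

theorem weight_inv (x : FreeGroup α) : weight x⁻¹ = weight x := by
  rw [weight, weight, inv_inv, add_comm]

/-- Replacing the prefix `q` of `z` by `p` when `y = p q⁻¹`. -/
theorem weight_mul {y z : FreeGroup α} {m : ℕ} (hy : y.norm = 2 * m)
    (hyz : gromov y⁻¹ z = m) (hz : 2 * m ≤ z.norm) :
    weight (y * z) + wordCode (y⁻¹.toWord.take m) = weight z + wordCode (y.toWord.take m) := by
  set p := y.toWord.take m with hp
  set p2 := y.toWord.drop m with hp2
  have hylen : y.toWord.length = 2 * m := hy
  have hypp : y.toWord = p ++ p2 := (List.take_append_drop m _).symm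
  have hplen : p.length = m := by simp [hp, hylen]; omega
  have hp2len : p2.length = m := by simp [hp2, hylen]; omega
  have hq : y⁻¹.toWord.take m = invRev p2 := by
    rw [toWord_inv, hypp]
    have : invRev (p ++ p2) = invRev p2 ++ invRev p := by simp [invRev]
    rw [this, List.take_left' (by rw [invRev_length, hp2len])]
  rw [hq]
  set q := invRev p2 with hqdef
  have hqlen : q.length = m := by rw [hqdef, invRev_length, hp2len]
  set r := z.toWord.drop m with hr
  have hzq : z.toWord = q ++ r := by
    have h := take_commonPrefix y⁻¹.toWord z.toWord
    change (y⁻¹.toWord).take (gromov y⁻¹ z) = (z.toWord).take (gromov y⁻¹ z) at h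
    rw [hyz, hq] at h
    rw [h, hr, List.take_append_drop]
  have hnorm : (y * z).norm = z.norm := by
    have := norm_mul_add y z
    omega
  have hyzw : (y * z).toWord = p ++ r := by
    have h1 : y * z = FreeGroup.mk (p ++ r) := by
      rw [← FreeGroup.mk_toWord (x := y), ← FreeGroup.mk_toWord (x := z), hypp, hzq]
      rw [← FreeGroup.mul_mk, ← FreeGroup.mul_mk, ← FreeGroup.mul_mk, hqdef, ← FreeGroup.inv_mk]
      group
    have h2 : (y * z).toWord.Sublist (p ++ r) := by
      rw [h1, toWord_mk]
      exact (reduce.red).sublist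
    refine h2.eq_of_length ?_
    change (y * z).norm = _
    rw [hnorm]
    change z.toWord.length = _
    rw [hzq]
    simp [hplen, hqlen]
  have hzlen : z.norm = m + r.length := by
    change z.toWord.length = _
    rw [hzq, List.length_append, hqlen]
  have hA : halfCode (y * z) + wordCode q = halfCode z + wordCode p := by
    have htake : ∀ a : List (α × Bool), a.length = m → (a ++ r).take ((z.norm + 1) / 2) =
        a ++ r.take ((z.norm + 1) / 2 - m) := by
      intro a ha
      rw [List.take_append, List.take_of_length_le (by omega), ha]
    rw [halfCode, halfCode, hnorm, hyzw, hzq, htake p hplen, htake q hqlen,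
      wordCode_append, wordCode_append, hplen, hqlen]
    ring
  -- Since `z` has length at least 2m, the initial half of its inverse lies within the inverse of
  -- `r`, which is untouched. Only the first summand of the weight changes.
  have hB : halfCode (y * z)⁻¹ = halfCode z⁻¹ := by
    have hinv : ∀ a : List (α × Bool), invRev (a ++ r) = invRev r ++ invRev a := by
      intro a
      simp [invRev]
    rw [halfCode, halfCode, norm_inv_eq, norm_inv_eq, hnorm, toWord_inv, toWord_inv, hyzw, hzq,
      hinv, hinv, List.take_append_of_le_length (by rw [invRev_length]; omega),
      List.take_append_of_le_length (by rw [invRev_length]; omega)]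
  rw [weight, weight, hB]
  omega

/-- If a tuple of elements of a free group has minimal length, and minimal weight among the tuples
of the same length, then no letter is cancelled completely by its neighbours. -/
theorem gromov_add_gromov_lt {x y z : FreeGroup α} (hy : y ≠ 1)
    (hx1 : x.norm ≤ (y⁻¹ * x).norm) (hz1 : z.norm ≤ (y * z).norm)
    (hx2 : 2 * gromov x y ≤ x.norm) (hz2 : 2 * gromov y⁻¹ z ≤ z.norm)
    (hxw : (y⁻¹ * x).norm = x.norm → weight x ≤ weight (y⁻¹ * x))
    (hzw : (y * z).norm = z.norm → weight z ≤ weight (y * z)) :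
    gromov x y + gromov y⁻¹ z < y.norm := by
  by_contra hcon
  have e1 := norm_mul_add y z
  have e2 := norm_mul_add y⁻¹ x
  rw [inv_inv, norm_inv_eq, gromov_comm] at e2
  -- Minimal length bounds each cancellation by half of `y`, so complete cancellation means exactly
  -- half on both sides. With y = p q⁻¹ cut in the middle, the two weight inequalities compare the
  -- codes of p and q in opposite directions. Hence p = q and y = 1.
  obtain ⟨m, hm⟩ : ∃ m, gromov x y = m := ⟨_, rfl⟩
  have hm2 : gromov y⁻¹ z = m := by omega
  have hyn : y.norm = 2 * m := by omega
  have w1 := weight_mul hyn hm2 (by omega)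
  have w2 := weight_mul (y := y⁻¹) (z := x) (m := m) (by rw [norm_inv_eq, hyn])
    (by rw [inv_inv, gromov_comm, hm]) (by omega)
  rw [inv_inv] at w2
  have hxw := hxw (by omega)
  have hzw := hzw (by omega)
  have hylen : y.toWord.length = 2 * m := hyn
  have hcode : y.toWord.take m = y⁻¹.toWord.take m := by
    apply wordCode_inj
    · simp [toWord_inv, invRev_length]
    · omega
  have hdrop : y⁻¹.toWord.take m = invRev (y.toWord.drop m) := by
    conv_lhs => rw [toWord_inv, ← List.take_append_drop m y.toWord]
    have : ∀ a b : List (α × Bool), invRev (a ++ b) = invRev b ++ invRev a := by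
      intro a b
      simp [invRev]
    rw [this, List.take_left' (by rw [invRev_length, List.length_drop]; omega)]
  apply hy
  rw [← FreeGroup.mk_toWord (x := y), ← List.take_append_drop m y.toWord, hcode, hdrop,
    ← FreeGroup.mul_mk, ← FreeGroup.inv_mk, inv_mul_cancel]

end Weight

/-- **Nielsen's theorem.** A subgroup of the automorphism group of a free group of finite rank that
contains all transvections and all signed permutations of the generators is the whole group. -/
theorem nielsen_generation [DecidableEq α] [Fintype α] (N : Subgroup (MulAut (FreeGroup α)))
    (hmove : ∀ y z : α × Bool, y.1 ≠ z.1 → ∃ ν ∈ N,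
      (∀ k, k ≠ z.1 → ν (FreeGroup.of k) = FreeGroup.of k) ∧
      ν (FreeGroup.mk [z]) = FreeGroup.mk [y] * FreeGroup.mk [z])
    (hperm : ∀ g : MulAut (FreeGroup α),
      (∀ j, ∃ y : α × Bool, g (FreeGroup.mk [y]) = FreeGroup.of j) → g ∈ N)
    (f : MulAut (FreeGroup α)) : f ∈ N := by
  -- Total length first, total weight second. The lexicographic order is well founded, so a minimum
  -- over `N` exists, and the tuple it gives is Nielsen reduced.
  let Φ : N → ℕ ×ₗ ℕ := fun ν =>
    toLex (∑ i, ((f * ν) (FreeGroup.of i)).norm, ∑ i, weight ((f * ν) (FreeGroup.of i)))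
  obtain ⟨ν, hν⟩ : ∃ ν, ∀ μ, Φ ν ≤ Φ μ :=
    ⟨Function.argmin Φ, fun μ => not_lt.mp (Function.not_lt_argmin Φ μ)⟩
  set g : MulAut (FreeGroup α) := f * ν with hg
  have hsym : ∀ (F : FreeGroup α → ℕ), (∀ x, F x⁻¹ = F x) → ∀ (h : MulAut (FreeGroup α))
      (z : α × Bool), F (h (FreeGroup.of z.1)) = F (h (FreeGroup.mk [z])) := by
    rintro F hF h ⟨i, b⟩
    cases b
    · rw [show FreeGroup.mk [(i, false)] = (FreeGroup.of i)⁻¹ from rfl, _root_.map_inv, hF]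
    · rfl
  have hmin : ∀ y z : α × Bool, y.1 ≠ z.1 →
      (g (FreeGroup.mk [z])).norm ≤ (g (FreeGroup.mk [y]) * g (FreeGroup.mk [z])).norm ∧
      ((g (FreeGroup.mk [y]) * g (FreeGroup.mk [z])).norm = (g (FreeGroup.mk [z])).norm →
        weight (g (FreeGroup.mk [z])) ≤ weight (g (FreeGroup.mk [y]) * g (FreeGroup.mk [z]))) := by
    intro y z hyz
    obtain ⟨μ, hμN, hμ1, hμ2⟩ := hmove y z hyz
    have hle := hν (ν * ⟨μ, hμN⟩)
    have hgμ : f * ((ν * ⟨μ, hμN⟩ : N) : MulAut (FreeGroup α)) = g * μ := by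
      rw [hg, mul_assoc]
      rfl
    have hsum : ∀ (F : FreeGroup α → ℕ), (∀ x, F x⁻¹ = F x) →
        ∑ i, F ((g * μ) (FreeGroup.of i)) + F (g (FreeGroup.mk [z])) =
        ∑ i, F (g (FreeGroup.of i)) + F (g (FreeGroup.mk [y]) * g (FreeGroup.mk [z])) := by
      intro F hF
      rw [← Finset.add_sum_erase _ _ (Finset.mem_univ z.1),
        ← Finset.add_sum_erase _ (fun i => F (g (FreeGroup.of i))) (Finset.mem_univ z.1),
        hsym F hF (g * μ) z, hsym F hF g z, MulAut.mul_apply, hμ2, _root_.map_mul]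
      have : ∑ x ∈ Finset.univ.erase z.1, F ((g * μ) (FreeGroup.of x)) =
          ∑ x ∈ Finset.univ.erase z.1, F (g (FreeGroup.of x)) := by
        refine Finset.sum_congr rfl fun k hk => ?_
        rw [MulAut.mul_apply, hμ1 k (Finset.ne_of_mem_erase hk)]
      rw [this]
      ring
    have hs1 := hsum FreeGroup.norm fun x => norm_inv_eq
    have hs2 := hsum weight weight_inv
    have hle' : toLex (∑ i, (g (FreeGroup.of i)).norm, ∑ i, weight (g (FreeGroup.of i))) ≤
        toLex (∑ i, ((g * μ) (FreeGroup.of i)).norm, ∑ i, weight ((g * μ) (FreeGroup.of i))) := by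
      rw [← hgμ]
      exact hle
    rw [Prod.Lex.toLex_le_toLex] at hle'
    simp only at hle'
    refine ⟨?_, fun h => ?_⟩ <;> omega
  have h0 : ∀ y : α × Bool, g (FreeGroup.mk [y]) ≠ 1 := by
    intro y hy
    rw [map_eq_one_iff g g.injective, ← FreeGroup.toWord_eq_nil_iff, toWord_mk,
      reduce_singleton] at hy
    exact absurd hy (by simp)
  have hinv : ∀ y : α × Bool, g (FreeGroup.mk [letterInv y]) = (g (FreeGroup.mk [y]))⁻¹ := by
    intro y
    rw [mk_letterInv, _root_.map_inv]
  have hN1 : ∀ y z : α × Bool, z ≠ letterInv y →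
      2 * gromov (g (FreeGroup.mk [y]))⁻¹ (g (FreeGroup.mk [z])) ≤
        (g (FreeGroup.mk [y])).norm := by
    intro y z hyz
    by_cases hne : y.1 = z.1
    · rcases eq_or_eq_letterInv hne with rfl | rfl
      · exact (two_mul_gromov_inv_lt (h0 y)).le
      · rw [letterInv_letterInv] at hyz
        exact absurd rfl hyz
    · have := (hmin y z hne).1
      have := norm_mul_add (g (FreeGroup.mk [y])) (g (FreeGroup.mk [z]))
      omega
  have hN1' : ∀ y z : α × Bool, z ≠ letterInv y →
      2 * gromov (g (FreeGroup.mk [y]))⁻¹ (g (FreeGroup.mk [z])) ≤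
        (g (FreeGroup.mk [z])).norm := by
    intro y z hyz
    have := hN1 (letterInv z) (letterInv y) (by
      rw [letterInv_letterInv]
      exact hyz.symm)
    rwa [hinv, hinv, inv_inv, norm_inv_eq, gromov_comm] at this
  have hN2 : ∀ x y z : α × Bool, y ≠ letterInv x → z ≠ letterInv y →
      gromov (g (FreeGroup.mk [x]))⁻¹ (g (FreeGroup.mk [y])) +
        gromov (g (FreeGroup.mk [y]))⁻¹ (g (FreeGroup.mk [z])) <
          (g (FreeGroup.mk [y])).norm := by
    intro x y z hxy hyz
    have hlt := two_mul_gromov_inv_lt (h0 y)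
    have e1 := hN1' x y hxy
    have e2 := hN1 y z hyz
    by_cases hne : x.1 = y.1
    · rcases eq_or_eq_letterInv hne with rfl | rfl
      · omega
      · rw [letterInv_letterInv] at hxy
        exact absurd rfl hxy
    by_cases hne' : y.1 = z.1
    · rcases eq_or_eq_letterInv hne' with rfl | rfl
      · omega
      · rw [letterInv_letterInv] at hyz
        exact absurd rfl hyz
    have hm1 := hmin (letterInv y) (letterInv x) (Ne.symm hne)
    have hm2 := hmin y z hne'
    rw [hinv, hinv] at hm1
    exact gromov_add_gromov_lt (h0 y) hm1.1 hm2.1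
      (by rw [norm_inv_eq]; exact hN1 x y hxy) (hN1' y z hyz) hm1.2 hm2.2
  -- A generator is the image of some reduced word, and words with at least two letters have images
  -- of length at least two. So it is the image of a single letter, and `g` is a signed permutation.
  have hgN : g ∈ N := by
    refine hperm g fun j => ?_
    obtain ⟨x, hx⟩ := g.surjective (FreeGroup.of j)
    have hred : FreeGroup.IsReduced x.toWord := isReduced_toWord
    match hw : x.toWord with
    | [] =>
      rw [toWord_eq_nil_iff] at hw
      rw [hw, _root_.map_one] at hx
      exact absurd hx.symm (FreeGroup.of_ne_one j)
    | y :: L =>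
      rw [hw] at hred
      have h2 := (two_le_norm_of_reduced g.toMonoidHom h0 hN1 hN1' hN2 y L hred).2
      have hxL : g (FreeGroup.mk (y :: L)) = FreeGroup.of j := by
        rw [← hw, FreeGroup.mk_toWord, hx]
      by_cases hL : L = []
      · exact ⟨y, by rw [← hxL, hL]⟩
      · have h3 : 2 ≤ (g (FreeGroup.mk (y :: L))).norm := h2 hL
        rw [hxL, norm_of] at h3
        omega
  have : f = g * (ν : MulAut (FreeGroup α))⁻¹ := by
    rw [hg, mul_inv_cancel_right]
  rw [this]
  exact N.mul_mem hgN (N.inv_mem ν.2)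

end Nielsen

/-! ### Explicit automorphisms and relations in Out(F_3). -/

section Automorphisms

theorem mulAut_ext {α : Type*} {f g : MulAut (FreeGroup α)}
    (h : ∀ i, f (FreeGroup.of i) = g (FreeGroup.of i)) : f = g := by
  have : f.toMonoidHom = g.toMonoidHom := FreeGroup.ext_hom _ _ h
  exact MulEquiv.ext fun x => DFunLike.congr_fun this x

theorem epsAut_of {n : ℕ} (i j : Fin n) :
    epsAut i (FreeGroup.of j) = if j = i then (FreeGroup.of j)⁻¹ else FreeGroup.of j := by
  simp [epsAut, epsHom]

/-- The automorphism `a₀ ↦ a₀ a₁⁻¹` fixing `a₁` and `a₂`. -/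
def transAut : MulAut (FreeGroup (Fin 3)) :=
  MonoidHom.toMulEquiv
    (FreeGroup.lift ![FreeGroup.of 0 * (FreeGroup.of 1)⁻¹, FreeGroup.of 1, FreeGroup.of 2])
    (FreeGroup.lift ![FreeGroup.of 0 * FreeGroup.of 1, FreeGroup.of 1, FreeGroup.of 2])
    (by
      ext i
      fin_cases i <;> simp)
    (by
      ext i
      fin_cases i <;> simp)

theorem transAut_zero :
    transAut (FreeGroup.of 0) = FreeGroup.of 0 * (FreeGroup.of 1)⁻¹ := by
  simp [transAut]

theorem transAut_one : transAut (FreeGroup.of 1) = FreeGroup.of 1 := by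
  simp [transAut]

theorem transAut_two : transAut (FreeGroup.of 2) = FreeGroup.of 2 := by
  simp [transAut]

/-- The automorphism of a free group permuting the generators. -/
def permAut {n : ℕ} : Equiv.Perm (Fin n) →* MulAut (FreeGroup (Fin n)) where
  toFun κ := FreeGroup.freeGroupCongr κ
  map_one' := mulAut_ext fun i => by simp
  map_mul' κ κ' := mulAut_ext fun i => by simp

theorem permAut_of {n : ℕ} (κ : Equiv.Perm (Fin n)) (i : Fin n) :
    permAut κ (FreeGroup.of i) = FreeGroup.of (κ i) := by
  simp [permAut]

theorem symAut_swap_eq_permAut {n : ℕ} (i j : Fin n) :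
    symAut n (Equiv.swap i.castSucc j.castSucc) = permAut (Equiv.swap i j) :=
  mulAut_ext fun k => by rw [symAut_swap_castSucc, permAut_of]

end Automorphisms

section Outer

/-- The class of `a₀ ↦ a₀ a₁⁻¹` in `Out(F₃)`. -/
def trans : OutF 3 := QuotientGroup.mk transAut

/-- The class of the automorphism interchanging two generators. -/
def permOut : Equiv.Perm (Fin 3) →* OutF 3 :=
  (QuotientGroup.mk' (Inn (FreeGroup (Fin 3)))).comp permAut

theorem symOut_swap (i j : Fin 3) :
    symOut 3 (Equiv.swap i.castSucc j.castSucc) = permOut (Equiv.swap i j) := by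
  simp only [symOut, permOut, MonoidHom.comp_apply, symAut_swap_eq_permAut]

theorem eps_mul_self (i : Fin 3) : (eps i : OutF 3) * eps i = 1 := by
  have : epsAut i * epsAut i = 1 := mulAut_ext fun j => by
    simp only [MulAut.mul_apply, epsAut_of, MulAut.one_apply]
    split_ifs with h <;> simp [epsAut_of, h]
  rw [eps, ← QuotientGroup.mk_mul, this]
  rfl

theorem eps_comm (i j : Fin 3) : (eps i : OutF 3) * eps j = eps j * eps i := by
  have : epsAut i * epsAut j = epsAut j * epsAut i := mulAut_ext fun k => by
    simp only [MulAut.mul_apply, epsAut_of]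
    split_ifs <;> simp_all [epsAut_of]
  rw [eps, eps, ← QuotientGroup.mk_mul, this]
  rfl

theorem permOut_mul_eps (κ : Equiv.Perm (Fin 3)) (i : Fin 3) :
    permOut κ * eps i = eps (κ i) * permOut κ := by
  have : permAut κ * epsAut i = epsAut (κ i) * permAut κ := mulAut_ext fun k => by
    simp only [MulAut.mul_apply, epsAut_of, permAut_of, EmbeddingLike.apply_eq_iff_eq]
    split_ifs <;> simp [permAut_of]
  change ((permAut κ * epsAut i : MulAut (FreeGroup (Fin 3))) : OutF 3) = _
  rw [this]
  rfl

theorem trans_mul_eps_two : trans * eps 2 = eps 2 * trans := by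
  have : transAut * epsAut 2 = epsAut 2 * transAut := mulAut_ext fun k => by
    fin_cases k <;> simp [epsAut_of, transAut_zero, transAut_one, transAut_two]
  change ((transAut * epsAut 2 : MulAut (FreeGroup (Fin 3))) : OutF 3) = _
  rw [this]
  rfl

theorem trans_mul_eps_one_mul_trans : trans * eps 1 * trans = eps 1 := by
  have : transAut * epsAut 1 * transAut = epsAut 1 := mulAut_ext fun k => by
    fin_cases k <;> simp [epsAut_of, transAut_zero, transAut_one, transAut_two]
  change ((transAut * epsAut 1 * transAut : MulAut (FreeGroup (Fin 3))) : OutF 3) = _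
  rw [this]
  rfl

/-- The product with ε_1 sends a_1 to a_1⁻¹ and a_0 to a_0 a_1⁻¹: on ⟨a_0, a_1⟩ it is the additional
transposition of S_3 < Aut(F_2), which braids with the swap of a_0 and a_1. -/
theorem trans_braid :
    trans * eps 1 * permOut (Equiv.swap 0 1) * (trans * eps 1) =
      permOut (Equiv.swap 0 1) * (trans * eps 1) * permOut (Equiv.swap 0 1) := by
  have : transAut * epsAut 1 * permAut (Equiv.swap 0 1) * (transAut * epsAut 1) =
      permAut (Equiv.swap 0 1) * (transAut * epsAut 1) * permAut (Equiv.swap 0 1) :=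
    mulAut_ext fun k => by
      fin_cases k <;>
        simp [epsAut_of, permAut_of, transAut_zero, transAut_one, transAut_two,
          Equiv.swap_apply_of_ne_of_ne]
  change ((transAut * epsAut 1 * permAut (Equiv.swap 0 1) * (transAut * epsAut 1) :
    MulAut (FreeGroup (Fin 3))) : OutF 3) = _
  rw [this]
  rfl

/-- The class of `a₂ ↦ a₂ a₁⁻¹` in `Out(F₃)`. -/
def trans21 : OutF 3 := permOut (Equiv.swap 0 2) * trans * permOut (Equiv.swap 0 2)

/-- The class of `a₀ ↦ a₀ a₂⁻¹` in `Out(F₃)`. -/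
def trans02 : OutF 3 := permOut (Equiv.swap 1 2) * trans * permOut (Equiv.swap 1 2)

/-- The automorphism `a₂ ↦ a₂ a₁⁻¹`. -/
def transAut21 : MulAut (FreeGroup (Fin 3)) :=
  permAut (Equiv.swap 0 2) * transAut * permAut (Equiv.swap 0 2)

/-- The automorphism `a₀ ↦ a₀ a₂⁻¹`. -/
def transAut02 : MulAut (FreeGroup (Fin 3)) :=
  permAut (Equiv.swap 1 2) * transAut * permAut (Equiv.swap 1 2)

theorem transAut21_zero : transAut21 (FreeGroup.of 0) = FreeGroup.of 0 := by
  simp [transAut21, permAut_of, transAut_two]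

theorem transAut21_one : transAut21 (FreeGroup.of 1) = FreeGroup.of 1 := by
  simp [transAut21, permAut_of, transAut_one, Equiv.swap_apply_of_ne_of_ne]

theorem transAut21_two :
    transAut21 (FreeGroup.of 2) = FreeGroup.of 2 * (FreeGroup.of 1)⁻¹ := by
  simp [transAut21, permAut_of, transAut_zero, Equiv.swap_apply_of_ne_of_ne]

theorem transAut02_zero :
    transAut02 (FreeGroup.of 0) = FreeGroup.of 0 * (FreeGroup.of 2)⁻¹ := by
  simp [transAut02, permAut_of, transAut_zero, Equiv.swap_apply_of_ne_of_ne]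

theorem transAut02_one : transAut02 (FreeGroup.of 1) = FreeGroup.of 1 := by
  simp [transAut02, permAut_of, transAut_two]

theorem transAut02_two : transAut02 (FreeGroup.of 2) = FreeGroup.of 2 := by
  simp [transAut02, permAut_of, transAut_one]

theorem trans_mul_trans21 : trans * trans21 = trans21 * trans := by
  have : transAut * transAut21 = transAut21 * transAut := mulAut_ext fun k => by
    fin_cases k <;>
      simp [transAut21_zero, transAut21_one, transAut21_two, transAut_zero, transAut_one,
        transAut_two]
  change ((transAut * transAut21 : MulAut (FreeGroup (Fin 3))) : OutF 3) = _
  rw [this]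
  rfl

/-- Conjugation by ε_0 ε_2 turns `trans02` into the left multiplication a_0 ↦ a_2⁻¹ a_0, which
commutes with right multiplication of a_0 by a_1⁻¹. -/
theorem trans_mul_left_trans02 :
    trans * (eps 0 * eps 2 * trans02 * eps 0 * eps 2) =
      eps 0 * eps 2 * trans02 * eps 0 * eps 2 * trans := by
  have : transAut * (epsAut 0 * epsAut 2 * transAut02 * epsAut 0 * epsAut 2) =
      epsAut 0 * epsAut 2 * transAut02 * epsAut 0 * epsAut 2 * transAut := mulAut_ext fun k => by
    fin_cases k <;>
      simp [transAut02_zero, transAut02_one, transAut02_two, transAut_zero, transAut_one,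
        transAut_two, epsAut_of, mul_assoc]
  change ((transAut * (epsAut 0 * epsAut 2 * transAut02 * epsAut 0 * epsAut 2) :
    MulAut (FreeGroup (Fin 3))) : OutF 3) = _
  rw [this]
  rfl

/-- A Steinberg commutator relation: up to order and sign, `trans` is the commutator of the other
two transvections. -/
theorem trans_mul_trans21_mul_trans02 : trans * trans21 * trans02 = trans02 * trans21 := by
  have : transAut * transAut21 * transAut02 = transAut02 * transAut21 := mulAut_ext fun k => by
    fin_cases k <;>
      simp [transAut02_zero, transAut02_one, transAut02_two, transAut_zero, transAut_one,
        transAut_two, transAut21_zero, transAut21_one, transAut21_two]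
  change ((transAut * transAut21 * transAut02 : MulAut (FreeGroup (Fin 3))) : OutF 3) = _
  rw [this]
  rfl

/-- This relation needs outer classes: in Aut(F_3) the two sides differ by conjugation by a_1. -/
theorem trans_mul_trans21_comm_eps :
    trans * trans21 * (eps 0 * eps 1 * eps 2) = eps 0 * eps 1 * eps 2 * (trans * trans21) := by
  have : transAut * transAut21 * (epsAut 0 * epsAut 1 * epsAut 2) =
      MulAut.conj (FreeGroup.of 1) *
        (epsAut 0 * epsAut 1 * epsAut 2 * (transAut * transAut21)) := mulAut_ext fun k => by
    fin_cases k <;>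
      simp [transAut_zero, transAut_one, MulAut.conj_apply,
        transAut_two, transAut21_zero, transAut21_one, transAut21_two, epsAut_of, mul_assoc]
  change ((transAut * transAut21 * (epsAut 0 * epsAut 1 * epsAut 2) :
    MulAut (FreeGroup (Fin 3))) : OutF 3) = _
  rw [this, QuotientGroup.mk_mul]
  have h1 : ((MulAut.conj (FreeGroup.of (1 : Fin 3)) : MulAut (FreeGroup (Fin 3))) : OutF 3) = 1 :=
    (QuotientGroup.eq_one_iff _).mpr ⟨_, rfl⟩
  rw [h1, one_mul]
  rfl

theorem symOut_swap_one_last :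
    symOut 3 (Equiv.swap 1 3) = trans * trans21 * eps 1 := by
  have : symAut 3 (Equiv.swap (Fin.castSucc 1) (Fin.last 3)) =
      transAut * transAut21 * epsAut 1 := mulAut_ext fun k => by
    by_cases hk : k = 1
    · subst hk
      rw [symAut_swap_last_self]
      simp [transAut_one, transAut21_one, epsAut_of]
    · rw [symAut_swap_last _ _ hk]
      fin_cases k <;>
        simp_all [transAut_zero, transAut_one,
          transAut_two, transAut21_zero, transAut21_two, epsAut_of]
  change ((symAut 3 (Equiv.swap (Fin.castSucc 1) (Fin.last 3)) :
    MulAut (FreeGroup (Fin 3))) : OutF 3) = _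
  rw [this]
  rfl

/-- Conjugating `trans` by permutations, and conjugating by ε_i or inverting, yields every move
required by `nielsen_generation`. A signed permutation is a permutation times a product of ε_i. -/
theorem outF_three_generation (H : Subgroup (OutF 3)) (he : ∀ i, eps i ∈ H)
    (hs : ∀ i j, permOut (Equiv.swap i j) ∈ H) (ht : trans ∈ H) (g : OutF 3) : g ∈ H := by
  set N : Subgroup (MulAut (FreeGroup (Fin 3))) :=
    H.comap (QuotientGroup.mk' (Inn (FreeGroup (Fin 3)))) with hN
  have heN : ∀ i, epsAut i ∈ N := fun i => he i
  have htN : transAut ∈ N := ht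
  have hpN : ∀ κ : Equiv.Perm (Fin 3), permAut κ ∈ N := by
    intro κ
    induction κ using Equiv.Perm.swap_induction_on with
    | one => rw [map_one]; exact N.one_mem
    | swap_mul f x y hxy hf =>
      rw [map_mul]
      exact N.mul_mem (hs x y) hf
  obtain ⟨f, rfl⟩ := QuotientGroup.mk_surjective g
  change f ∈ N
  refine nielsen_generation N ?_ ?_ f
  · have hπ : ∀ i j : Fin 3, i ≠ j → ∃ π : Equiv.Perm (Fin 3), π 0 = i ∧ π 1 = j := by decide
    have hbase : ∀ i j : Fin 3, i ≠ j → ∃ ν ∈ N, (∀ k, k ≠ i → ν (FreeGroup.of k) = FreeGroup.of k) ∧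
        ν (FreeGroup.of i) = FreeGroup.of i * (FreeGroup.of j)⁻¹ := by
      intro i j hij
      obtain ⟨π, rfl, rfl⟩ := hπ i j hij
      have hinv : ∀ l, permAut π⁻¹ (FreeGroup.of (π l)) = FreeGroup.of l := fun l => by
        rw [permAut_of]
        simp
      refine ⟨permAut π * transAut * permAut π⁻¹,
        N.mul_mem (N.mul_mem (hpN π) htN) (hpN _), fun k hk => ?_, ?_⟩
      · obtain ⟨l, rfl⟩ := π.surjective k
        have hl : l ≠ 0 := fun h => hk (by rw [h])
        rw [MulAut.mul_apply, MulAut.mul_apply, hinv]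
        fin_cases l
        · exact absurd rfl hl
        · simp [transAut_one, permAut_of]
        · simp [transAut_two, permAut_of]
      · rw [MulAut.mul_apply, MulAut.mul_apply, hinv]
        simp [permAut_of, transAut_zero]
    have hpos : ∀ (i j : Fin 3) (b : Bool), i ≠ j → ∃ ν ∈ N,
        (∀ k, k ≠ i → ν (FreeGroup.of k) = FreeGroup.of k) ∧
        ν (FreeGroup.mk [(i, b)]) = FreeGroup.of j * FreeGroup.mk [(i, b)] := by
      intro i j b hij
      obtain ⟨ν, hνN, hν1, hν2⟩ := hbase i j hij
      cases b
      · refine ⟨ν, hνN, hν1, ?_⟩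
        change ν (FreeGroup.of i)⁻¹ = FreeGroup.of j * (FreeGroup.of i)⁻¹
        simp [hν2]
      · refine ⟨epsAut i * ν * epsAut i, N.mul_mem (N.mul_mem (heN i) hνN) (heN i),
          fun k hk => ?_, ?_⟩
        · simp [epsAut_of, hk, hν1 k hk]
        · change (epsAut i * ν * epsAut i) (FreeGroup.of i) = FreeGroup.of j * FreeGroup.of i
          simp [epsAut_of, hν2, hij.symm]
    rintro ⟨j, c⟩ ⟨i, b⟩ hji
    obtain ⟨ν, hνN, hν1, hν2⟩ := hpos i j b (Ne.symm hji)
    cases c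
    · refine ⟨ν⁻¹, N.inv_mem hνN, fun k hk => ?_, ?_⟩
      · rw [MulAut.inv_apply, MulEquiv.symm_apply_eq, hν1 k hk]
      · rw [MulAut.inv_apply, MulEquiv.symm_apply_eq, map_mul, hν2]
        change _ = ν (FreeGroup.of j)⁻¹ * _
        rw [map_inv, hν1 j hji, inv_mul_cancel_left]
    · exact ⟨ν, hνN, hν1, hν2⟩
  · intro g hg
    choose y hy using hg
    have hg' : ∀ j, g (FreeGroup.of (y j).1) = FreeGroup.of j ∨
        g (FreeGroup.of (y j).1) = (FreeGroup.of j)⁻¹ := by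
      intro j
      have h := hy j
      generalize y j = l at h ⊢
      obtain ⟨i, b⟩ := l
      cases b
      · right
        change g (FreeGroup.of i)⁻¹ = _ at h
        rw [← h, map_inv, inv_inv]
      · exact Or.inl h
    have hne : ∀ i j : Fin 3, (FreeGroup.of i) ≠ (FreeGroup.of j)⁻¹ := by
      intro i j h
      have := congrArg FreeGroup.toWord h
      simp [FreeGroup.toWord_inv, FreeGroup.invRev] at this
    have hinj : Function.Injective fun j => (y j).1 := by
      intro i j hij
      have hi := hg' i
      have hj := hg' j
      simp only at hij
      rw [hij] at hi
      rcases hi with hi | hi <;> rcases hj with hj | hj <;> rw [hi] at hj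
      · exact FreeGroup.of_injective hj
      · exact absurd hj (hne _ _)
      · exact absurd hj.symm (hne _ _)
      · exact FreeGroup.of_injective (inv_injective hj)
    obtain ⟨κ, hκ⟩ : ∃ κ : Equiv.Perm (Fin 3), ∀ j, κ j = (y j).1 :=
      ⟨Equiv.ofBijective _ (Finite.injective_iff_bijective.mp hinj), fun j => rfl⟩
    have hh : ∀ j, (g * permAut κ) (FreeGroup.of j) = FreeGroup.of j ∨
        (g * permAut κ) (FreeGroup.of j) = (FreeGroup.of j)⁻¹ := by
      intro j
      rw [MulAut.mul_apply, permAut_of, hκ]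
      exact hg' j
    have hmem : g * permAut κ ∈ N := by
      have hcase : ∀ b : Fin 3 → Bool, ∃ ν ∈ N, ∀ j, ν (FreeGroup.of j) =
          if b j then (FreeGroup.of j)⁻¹ else FreeGroup.of j := by
        intro b
        have hb : ∀ i, (if b i then epsAut i else 1) ∈ N := fun i => by
          split_ifs
          · exact heN i
          · exact N.one_mem
        refine ⟨(if b 0 then epsAut 0 else 1) * (if b 1 then epsAut 1 else 1) *
          (if b 2 then epsAut 2 else 1), N.mul_mem (N.mul_mem (hb 0) (hb 1)) (hb 2), fun j => ?_⟩
        cases h0 : b 0 <;> cases h1 : b 1 <;> cases h2 : b 2 <;> fin_cases j <;>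
          simp [epsAut_of, h0, h1, h2]
      classical
      obtain ⟨ν, hνN, hν⟩ := hcase fun j =>
        decide ((g * permAut κ) (FreeGroup.of j) = (FreeGroup.of j)⁻¹)
      have : g * permAut κ = ν := mulAut_ext fun j => by
        rw [hν]
        by_cases h : (g * permAut κ) (FreeGroup.of j) = (FreeGroup.of j)⁻¹
        · simp only [h, decide_true, if_true]
        · simp only [h, decide_false, Bool.false_eq_true, if_false]
          exact (hh j).resolve_right h
      rw [this]
      exact hνN
    have : g = g * permAut κ * (permAut κ)⁻¹ := by rw [mul_inv_cancel_right]
    rw [this]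
    exact N.mul_mem hmem (N.inv_mem (hpN κ))

end Outer

/-! ### The determinant character and its restriction to S_4. -/

section Determinant

variable {n : ℕ}

/-- The vector of exponent sums of a word. -/
def expSum : FreeGroup (Fin n) →* Multiplicative (Fin n → ℤ) :=
  FreeGroup.lift fun i => Multiplicative.ofAdd (Pi.single i 1)

/-- The matrix of the action of an endomorphism on the abelianization of the free group. -/
def abMatrix (f : FreeGroup (Fin n) →* FreeGroup (Fin n)) : Matrix (Fin n) (Fin n) ℤ :=
  Matrix.of fun i j => Multiplicative.toAdd (expSum (f (FreeGroup.of j))) i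

theorem expSum_apply (f : FreeGroup (Fin n) →* FreeGroup (Fin n)) (x : FreeGroup (Fin n)) :
    Multiplicative.toAdd (expSum (f x)) =
      (abMatrix f).mulVec (Multiplicative.toAdd (expSum x)) := by
  have : expSum.comp f =
      (AddMonoidHom.toMultiplicative (abMatrix f).mulVecLin.toAddMonoidHom).comp expSum := by
    ext1 j
    apply Multiplicative.toAdd.injective
    ext i
    simp [abMatrix, expSum]
  exact congrArg Multiplicative.toAdd (DFunLike.congr_fun this x)

theorem abMatrix_comp (f g : FreeGroup (Fin n) →* FreeGroup (Fin n)) :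
    abMatrix (f.comp g) = abMatrix f * abMatrix g := by
  ext i j
  rw [abMatrix, Matrix.of_apply, MonoidHom.comp_apply, expSum_apply]
  rfl

theorem abMatrix_id : abMatrix (MonoidHom.id (FreeGroup (Fin n))) = 1 := by
  ext i j
  simp [abMatrix, expSum, Matrix.one_apply, Pi.single_apply]

/-- The determinant of the action of an automorphism on the abelianization. -/
def detAut : MulAut (FreeGroup (Fin n)) →* ℤˣ :=
  MonoidHom.toHomUnits
    { toFun := fun f => (abMatrix f.toMonoidHom).det
      map_one' := by
        rw [show (1 : MulAut (FreeGroup (Fin n))).toMonoidHom = MonoidHom.id _ from rfl,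
          abMatrix_id, Matrix.det_one]
      map_mul' := fun f g => by
        rw [show (f * g).toMonoidHom = f.toMonoidHom.comp g.toMonoidHom from rfl,
          abMatrix_comp, Matrix.det_mul] }

theorem coe_detAut (f : MulAut (FreeGroup (Fin n))) :
    (detAut f : ℤ) = (abMatrix f.toMonoidHom).det := rfl

/-- The determinant character of `Out(F_n)`. -/
def detOut : OutF n →* ℤˣ :=
  QuotientGroup.lift (Inn (FreeGroup (Fin n))) detAut (by
    rintro _ ⟨x, rfl⟩
    ext
    rw [coe_detAut]
    have : abMatrix (MulAut.conj x).toMonoidHom = 1 := by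
      rw [← abMatrix_id]
      ext i j
      simp [abMatrix, MulAut.conj_apply]
    rw [this]
    simp)

theorem detOut_eps (i : Fin 3) : detOut (eps i) = -1 := by
  change detAut (epsAut i) = -1
  ext
  rw [coe_detAut, Matrix.det_fin_three]
  have h : ∀ j k, abMatrix (epsAut i).toMonoidHom j k =
      if k = i then - Pi.single (M := fun _ => ℤ) k 1 j else Pi.single (M := fun _ => ℤ) k 1 j := by
    intro j k
    rw [abMatrix, Matrix.of_apply]
    change Multiplicative.toAdd (expSum (epsAut i (FreeGroup.of k))) j = _
    rw [epsAut_of]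
    split_ifs <;> simp [expSum]
  simp only [h]
  fin_cases i <;> simp

/-- The sign is the only surjective homomorphism from a symmetric group to {1, -1}, so one
transposition of determinant -1 decides. -/
theorem detOut_symOut (π : Equiv.Perm (Fin 4)) : detOut (symOut 3 π) = Equiv.Perm.sign π := by
  have hswap : detOut (symOut 3 (Equiv.swap 0 1)) = -1 := by
    have h01 := symOut_swap 0 1
    change symOut 3 (Equiv.swap 0 1) = _ at h01
    rw [h01]
    change detAut (permAut (Equiv.swap 0 1)) = -1
    ext
    rw [coe_detAut, Matrix.det_fin_three]
    have h : ∀ j k, abMatrix (permAut (Equiv.swap (0 : Fin 3) 1)).toMonoidHom j k =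
        Pi.single (M := fun _ => ℤ) (Equiv.swap 0 1 k) 1 j := by
      intro j k
      rw [abMatrix, Matrix.of_apply]
      change Multiplicative.toAdd (expSum (permAut _ (FreeGroup.of k))) j = _
      rw [permAut_of]
      simp [expSum]
    simp only [h]
    simp [Equiv.swap_apply_of_ne_of_ne]
  have hsurj : Function.Surjective (detOut.comp (symOut 3)) := by
    intro u
    rcases Int.units_eq_one_or u with rfl | rfl
    · exact ⟨1, map_one _⟩
    · exact ⟨_, hswap⟩
  exact DFunLike.congr_fun (Equiv.Perm.eq_sign_of_surjective_hom hsurj) π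

end Determinant

/-! ### Linear algebra: what the relations impose on the matrix of a transvection. -/

section Frames

variable {K V : Type*} [Field K] [AddCommGroup V] [Module K V]

/-- The vectors `e₀`, `e₁`, `e₂` are linearly independent modulo the two subspaces `E` and `F`, and
these are independent. -/
def IndepFrame (E F : Submodule K V) (e₀ e₁ e₂ : V) : Prop :=
  ∀ (w : V) (a b c : K) (g : V), w ∈ E → g ∈ F → w + a • e₀ + b • e₁ + c • e₂ + g = 0 →
    w = 0 ∧ a = 0 ∧ b = 0 ∧ c = 0 ∧ g = 0

variable {E F : Submodule K V} {e₀ e₁ e₂ : V} {z : K} {T s₀₁ s₀₂ s₁₂ : V →ₗ[K] V}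

/-- The case of an eigenvector e_2: the hypotheses give x² = 1 and z x² = x. -/
theorem braid_zero (hind : IndepFrame E F e₀ e₁ e₂) {x : K}
    (hC : T (x • e₂) = e₂) (hT2 : T e₂ = x • e₂)
    (hbr : (x * z) • T e₂ = x • e₂) : x = z := by
  have h1 := (hind 0 0 0 (x * x - 1) 0 E.zero_mem F.zero_mem (by
    rw [map_smul, hT2] at hC
    linear_combination (norm := module) hC)).2.2.2.1
  have h2 := (hind 0 0 0 (x * z * x - x) 0 E.zero_mem F.zero_mem (by
    rw [hT2] at hbr
    linear_combination (norm := module) hbr)).2.2.2.1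
  linear_combination z * h1 - h2

/-- Here κ = ±z because κ² = 1 = z². The `F`-component of the braid relation is xz - κx - zκ = 0.
For κ = z it reads 1 = 0, and for κ = -z it gives 2x = -z. -/
theorem braid_ne_zero (hind : IndepFrame E F e₀ e₁ e₂) (hz : z * z = 1) {x κ : K} {f : V}
    (hf : f ∈ F) (hf0 : f ≠ 0) (hC : T (x • e₂ - f) = e₂) (hT2 : T e₂ = x • e₂ + f)
    (hss : s₀₁ (s₀₁ f) = f)
    (hbr : (x * z) • T e₂ - T (s₀₁ f) = x • e₂ + z • s₀₁ f) (hκ : s₀₁ f = κ • f) :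
    2 * x = -z := by
  have hfK : ∀ a : K, a • f = 0 → a = 0 := fun a h => (smul_eq_zero.mp h).resolve_right hf0
  have hκ2 : κ * κ - 1 = 0 := by
    apply hfK
    rw [hκ, map_smul, hκ] at hss
    linear_combination (norm := module) hss
  have hTf : T f = x • T e₂ - e₂ := by
    rw [map_sub, map_smul] at hC
    linear_combination (norm := module) -hC
  have h := hind 0 0 0 (x * z * x - κ * (x * x - 1) - x) ((x * z - κ * x - z * κ) • f)
    E.zero_mem (F.smul_mem _ hf) (by
      rw [hκ, map_smul, hTf, hT2] at hbr
      linear_combination (norm := module) hbr)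
  have h1 := hfK _ h.2.2.2.2
  have hfac : (κ - z) * (κ + z) = 0 := by linear_combination hκ2 - hz
  rcases mul_eq_zero.mp hfac with h3 | h3
  · have : κ = z := by linear_combination h3
    rw [this] at h1
    exact absurd (by linear_combination -h1 - hz : (1 : K) = 0) one_ne_zero
  · have : κ = -z := by linear_combination h3
    rw [this] at h1
    linear_combination z * h1 - (2 * x + z) * hz

/-- The component in `E` of the image of `e₁` vanishes. -/
theorem fixed_component_eq_zero (h2 : (2 : K) ≠ 0) (h3 : (3 : K) ≠ 0)
    (hind : IndepFrame E F e₀ e₁ e₂) (hz : z * z = 1)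
    {p q r s x : K} {v f : V} (hv : v ∈ E) (hf : f ∈ F)
    (hT0 : T e₀ = p • e₀ + r • e₁) (hT1 : T e₁ = v + q • e₀ + s • e₁)
    (hT2 : T e₂ = x • e₂ + f)
    (hTE : ∀ w ∈ E, ∃ w' ∈ E, ∃ b : K, T w = w' + b • e₁)
    (hA : T (p • e₀ - r • e₁) = e₀) (hB : T (v + q • e₀ - s • e₁) = -e₁)
    (hC : T (x • e₂ - f) = e₂)
    (hD : z • (-(p • T e₁) + r • T e₀) = -(z • s₀₁ v) - q • e₁ - s • e₀)
    (hbr : (x * z) • T e₂ - T (s₀₁ f) = x • e₂ + z • s₀₁ f)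
    (hs1 : s₀₂ e₁ = z • e₁) (hs2 : s₀₂ e₂ = z • e₀)
    (hsE01 : ∀ w ∈ E, s₀₁ w ∈ E) (hsE02 : ∀ w ∈ E, s₀₂ w ∈ E) (hsE12 : ∀ w ∈ E, s₁₂ w ∈ E)
    (hsF01 : ∀ w ∈ F, s₀₁ w ∈ F) (hsF02 : ∀ w ∈ F, s₀₂ w ∈ F)
    (hss01 : ∀ w, s₀₁ (s₀₁ w) = w) (hss02 : ∀ w, s₀₂ (s₀₂ w) = w)
    (hconj12 : ∀ w, s₁₂ w = s₀₁ (s₀₂ (s₀₁ w))) (hconj12' : ∀ w, s₁₂ w = s₀₂ (s₀₁ (s₀₂ w)))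
    (hR : ∃ a b c : K, ∃ g ∈ F,
      T (z • s₀₂ v + q • e₂ + s • e₁) = a • e₀ + b • e₁ + c • e₂ + g)
    (hF1 : T (z • s₀₂ v + q • e₂ + s • e₁) = s₀₂ (T (s₀₂ (v + q • e₀ + s • e₁))))
    (hs0 : s₀₂ e₀ = z • e₂)
    (hL : ∃ y : K, ∃ g ∈ F, T (-(z • s₁₂ v) + q • e₀ + s • e₂) =
      x • (-(z • s₁₂ v) + q • e₀ + s • e₂) + y • e₁ + g)
    (hdF : v ≠ 0 → ∀ g ∈ F, ∀ g' ∈ F, g ≠ 0 → ∃ c : K, g' = c • g)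
    (hdE : ∀ w ∈ E, ∀ w' ∈ E, w ≠ 0 → (¬∃ c : K, w' = c • w) →
      (∀ u ∈ E, ∃ a b : K, u = a • w + b • w') ∧ ∀ g ∈ F, g = 0) : v = 0 := by
  -- The contradiction comes from the `E`-component of `T` on `E`. The relations make it send v to s
  -- v, v' = z s₀₂ v to -s v, and v₃ = z s₁₂ v to x v₃. This is incompatible with an action of S_3
  -- on a space of dimension at most two.
  by_contra hv0
  have hvK : ∀ a : K, a • v = 0 → a = 0 := fun a h => (smul_eq_zero.mp h).resolve_right hv0
  have hz0 : z ≠ 0 := fun h => by simp [h] at hz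
  -- the equations for `r`, `p`
  have eA := hind (-(r • v)) (p * p - r * q - 1) (p * r - r * s) 0 0
    (E.neg_mem (E.smul_mem _ hv)) F.zero_mem (by
      rw [map_sub, map_smul, map_smul, hT0, hT1] at hA
      linear_combination (norm := module) hA)
  have hr : r = 0 := hvK _ (neg_eq_zero.mp eA.1)
  subst hr
  have hp : p * p = 1 := by linear_combination eA.2.1
  -- the braid relation
  have eD := hind (-(z * p) • v + z • s₀₁ v) (-(z * p * q) + s) (-(z * p * s) + q) 0 0
    (E.add_mem (E.smul_mem _ hv) (E.smul_mem _ (hsE01 v hv))) F.zero_mem (by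
      rw [hT0, hT1] at hD
      linear_combination (norm := module) hD)
  have hs01v : s₀₁ v = p • v := by
    have h : z • (s₀₁ v - p • v) = 0 := by
      rw [← eD.1]
      module
    exact sub_eq_zero.mp ((smul_eq_zero.mp h).resolve_left hz0)
  have hq : q = z * p * s := by linear_combination eD.2.2.1
  -- the value on `v`
  obtain ⟨v₁, hv₁, b, hTv⟩ := hTE v hv
  have eB := hind (v₁ - s • v) (q * p - s * q) (b - s * s + 1) 0 0
    (E.sub_mem hv₁ (E.smul_mem _ hv)) F.zero_mem (by
      rw [map_sub, map_add, map_smul, map_smul, hTv, hT0, hT1] at hB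
      linear_combination (norm := module) hB)
  have hv₁s : v₁ = s • v := sub_eq_zero.mp eB.1
  have hqsp : q * (p - s) = 0 := by linear_combination eB.2.1
  -- the commutation with the left transvection
  obtain ⟨v₃, hv₃def⟩ : ∃ v₃, v₃ = z • s₁₂ v := ⟨_, rfl⟩
  have hv₃ : v₃ ∈ E := hv₃def ▸ E.smul_mem _ (hsE12 v hv)
  rw [← hv₃def] at hL
  obtain ⟨v₃', hv₃', b₃, hTv₃⟩ := hTE v₃ hv₃
  obtain ⟨y, g, hg, hL⟩ := hL
  have eL := hind (-v₃' + x • v₃) (q * p - x * q) (-b₃ - y) 0 (s • f - g)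
    (E.add_mem (E.neg_mem hv₃') (E.smul_mem _ hv₃)) (F.sub_mem (F.smul_mem _ hf) hg) (by
      rw [map_add, map_add, map_neg, map_smul, map_smul, hTv₃, hT0, hT2] at hL
      linear_combination (norm := module) hL)
  have hTv₃x : v₃' = x • v₃ := by
    have := eL.1
    linear_combination (norm := module) -this
  have hqpx : q * (p - x) = 0 := by linear_combination eL.2.1
  -- the product of the two commuting transvections
  obtain ⟨v', hv'def⟩ : ∃ v', v' = z • s₀₂ v := ⟨_, rfl⟩
  have hv' : v' ∈ E := hv'def ▸ E.smul_mem _ (hsE02 v hv)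
  rw [← hv'def] at hR hF1
  obtain ⟨w', hw', b', hTv'⟩ := hTE v' hv'
  have hprod : T (v' + q • e₂ + s • e₁) =
      (w' + s • v) + (s * q) • e₀ + (b' + s * s) • e₁ + (q * x) • e₂ + q • f := by
    rw [map_add, map_add, map_smul, map_smul, hTv', hT1, hT2]
    module
  obtain ⟨a₁, b₁, c₁, g₁, hg₁, hR⟩ := hR
  have eR := hind (w' + s • v) (s * q - a₁) (b' + s * s - b₁) (q * x - c₁) (q • f - g₁)
    (E.add_mem hw' (E.smul_mem _ hv)) (F.sub_mem (F.smul_mem _ hf) hg₁) (by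
      rw [hprod] at hR
      linear_combination (norm := module) hR)
  have hw'v : w' = -(s • v) := eq_neg_of_add_eq_zero_left eR.1
  have hxs : q * (s - x) = 0 := by
    obtain ⟨u, hu, c, hTu⟩ := hTE (s₀₂ v) (hsE02 v hv)
    have hrhs : s₀₂ (T (s₀₂ (v + q • e₀ + s • e₁))) =
        (s₀₂ u + (s * z) • s₀₂ v) + (q * x * (z * z)) • e₀ + (c * z + s * (z * z) * s) • e₁ +
          (s * (z * z) * q) • e₂ + (q * z) • s₀₂ f := by
      simp only [map_add, map_smul, hs0, hs1, hs2, hTu, hT1, hT2]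
      module
    have := hind ((w' + s • v) - (s₀₂ u + (s * z) • s₀₂ v)) (s * q - q * x * (z * z))
      (b' + s * s - (c * z + s * (z * z) * s)) (q * x - (s * (z * z) * q))
      (q • f - (q * z) • s₀₂ f)
      (E.sub_mem (E.add_mem hw' (E.smul_mem _ hv))
        (E.add_mem (hsE02 _ hu) (E.smul_mem _ (hsE02 _ hv))))
      (F.sub_mem (F.smul_mem _ hf) (F.smul_mem _ (hsF02 _ hf))) (by
        rw [hprod, hrhs] at hF1
        linear_combination (norm := module) hF1)
    linear_combination this.2.1 + q * x * hz
  -- the eigenvalue on `e₂`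
  have hx : x = z ∨ (f ≠ 0 ∧ 2 * x = -z) := by
    by_cases hf0 : f = 0
    · left
      subst hf0
      rw [sub_zero] at hC
      rw [add_zero] at hT2
      rw [map_zero, map_zero, sub_zero, smul_zero, add_zero] at hbr
      exact braid_zero hind hC hT2 hbr
    · right
      -- As v ≠ 0 uses up a dimension of `E`, the space `F` is at most a line, so f is an
      -- eigenvector of s₀₁.
      obtain ⟨κ, hκ⟩ := hdF hv0 f hf (s₀₁ f) (hsF01 f hf) hf0
      exact ⟨hf0, braid_ne_zero hind hz hf hf0 hC hT2 (hss01 f) hbr hκ⟩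
  have hx0 : x ≠ 0 := by
    rintro rfl
    rcases hx with hx | ⟨-, hx⟩
    · exact hz0 hx.symm
    · exact hz0 (by linear_combination hx)
  have hs02v : s₀₂ v = z • v' := by
    rw [hv'def, smul_smul, hz, one_smul]
  have hs12v : s₁₂ v = z • v₃ := by
    rw [hv₃def, smul_smul, hz, one_smul]
  by_cases hs : s = 0
  · subst hs
    -- For s = 0 the `E`-component of `T` kills v and v' but not v₃. So v and v₃ span `E`, and v' is
    -- a multiple of v. Then s₀₁ and s₀₂, hence also s₁₂, preserve the line of v, contrary to the
    -- independence of v₃.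
    have hdep : ¬∃ c : K, v₃ = c • v := by
      rintro ⟨c, hc⟩
      have h : T v₃ = c • T v := by rw [hc, map_smul]
      rw [hTv₃, hTv, hTv₃x, hv₁s] at h
      have := (hind (x • v₃) 0 (b₃ - c * b) 0 0 (E.smul_mem _ hv₃) F.zero_mem (by
        linear_combination (norm := module) h)).1
      have hv₃0 := (smul_eq_zero.mp this).resolve_left hx0
      rw [hv₃0] at hs12v
      apply hv0
      have h1 := hconj12 v
      rw [hs12v, smul_zero] at h1
      rw [← hss01 v, ← hss02 (s₀₁ v), ← hss01 (s₀₂ (s₀₁ v)), ← h1]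
      simp
    obtain ⟨hspan, -⟩ := hdE v hv v₃ hv₃ hv0 hdep
    obtain ⟨a, c, hac⟩ := hspan v' hv'
    have h : T v' = a • T v + c • T v₃ := by rw [hac, map_add, map_smul, map_smul]
    rw [hTv', hTv, hTv₃, hw'v, hv₁s, hTv₃x] at h
    have e := (hind (-((c * x) • v₃)) 0 (b' - a * b - c * b₃) 0 0
      (E.neg_mem (E.smul_mem _ hv₃)) F.zero_mem (by
        linear_combination (norm := module) h)).1
    have hv₃0 : v₃ ≠ 0 := fun h => hdep ⟨0, by rw [h, zero_smul]⟩
    have hc : c = 0 := by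
      have := (smul_eq_zero.mp (neg_eq_zero.mp e)).resolve_right hv₃0
      exact (mul_eq_zero.mp this).resolve_right hx0
    rw [hc, zero_smul, add_zero] at hac
    apply hdep
    refine ⟨z * (p * (z * a) * p), ?_⟩
    rw [hv₃def, hconj12, hs01v, map_smul, map_smul, hs02v, hac]
    simp only [map_smul, hs01v]
    module
  -- For s ≠ 0 all of p, s, x agree. They equal z, because 2x = -z together with x² = 1 would give 3
  -- = 0. Then v' = v or v' = -v. The former contradicts the values of `T` on v and v', the latter
  -- the braid relation of s₀₁ and s₀₂.
  · have hq0 : q ≠ 0 := by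
      rw [hq]
      exact mul_ne_zero (mul_ne_zero hz0 (fun h => by simp [h] at hp)) hs
    have hps : p = s := sub_eq_zero.mp ((mul_eq_zero.mp hqsp).resolve_left hq0)
    have hpx : p = x := sub_eq_zero.mp ((mul_eq_zero.mp hqpx).resolve_left hq0)
    subst hps
    subst hpx
    have hpz : p = z := by
      rcases hx with hx | ⟨-, hx⟩
      · exact hx
      · exact absurd (by linear_combination hz - 4 * hp + (2 * p - z) * hx : (3 : K) = 0) h3
    subst hpz
    by_cases hdep : ∃ c : K, v₃ = c • v
    · obtain ⟨c, hc⟩ := hdep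
      have hv₃0 : s₁₂ v = (p * c) • v := by rw [hs12v, hc, smul_smul]
      have hs02 : s₀₂ v = (p * c) • v := by
        have h1 : s₀₂ v = s₀₁ (s₁₂ (s₀₁ v)) := by rw [hconj12, hss01, hss01]
        rw [h1, hs01v, map_smul, hv₃0, map_smul, map_smul, hs01v]
        linear_combination (norm := module) (p * c) • congrArg (fun t => t • v) hp
      have hc2 : c * c = c := by
        have h1 := hconj12' v
        rw [hv₃0, hs02, map_smul, map_smul, hs01v, map_smul, hs02] at h1
        have := hvK (p * c - p * c * (p * (p * c))) (by
          linear_combination (norm := module) h1)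
        linear_combination -p * this + c * (1 - c * (1 + p * p)) * hp
      have hc0 : c ≠ 0 := by
        rintro rfl
        rw [mul_zero, zero_smul] at hs02
        apply hv0
        rw [← hss02 v, hs02, map_zero]
      have hc1 : c = 1 := mul_left_cancel₀ hc0 (by rw [hc2, mul_one])
      have hv'v : v' = v := by rw [hv'def, hs02, hc1, mul_one, smul_smul, hp, one_smul]
      rw [hv'v, hTv, hv₁s, hw'v] at hTv'
      have := (hind ((2 * p) • v) 0 (b - b') 0 0 (E.smul_mem _ hv) F.zero_mem (by
        linear_combination (norm := module) hTv')).1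
      exact mul_ne_zero h2 hz0 (hvK _ this)
    · obtain ⟨hspan, -⟩ := hdE v hv v₃ hv₃ hv0 hdep
      obtain ⟨a, c, hac⟩ := hspan v' hv'
      have h : T v' = a • T v + c • T v₃ := by rw [hac, map_add, map_smul, map_smul]
      rw [hTv', hTv, hTv₃, hw'v, hv₁s, hTv₃x] at h
      have e := (hind (p • (v' + v)) 0 (a * b + c * b₃ - b') 0 0
        (E.smul_mem _ (E.add_mem hv' hv)) F.zero_mem (by
          rw [hac]
          linear_combination (norm := module) -h)).1
      have hv'v : v' = -v := eq_neg_of_add_eq_zero_left ((smul_eq_zero.mp e).resolve_left hz0)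
      rw [hv'v] at hs02v
      have h1 := hconj12 v
      rw [hconj12' v, hs02v, hs01v] at h1
      simp only [map_smul, map_neg, hs01v, hs02v] at h1
      have := hvK (2 * p) (by
        linear_combination (norm := module) h1 - (2 * p) • congrArg (fun t => t • v) hp)
      exact mul_ne_zero h2 hz0 this

/-- The component in `F` of the image of `e₂` vanishes; and the eigenvalues on the three lines
agree. -/
theorem top_component_eq_zero (h3 : (3 : K) ≠ 0)
    (hind : IndepFrame E F e₀ e₁ e₂) (hz : z * z = 1)
    {p q r s x : K} {f : V} (hf : f ∈ F)
    (hT0 : T e₀ = p • e₀ + r • e₁) (hT1 : T e₁ = q • e₀ + s • e₁)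
    (hT2 : T e₂ = x • e₂ + f)
    (hTF : ∀ g ∈ F, ∃ y : K, ∃ g' ∈ F, T g = y • e₂ + g')
    (hTT : ∀ g ∈ F, T g ∈ F → T (T g) = g)
    (hA : T (p • e₀ - r • e₁) = e₀) (hB : T (q • e₀ - s • e₁) = -e₁)
    (hC : T (x • e₂ - f) = e₂)
    (hD : z • (-(p • T e₁) + r • T e₀) = - q • e₁ - s • e₀)
    (hbr : (x * z) • T e₂ - T (s₀₁ f) = x • e₂ + z • s₀₁ f)
    (hsF01 : ∀ w ∈ F, s₀₁ w ∈ F) (hsF02 : ∀ w ∈ F, s₀₂ w ∈ F) (hsF12 : ∀ w ∈ F, s₁₂ w ∈ F)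
    (hss01 : ∀ w, s₀₁ (s₀₁ w) = w) (hconj01 : ∀ w, s₀₁ w = s₀₂ (s₁₂ (s₀₂ w)))
    (hF0 : T (x • e₀ + z • s₀₂ f) = p • (x • e₀ + z • s₀₂ f) + r • (q • e₂ + s • e₁))
    (hG1 : T (x • e₁ + z • s₁₂ f) = q • (p • e₀ + r • e₂) + s • (x • e₁ + z • s₁₂ f))
    (hdF : ∀ g ∈ F, ∀ g' ∈ F, g ≠ 0 → (¬∃ c : K, g' = c • g) →
      ∀ u ∈ F, ∃ a b : K, u = a • g + b • g') :
    f = 0 ∧ p = z ∧ s = z ∧ x = z ∧ q * r = 0 ∧ r - q = -z := by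
  have hz0 : z ≠ 0 := fun h => by simp [h] at hz
  have eA := hind 0 (p * p - r * q - 1) (p * r - r * s) 0 0 E.zero_mem F.zero_mem (by
    rw [map_sub, map_smul, map_smul, hT0, hT1] at hA
    linear_combination (norm := module) hA)
  have eB := hind 0 (q * p - s * q) (q * r - s * s + 1) 0 0 E.zero_mem F.zero_mem (by
    rw [map_sub, map_smul, map_smul, hT0, hT1] at hB
    linear_combination (norm := module) hB)
  have eD := hind 0 (z * (r * p - p * q) + s) (z * (r * r - p * s) + q) 0 0
    E.zero_mem F.zero_mem (by
      rw [hT0, hT1] at hD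
      linear_combination (norm := module) hD)
  obtain ⟨f', hf'def⟩ : ∃ f', f' = z • s₀₂ f := ⟨_, rfl⟩
  have hf' : f' ∈ F := hf'def ▸ F.smul_mem _ (hsF02 f hf)
  obtain ⟨f'', hf''def⟩ : ∃ f'', f'' = z • s₁₂ f := ⟨_, rfl⟩
  have hf'' : f'' ∈ F := hf''def ▸ F.smul_mem _ (hsF12 f hf)
  rw [← hf'def] at hF0
  rw [← hf''def] at hG1
  obtain ⟨y', g', hg', hTf'⟩ := hTF f' hf'
  obtain ⟨y'', g'', hg'', hTf''⟩ := hTF f'' hf''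
  have eF := hind 0 0 (x * r - r * s) (y' - r * q) (g' - p • f') E.zero_mem
    (F.sub_mem hg' (F.smul_mem _ hf')) (by
      rw [map_add, map_smul, hT0, hTf'] at hF0
      linear_combination (norm := module) hF0)
  have eG := hind 0 (x * q - q * p) 0 (y'' - q * r) (g'' - s • f'') E.zero_mem
    (F.sub_mem hg'' (F.smul_mem _ hf'')) (by
      rw [map_add, map_smul, hT1, hTf''] at hG1
      linear_combination (norm := module) hG1)
  have hps : p = s ∧ x = s := by
    by_cases hr : r = 0
    · have hq : q ≠ 0 := by
        rintro rfl
        have hs0 : s = 0 := by linear_combination eD.2.1 - z * p * hr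
        have := eB.2.2.1
        rw [hs0] at this
        simp at this
      have h1 : p = s := mul_left_cancel₀ hq (by linear_combination eB.2.1)
      exact ⟨h1, mul_left_cancel₀ hq (by linear_combination eG.2.1 + q * h1)⟩
    · exact ⟨mul_left_cancel₀ hr (by linear_combination eA.2.2.1),
        mul_left_cancel₀ hr (by linear_combination eF.2.2.1)⟩
  obtain ⟨rfl, rfl⟩ := hps
  have hqr : q * r = x * x - 1 := by linear_combination -eA.2.1
  have hTf : T f = (x * x - 1) • e₂ + x • f := by
    rw [map_sub, map_smul, hT2] at hC
    linear_combination (norm := module) -hC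
  have hTf'x : T f' = (x * x - 1) • e₂ + x • f' := by
    rw [hTf', ← sub_eq_zero.mp eF.2.2.2.2, ← hqr, sub_eq_zero.mp eF.2.2.2.1, mul_comm]
  have hTf''x : T f'' = (x * x - 1) • e₂ + x • f'' := by
    rw [hTf'', ← sub_eq_zero.mp eG.2.2.2.2, ← hqr, sub_eq_zero.mp eG.2.2.2.1]
  -- If f, f', f'' coincide, s₀₁ f = z f and the braid relation gives 1 = 0. Otherwise a difference
  -- of two of them is an eigenvector of `T` in `F` with eigenvalue x, and x² = 1. Then f is not an
  -- eigenvector of s₀₁, by `braid_ne_zero` and 3 ≠ 0, so f and s₀₁ f span `F`.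
  have hf0 : f = 0 := by
    by_contra hf0
    have hfK : ∀ a : K, a • f = 0 → a = 0 := fun a h => (smul_eq_zero.mp h).resolve_right hf0
    have hκ : ∀ κ : K, s₀₁ f = κ • f → 2 * x = -z := fun κ h =>
      braid_ne_zero hind hz hf hf0 hC hT2 (hss01 f) hbr h
    have hs02 : s₀₂ f = z • f' := by rw [hf'def, smul_smul, hz, one_smul]
    have hs12 : s₁₂ f = z • f'' := by rw [hf''def, smul_smul, hz, one_smul]
    have hprop : ∀ a b : K, f' = a • f → f'' = b • f → s₀₁ f = (z * a * (z * b) * (z * a)) • f := by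
      intro a b ha hb
      rw [hconj01, hs02, ha]
      simp only [map_smul, hs12, hb, hs02, ha]
      module
    have hsq : ∀ g ∈ F, T g = x • g → g ≠ 0 → x * x = 1 := by
      intro g hg hTg hg0
      have h := hTT g hg (hTg ▸ F.smul_mem _ hg)
      rw [hTg, map_smul, hTg] at h
      have : (x * x - 1) • g = 0 := by
        linear_combination (norm := module) h
      linear_combination (smul_eq_zero.mp this).resolve_right hg0
    by_cases heq : f' = f ∧ f'' = f
    · have h := hprop 1 1 (by rw [heq.1, one_smul]) (by rw [heq.2, one_smul])
      have h' : s₀₁ f = z • f := by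
        rw [h]
        linear_combination (norm := module) z • congrArg (fun t => t • f) hz
      rw [h', hT2, map_smul, hTf] at hbr
      have := hfK _ (hind 0 0 0 (x * z * x - z * (x * x - 1) - x) ((-(z * z)) • f)
        E.zero_mem (F.smul_mem _ hf) (by
          linear_combination (norm := module) hbr)).2.2.2.2
      rw [hz] at this
      exact one_ne_zero (neg_eq_zero.mp this)
    · have hx2 : x * x = 1 := by
        rcases not_and_or.mp heq with h | h
        · refine hsq (f' - f) (F.sub_mem hf' hf) ?_ (sub_ne_zero.mpr h)
          rw [map_sub, hTf'x, hTf]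
          module
        · refine hsq (f'' - f) (F.sub_mem hf'' hf) ?_ (sub_ne_zero.mpr h)
          rw [map_sub, hTf''x, hTf]
          module
      have hnot : ¬∃ κ : K, s₀₁ f = κ • f := by
        rintro ⟨κ, h⟩
        have := hκ κ h
        exact h3 (by linear_combination hz - 4 * hx2 + (2 * x - z) * this)
      have hh := hsF01 f hf
      -- Since x² = 1, the condition says T g = x g. Applied to f' and f'', this makes f an
      -- eigenvector of s₀₂ and s₁₂, hence of s₀₁ = s₀₂ s₁₂ s₀₂, which was excluded.
      have hline : ∀ g ∈ F, T g = (x * x - 1) • e₂ + x • g → ∃ a : K, g = a • f := by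
        intro g hg hTg
        obtain ⟨a, b, hab⟩ := hdF f hf (s₀₁ f) hh hf0 hnot g hg
        have hTh : T (s₀₁ f) = (x * z) • (x • e₂ + f) - x • e₂ - z • s₀₁ f := by
          rw [hT2] at hbr
          linear_combination (norm := module) -hbr
        have hTg' : T g = a • T f + b • T (s₀₁ f) := by rw [hab, map_add, map_smul, map_smul]
        rw [hTg, hTf, hTh, hx2, hab] at hTg'
        have e := hind 0 0 0 (b * (x * z * x - x)) (b • ((x * z) • f - (z + x) • s₀₁ f))
          E.zero_mem (F.smul_mem _ (F.sub_mem (F.smul_mem _ hf) (F.smul_mem _ hh))) (by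
            linear_combination (norm := module) -hTg')
        by_cases hb : b = 0
        · exact ⟨a, by rw [hab, hb, zero_smul, add_zero]⟩
        · exfalso
          have e1 := (mul_eq_zero.mp e.2.2.2.1).resolve_left hb
          have hxz : x = z := by linear_combination z * hx2 - e1
          have e2 := (smul_eq_zero.mp e.2.2.2.2).resolve_left hb
          subst hxz
          by_cases h0 : x + x = 0
          · rw [hx2, h0] at e2
            simp at e2
            exact hf0 e2
          · apply hnot
            refine ⟨(x + x)⁻¹, ?_⟩
            rw [eq_inv_smul_iff₀ h0]
            rw [hx2] at e2
            linear_combination (norm := module) -e2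
      obtain ⟨a, ha⟩ := hline f' hf' hTf'x
      obtain ⟨b, hb⟩ := hline f'' hf'' hTf''x
      exact hnot ⟨_, hprop a b ha hb⟩
  subst hf0
  rw [sub_zero] at hC
  rw [add_zero] at hT2
  rw [map_zero, map_zero, sub_zero, smul_zero, add_zero] at hbr
  have hxz : x = z := braid_zero hind hC hT2 hbr
  subst hxz
  refine ⟨rfl, rfl, rfl, rfl, by rw [hqr, hz, sub_self], ?_⟩
  linear_combination eD.2.1 - (r - q) * hz

/-- The commutator relation forces the sign to be trivial. -/
theorem sign_eq_one (hind : IndepFrame E F e₀ e₁ e₂) (hz : z * z = 1) {q : K}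
    {T' T'' : V →ₗ[K] V} (hT1 : T e₁ = q • e₀ + z • e₁)
    (hT2 : T e₂ = z • e₂) (hT'1 : T' e₁ = q • e₂ + z • e₁) (hT''1 : T'' e₁ = z • e₁)
    (hT''2 : T'' e₂ = q • e₀ + z • e₂)
    (hcomm : T (T' (T'' e₁)) = T'' (T' e₁)) : z = 1 := by
  simp only [hT''1, hT'1, map_smul, map_add, hT1, hT2, hT''2] at hcomm
  -- The coefficient of e_1 gives z³ = z².
  have := (hind 0 (z * z * q - q * q) (z * z * z - z * z) (z * q * z - q * z) 0
    E.zero_mem F.zero_mem (by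
      linear_combination (norm := module) hcomm)).2.2.1
  linear_combination this - (z - 1) * hz

end Frames

/-! ### Simultaneous eigenspaces of the ε_i, their dimensions and duals. -/

section Eigenspaces

variable {K V : Type*} [Field K] [AddCommGroup V] [Module K V]
  (φ : Representation K (OutF 3) V)

theorem mem_eigen {I : Finset (Fin 3)} {v : V} :
    v ∈ eigen φ I ↔ ∀ i, φ (eps i) v = (if i ∈ I then (-1 : K) else 1) • v := Iff.rfl

theorem eps_apply_of_mem {I : Finset (Fin 3)} {v : V} (hv : v ∈ eigen φ I) {i : Fin 3}
    (hi : i ∈ I) : φ (eps i) v = -v := by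
  rw [(mem_eigen φ).mp hv i, if_pos hi, neg_one_smul]

theorem eps_apply_of_notMem {I : Finset (Fin 3)} {v : V} (hv : v ∈ eigen φ I) {i : Fin 3}
    (hi : i ∉ I) : φ (eps i) v = v := by
  rw [(mem_eigen φ).mp hv i, if_neg hi, one_smul]

theorem eps_eps (i : Fin 3) (v : V) : φ (eps i) (φ (eps i) v) = v := by
  rw [← Module.End.mul_apply, ← map_mul, eps_mul_self, map_one, Module.End.one_apply]

theorem eps_eps_comm (i j : Fin 3) (v : V) :
    φ (eps i) (φ (eps j) v) = φ (eps j) (φ (eps i) v) := by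
  rw [← Module.End.mul_apply, ← map_mul, eps_comm, map_mul, Module.End.mul_apply]

/-- The projection to the sum of the eigenspaces of `ε_i` with the sign prescribed by `I`. -/
noncomputable def halfProj (I : Finset (Fin 3)) (i : Fin 3) : V →ₗ[K] V :=
  (2 : K)⁻¹ • (1 + (if i ∈ I then (-1 : K) else 1) • φ (eps i))

/-- The projection to the simultaneous eigenspace `E_I`. -/
noncomputable def eigenProj (I : Finset (Fin 3)) : V →ₗ[K] V :=
  halfProj φ I 0 * (halfProj φ I 1 * halfProj φ I 2)

theorem halfProj_apply (I : Finset (Fin 3)) (i : Fin 3) (v : V) :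
    halfProj φ I i v = (2 : K)⁻¹ • (v + (if i ∈ I then (-1 : K) else 1) • φ (eps i) v) := rfl

theorem eps_halfProj_self (I : Finset (Fin 3)) (i : Fin 3) (v : V) :
    φ (eps i) (halfProj φ I i v) = (if i ∈ I then (-1 : K) else 1) • halfProj φ I i v := by
  rw [halfProj_apply, map_smul, map_add, map_smul, eps_eps]
  split_ifs <;> module

theorem eps_halfProj (I : Finset (Fin 3)) (i j : Fin 3) (v : V) :
    φ (eps j) (halfProj φ I i v) = halfProj φ I i (φ (eps j) v) := by
  rw [halfProj_apply, halfProj_apply, map_smul, map_add, map_smul, eps_eps_comm]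

theorem eigenProj_mem (I : Finset (Fin 3)) (v : V) : eigenProj φ I v ∈ eigen φ I := by
  intro i
  simp only [eigenProj, Module.End.mul_apply]
  fin_cases i
  · exact eps_halfProj_self φ I 0 _
  · have := eps_halfProj_self φ I 1 (halfProj φ I 2 v)
    simp only [Fin.mk_one, Fin.isValue] at this ⊢
    rw [eps_halfProj, this, map_smul]
  · have := eps_halfProj_self φ I 2 v
    simp only [Fin.reduceFinMk, Fin.isValue] at this ⊢
    rw [eps_halfProj, eps_halfProj, this, map_smul, map_smul]

theorem halfProj_of_mem (h2 : (2 : K) ≠ 0) {I : Finset (Fin 3)} {v : V} (hv : v ∈ eigen φ I)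
    (i : Fin 3) : halfProj φ I i v = v := by
  rw [halfProj_apply, (mem_eigen φ).mp hv i, inv_smul_eq_iff₀ h2]
  split_ifs <;> module

theorem eigenProj_of_mem (h2 : (2 : K) ≠ 0) {I : Finset (Fin 3)} {v : V} (hv : v ∈ eigen φ I) :
    eigenProj φ I v = v := by
  simp only [eigenProj, Module.End.mul_apply, halfProj_of_mem φ h2 hv]

theorem range_eigenProj (h2 : (2 : K) ≠ 0) (I : Finset (Fin 3)) :
    LinearMap.range (eigenProj φ I) = eigen φ I := by
  ext v
  constructor
  · rintro ⟨w, rfl⟩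
    exact eigenProj_mem φ I w
  · intro hv
    exact ⟨v, eigenProj_of_mem φ h2 hv⟩

theorem univ_finset_fin_three : (Finset.univ : Finset (Finset (Fin 3))) =
    {∅, {0}, {1}, {2}, {0, 1}, {0, 2}, {1, 2}, Finset.univ} := by
  decide

theorem sum_finset_fin_three {M : Type*} [AddCommMonoid M] (f : Finset (Fin 3) → M) :
    ∑ I, f I = f ∅ + (f {0} + (f {1} + (f {2} + (f {0, 1} + (f {0, 2} +
      (f {1, 2} + f Finset.univ)))))) := by
  rw [univ_finset_fin_three, Finset.sum_insert (by decide), Finset.sum_insert (by decide),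
    Finset.sum_insert (by decide), Finset.sum_insert (by decide), Finset.sum_insert (by decide),
    Finset.sum_insert (by decide), Finset.sum_insert (by decide), Finset.sum_singleton]

theorem sum_eigenProj (h2 : (2 : K) ≠ 0) (v : V) : ∑ I, eigenProj φ I v = v := by
  have hq : ∀ (I J : Finset (Fin 3)) (i : Fin 3), i ∈ I → i ∉ J → ∀ w,
      halfProj φ I i w + halfProj φ J i w = w := by
    intro I J i hi hj w
    rw [halfProj_apply, halfProj_apply, if_pos hi, if_neg hj]
    match_scalars
    · field_simp
      norm_num
    · ring
  have hc : ∀ (I J : Finset (Fin 3)) (i : Fin 3), (i ∈ I ↔ i ∈ J) →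
      halfProj φ I i = halfProj φ J i := by
    intro I J i h
    simp only [halfProj, h]
  set U : Finset (Fin 3) := Finset.univ with hU
  have h0 := hq U ∅ 0 (by simp [U]) (by simp)
  have h1 := hq U ∅ 1 (by simp [U]) (by simp)
  have h2 := hq U ∅ 2 (by simp [U]) (by simp)
  rw [sum_finset_fin_three]
  simp only [eigenProj, Module.End.mul_apply]
  rw [hc {0} U 0 (by simp [U]), hc {0} ∅ 1 (by simp), hc {0} ∅ 2 (by simp),
    hc {1} U 1 (by simp [U]), hc {1} ∅ 0 (by simp), hc {1} ∅ 2 (by simp),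
    hc {2} U 2 (by simp [U]), hc {2} ∅ 0 (by simp), hc {2} ∅ 1 (by simp),
    hc {0, 1} U 0 (by simp [U]), hc {0, 1} U 1 (by simp [U]), hc {0, 1} ∅ 2 (by simp),
    hc {0, 2} U 0 (by simp [U]), hc {0, 2} U 2 (by simp [U]), hc {0, 2} ∅ 1 (by simp),
    hc {1, 2} U 1 (by simp [U]), hc {1, 2} U 2 (by simp [U]), hc {1, 2} ∅ 0 (by simp)]
  have e0 : ∀ w, halfProj φ ∅ 0 w = w - halfProj φ U 0 w := fun w => by
    rw [eq_sub_iff_add_eq', h0]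
  have e1 : ∀ w, halfProj φ ∅ 1 w = w - halfProj φ U 1 w := fun w => by
    rw [eq_sub_iff_add_eq', h1]
  have e2 : ∀ w, halfProj φ ∅ 2 w = w - halfProj φ U 2 w := fun w => by
    rw [eq_sub_iff_add_eq', h2]
  simp only [e0, e1, e2, map_sub]
  abel

/-- Commuting operators have independent joint eigenspaces. Distinct sets I give distinct systems of
eigenvalues because -1 ≠ 1. -/
theorem iSupIndep_eigen (h2 : (2 : K) ≠ 0) : iSupIndep (eigen φ) := by
  have h := Module.End.independent_iInf_maxGenEigenspace_of_forall_mapsTo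
    (fun i : Fin 3 => (φ (eps i) : Module.End K V)) (by
      intro i j μ
      apply Module.End.mapsTo_maxGenEigenspace_of_comm
      change φ (eps j) * φ (eps i) = φ (eps i) * φ (eps j)
      rw [← map_mul, eps_comm, map_mul])
  have hinj : Function.Injective
      (fun (I : Finset (Fin 3)) (i : Fin 3) => if i ∈ I then (-1 : K) else 1) := by
    have hne : (-1 : K) ≠ 1 := fun h => h2 (by linear_combination -h)
    intro I J hIJ
    ext i
    have := congrFun hIJ i
    simp only at this
    by_cases hi : i ∈ I <;> by_cases hj : i ∈ J
    · simp only [hi, hj]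
    · rw [if_pos hi, if_neg hj] at this
      exact absurd this hne
    · rw [if_neg hi, if_pos hj] at this
      exact absurd this.symm hne
    · simp only [hi, hj]
  refine (h.comp hinj).mono fun I v hv => ?_
  rw [Function.comp_apply, Submodule.mem_iInf]
  intro i
  have hmem : v ∈ Module.End.eigenspace (φ (eps i)) (if i ∈ I then (-1 : K) else 1) :=
    Module.End.mem_eigenspace_iff.mpr (hv i)
  exact Module.End.genEigenspace_le_maximal _ _ _ hmem

theorem isInternal_eigen (h2 : (2 : K) ≠ 0) : DirectSum.IsInternal (eigen φ) := by
  refine DirectSum.isInternal_submodule_of_iSupIndep_of_iSup_eq_top (iSupIndep_eigen φ h2) ?_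
  rw [eq_top_iff]
  intro v _
  rw [← sum_eigenProj φ h2 v]
  exact Submodule.sum_mem _ fun I _ => Submodule.mem_iSup_of_mem I (eigenProj_mem φ I v)

theorem sum_finrank_eigen (h2 : (2 : K) ≠ 0) [FiniteDimensional K V] :
    ∑ I, Module.finrank K (eigen φ I) = Module.finrank K V := by
  have e := LinearEquiv.ofBijective (DirectSum.coeLinearMap (eigen φ)) (isInternal_eigen φ h2)
  rw [← e.finrank_eq, Module.finrank_directSum]

theorem permOut_mem_eigen (κ : Equiv.Perm (Fin 3)) {I : Finset (Fin 3)} {v : V}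
    (hv : v ∈ eigen φ I) : φ (permOut κ) v ∈ eigen φ (I.map κ.toEmbedding) := by
  intro i
  obtain ⟨j, rfl⟩ := κ.surjective i
  rw [← Module.End.mul_apply, ← map_mul, ← permOut_mul_eps, map_mul, Module.End.mul_apply,
    (mem_eigen φ).mp hv j, map_smul]
  congr 1
  simp

theorem permOut_permOut (κ κ' : Equiv.Perm (Fin 3)) (v : V) :
    φ (permOut κ) (φ (permOut κ') v) = φ (permOut (κ * κ')) v := by
  rw [← Module.End.mul_apply, ← map_mul, ← map_mul]

theorem finrank_eigen_map [FiniteDimensional K V] (κ : Equiv.Perm (Fin 3)) (I : Finset (Fin 3)) :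
    Module.finrank K (eigen φ I) ≤ Module.finrank K (eigen φ (I.map κ.toEmbedding)) := by
  let f : eigen φ I →ₗ[K] eigen φ (I.map κ.toEmbedding) :=
    (φ (permOut κ)).restrict fun v hv => permOut_mem_eigen φ κ hv
  refine LinearMap.finrank_le_finrank_of_injective (f := f) ?_
  intro v w hvw
  have h : φ (permOut κ) v = φ (permOut κ) w := congrArg Subtype.val hvw
  have h' := congrArg (φ (permOut κ⁻¹)) h
  rw [permOut_permOut, permOut_permOut, inv_mul_cancel, map_one, map_one] at h'
  exact Subtype.ext h'

theorem finrank_eigen_of_card_eq [FiniteDimensional K V] {I J : Finset (Fin 3)}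
    (h : I.card = J.card) : Module.finrank K (eigen φ I) = Module.finrank K (eigen φ J) := by
  have hκ : ∀ I J : Finset (Fin 3), I.card = J.card →
      ∃ κ : Equiv.Perm (Fin 3), I.map κ.toEmbedding = J := by decide
  obtain ⟨κ, rfl⟩ := hκ I J h
  refine le_antisymm (finrank_eigen_map φ κ I) ?_
  have := finrank_eigen_map φ κ⁻¹ (I.map κ.toEmbedding)
  rwa [Finset.map_map, show κ.toEmbedding.trans (κ⁻¹).toEmbedding = Function.Embedding.refl _ by
    ext; simp, Finset.map_refl] at this

theorem eigenProj_dual (I : Finset (Fin 3)) (f : Module.Dual K V) :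
    eigenProj φ.dual I f = f ∘ₗ eigenProj φ I := by
  have hh : ∀ (i : Fin 3) (f : Module.Dual K V),
      halfProj φ.dual I i f = f ∘ₗ halfProj φ I i := by
    intro i f
    have hinv : (eps i : OutF 3)⁻¹ = eps i := inv_eq_of_mul_eq_one_right (eps_mul_self i)
    ext v
    simp [halfProj_apply, Representation.dual_apply, Module.Dual.transpose_apply, hinv]
    split_ifs <;> simp
  -- Dualizing reverses the order of the three factors, which is harmless because they commute.
  have hcomm : ∀ i j v, halfProj φ I i (halfProj φ I j v) = halfProj φ I j (halfProj φ I i v) := by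
    intro i j v
    rw [halfProj_apply φ I i, halfProj_apply φ I i v, eps_halfProj, map_smul, map_add, map_smul]
  ext v
  simp only [eigenProj, Module.End.mul_apply, hh, LinearMap.comp_apply]
  rw [hcomm 1 0, hcomm 2 0, hcomm 2 1]

/-- The ε_i are involutions, so the projection for the dual representation is the transpose of the
original one and has the same rank. -/
theorem finrank_eigen_dual (h2 : (2 : K) ≠ 0) [FiniteDimensional K V] (I : Finset (Fin 3)) :
    Module.finrank K (eigen φ.dual I) = Module.finrank K (eigen φ I) := by
  have : eigenProj φ.dual I = (eigenProj φ I).dualMap := by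
    ext1 f
    exact eigenProj_dual φ I f
  rw [← range_eigenProj φ.dual h2, ← range_eigenProj φ h2, this,
    LinearMap.finrank_range_dualMap_eq_finrank_range]

end Eigenspaces

/-! ### The relations as identities between operators. -/

section Relations

variable {K V : Type*} [Field K] [AddCommGroup V] [Module K V]
  (φ : Representation K (OutF 3) V)

theorem trans_eps_two (v : V) : φ trans (φ (eps 2) v) = φ (eps 2) (φ trans v) := by
  simpa only [map_mul, Module.End.mul_apply] using congrArg (fun g => φ g v) trans_mul_eps_two

theorem trans_eps_one_trans (v : V) : φ trans (φ (eps 1) (φ trans v)) = φ (eps 1) v := by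
  simpa only [map_mul, Module.End.mul_apply] using
    congrArg (fun g => φ g v) trans_mul_eps_one_mul_trans

theorem trans_braid_apply (v : V) :
    φ trans (φ (eps 1) (φ (permOut (Equiv.swap 0 1)) (φ trans (φ (eps 1) v)))) =
      φ (permOut (Equiv.swap 0 1)) (φ trans (φ (eps 1) (φ (permOut (Equiv.swap 0 1)) v))) := by
  simpa only [map_mul, Module.End.mul_apply] using congrArg (fun g => φ g v) trans_braid

theorem trans21_apply (v : V) : φ trans21 v =
    φ (permOut (Equiv.swap 0 2)) (φ trans (φ (permOut (Equiv.swap 0 2)) v)) := by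
  simp only [trans21, map_mul, Module.End.mul_apply]

theorem trans02_apply (v : V) : φ trans02 v =
    φ (permOut (Equiv.swap 1 2)) (φ trans (φ (permOut (Equiv.swap 1 2)) v)) := by
  simp only [trans02, map_mul, Module.End.mul_apply]

theorem trans_trans21 (v : V) : φ trans (φ trans21 v) = φ trans21 (φ trans v) := by
  simpa only [map_mul, Module.End.mul_apply] using congrArg (fun g => φ g v) trans_mul_trans21

theorem trans_left_trans02 (v : V) :
    φ trans (φ (eps 0) (φ (eps 2) (φ trans02 (φ (eps 0) (φ (eps 2) v))))) =
      φ (eps 0) (φ (eps 2) (φ trans02 (φ (eps 0) (φ (eps 2) (φ trans v))))) := by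
  simpa only [map_mul, Module.End.mul_apply] using congrArg (fun g => φ g v) trans_mul_left_trans02

theorem trans_trans21_trans02 (v : V) :
    φ trans (φ trans21 (φ trans02 v)) = φ trans02 (φ trans21 v) := by
  simpa only [map_mul, Module.End.mul_apply] using
    congrArg (fun g => φ g v) trans_mul_trans21_mul_trans02

theorem permOut_eps (κ : Equiv.Perm (Fin 3)) (i : Fin 3) (v : V) :
    φ (permOut κ) (φ (eps i) v) = φ (eps (κ i)) (φ (permOut κ) v) := by
  simpa only [map_mul, Module.End.mul_apply] using congrArg (fun g => φ g v) (permOut_mul_eps κ i)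

theorem swap_swap_apply (i j : Fin 3) (v : V) :
    φ (permOut (Equiv.swap i j)) (φ (permOut (Equiv.swap i j)) v) = v := by
  rw [permOut_permOut, Equiv.swap_mul_self, map_one, map_one, Module.End.one_apply]

theorem trans21_eps_zero (v : V) : φ trans21 (φ (eps 0) v) = φ (eps 0) (φ trans21 v) := by
  rw [trans21_apply, trans21_apply, permOut_eps]
  simp only [Equiv.swap_apply_left]
  rw [trans_eps_two, permOut_eps]
  simp

/-- The product of all the `ε_i`. -/
def epsAll : OutF 3 := eps 0 * eps 1 * eps 2

theorem epsAll_apply (v : V) : φ epsAll v = φ (eps 0) (φ (eps 1) (φ (eps 2) v)) := by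
  simp only [epsAll, map_mul, Module.End.mul_apply]

theorem trans_trans21_epsAll (v : V) :
    φ trans (φ trans21 (φ epsAll v)) = φ epsAll (φ trans (φ trans21 v)) := by
  simpa only [epsAll, map_mul, Module.End.mul_apply] using
    congrArg (fun g => φ g v) trans_mul_trans21_comm_eps

/-- The product of the two transvections is invertible and commutes with `epsAll`, so it maps every
eigenspace of `epsAll` onto itself. -/
theorem exists_trans_trans21_eq {v : V} {c : K} (hv : φ epsAll v = c • v) :
    ∃ w, φ trans (φ trans21 w) = v ∧ φ epsAll w = c • w := by
  have hinj : ∀ {a b : V}, φ trans (φ trans21 a) = φ trans (φ trans21 b) → a = b := by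
    intro a b h
    have h' := congrArg (φ (trans * trans21)⁻¹) h
    simp only [← Module.End.mul_apply, ← map_mul] at h'
    simpa [mul_assoc] using h'
  have hsurj : φ trans (φ trans21 (φ (trans * trans21)⁻¹ v)) = v := by
    simp only [← Module.End.mul_apply, ← map_mul]
    simp
  refine ⟨φ (trans * trans21)⁻¹ v, hsurj, hinj ?_⟩
  rw [trans_trans21_epsAll, hsurj, hv, map_smul, map_smul, hsurj]

end Relations

/-! ### Existence of a frame of the first level. -/

section IsFrame

variable {K V : Type*} [Field K] [AddCommGroup V] [Module K V]

/-- Eigenvectors spanning the first level, permuted by the symmetric group of degree three up to the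
sign `z`, such that `V` is the sum of the levels `0`, `1`, `3`. -/
structure IsFrame (φ : Representation K (OutF 3) V) (e₀ e₁ e₂ : V) (z : K) : Prop where
  mem₀ : e₀ ∈ eigen φ {0}
  mem₁ : e₁ ∈ eigen φ {1}
  mem₂ : e₂ ∈ eigen φ {2}
  ind : IndepFrame (eigen φ ∅) (eigen φ Finset.univ) e₀ e₁ e₂
  dec : ∀ v, ∃ w ∈ eigen φ ∅, ∃ a b c : K, ∃ g ∈ eigen φ Finset.univ,
    v = w + a • e₀ + b • e₁ + c • e₂ + g
  sq : z * z = 1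
  swap₀₁₀ : φ (permOut (Equiv.swap 0 1)) e₀ = z • e₁
  swap₀₁₁ : φ (permOut (Equiv.swap 0 1)) e₁ = z • e₀
  swap₀₁₂ : φ (permOut (Equiv.swap 0 1)) e₂ = z • e₂
  swap₀₂₀ : φ (permOut (Equiv.swap 0 2)) e₀ = z • e₂
  swap₀₂₁ : φ (permOut (Equiv.swap 0 2)) e₁ = z • e₁
  swap₀₂₂ : φ (permOut (Equiv.swap 0 2)) e₂ = z • e₀
  swap₁₂₀ : φ (permOut (Equiv.swap 1 2)) e₀ = z • e₀
  swap₁₂₁ : φ (permOut (Equiv.swap 1 2)) e₁ = z • e₂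
  swap₁₂₂ : φ (permOut (Equiv.swap 1 2)) e₂ = z • e₁

variable (φ : Representation K (OutF 3) V)

theorem indepFrame_of_mem (h2 : (2 : K) ≠ 0) {e₀ e₁ e₂ : V} (m₀ : e₀ ∈ eigen φ {0})
    (m₁ : e₁ ∈ eigen φ {1}) (m₂ : e₂ ∈ eigen φ {2}) (n₀ : e₀ ≠ 0) (n₁ : e₁ ≠ 0) (n₂ : e₂ ≠ 0) :
    IndepFrame (eigen φ ∅) (eigen φ Finset.univ) e₀ e₁ e₂ := by
  intro w a b c g hw hg h
  have a0 := congrArg (φ (eps 0)) h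
  have a1 := congrArg (φ (eps 1)) h
  have a2 := congrArg (φ (eps 2)) h
  simp only [map_add, map_smul, map_zero] at a0 a1 a2
  rw [eps_apply_of_notMem φ hw (by simp), eps_apply_of_mem φ m₀ (by simp),
    eps_apply_of_notMem φ m₁ (by simp), eps_apply_of_notMem φ m₂ (by simp),
    eps_apply_of_mem φ hg (by simp)] at a0
  rw [eps_apply_of_notMem φ hw (by simp), eps_apply_of_notMem φ m₀ (by simp),
    eps_apply_of_mem φ m₁ (by simp), eps_apply_of_notMem φ m₂ (by simp),
    eps_apply_of_mem φ hg (by simp)] at a1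
  rw [eps_apply_of_notMem φ hw (by simp), eps_apply_of_notMem φ m₀ (by simp),
    eps_apply_of_notMem φ m₁ (by simp), eps_apply_of_mem φ m₂ (by simp),
    eps_apply_of_mem φ hg (by simp)] at a2
  have a01 := congrArg (φ (eps 1)) a0
  simp only [map_add, map_smul, map_neg, map_zero] at a01
  rw [eps_apply_of_notMem φ hw (by simp), eps_apply_of_notMem φ m₀ (by simp),
    eps_apply_of_mem φ m₁ (by simp), eps_apply_of_notMem φ m₂ (by simp),
    eps_apply_of_mem φ hg (by simp)] at a01
  have h4 : (4 : K) ≠ 0 := by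
    rw [show (4 : K) = 2 * 2 by norm_num]
    exact mul_ne_zero h2 h2
  have key : ∀ u : V, (4 : K) • u = 0 → u = 0 := fun u hu => (smul_eq_zero.mp hu).resolve_left h4
  have hb : b • e₁ = 0 := key _ (by linear_combination (norm := module) h + a0 - a1 - a01)
  have ha : a • e₀ = 0 := key _ (by linear_combination (norm := module) h - a0 + a1 - a01)
  have hg0 : g = 0 := key _ (by
    linear_combination (norm := module) (2 : K) • h - (2 : K) • a0 - (4 : K) • ha)
  have hc : c • e₂ = 0 := key _ (by
    linear_combination (norm := module) (2 : K) • h - (2 : K) • a2 - (4 : K) • hg0)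
  have hw0 : w = 0 := by
    linear_combination (norm := module) h - ha - hb - hc - hg0
  exact ⟨hw0, (smul_eq_zero.mp ha).resolve_right n₀, (smul_eq_zero.mp hb).resolve_right n₁,
    (smul_eq_zero.mp hc).resolve_right n₂, hg0⟩

/-- The swap of 0 and 1 acts on the line E_{2} by a sign z. Carrying e_2 to the other lines by the
remaining swaps, rescaled by z, makes each transposition act as z times a permutation of the frame.
-/
theorem exists_isFrame (h2 : (2 : K) ≠ 0) [FiniteDimensional K V]
    (hd1 : ∀ I : Finset (Fin 3), I.card = 1 → Module.finrank K (eigen φ I) = 1)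
    (hd2 : ∀ I : Finset (Fin 3), I.card = 2 → Module.finrank K (eigen φ I) = 0) :
    ∃ e₀ e₁ e₂ : V, ∃ z : K, IsFrame φ e₀ e₁ e₂ z := by
  have hmul : ∀ {I : Finset (Fin 3)}, I.card = 1 → ∀ {u w : V}, u ∈ eigen φ I → u ≠ 0 →
      w ∈ eigen φ I → ∃ c : K, w = c • u := by
    intro I hI u w hu hu0 hw
    obtain ⟨c, hc⟩ := (finrank_eq_one_iff_of_nonzero' (⟨u, hu⟩ : eigen φ I)
      (fun h => hu0 (congrArg Subtype.val h))).mp (hd1 I hI) ⟨w, hw⟩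
    exact ⟨c, (congrArg Subtype.val hc).symm⟩
  obtain ⟨⟨e₂, m₂⟩, hne⟩ := Module.finrank_pos_iff_exists_ne_zero.mp
    (by rw [hd1 {2} (by simp)]; norm_num : 0 < Module.finrank K (eigen φ {2}))
  have n₂ : e₂ ≠ 0 := fun h => hne (Subtype.ext h)
  have hs2 : φ (permOut (Equiv.swap 0 1)) e₂ ∈ eigen φ {2} := by
    have := permOut_mem_eigen φ (Equiv.swap 0 1) m₂
    rwa [show ({2} : Finset (Fin 3)).map (Equiv.swap (0 : Fin 3) 1).toEmbedding = {2} by decide]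
      at this
  obtain ⟨z, hz⟩ := hmul (by simp) m₂ n₂ hs2
  have hzz : z * z = 1 := by
    have := swap_swap_apply φ 0 1 e₂
    rw [hz, map_smul, hz] at this
    have h : (z * z - 1) • e₂ = 0 := by linear_combination (norm := module) this
    linear_combination (smul_eq_zero.mp h).resolve_right n₂
  have hz0 : z ≠ 0 := fun h => by simp [h] at hzz
  obtain ⟨e₀, he₀⟩ : ∃ e₀, e₀ = z • φ (permOut (Equiv.swap 0 2)) e₂ := ⟨_, rfl⟩
  obtain ⟨e₁, he₁⟩ : ∃ e₁, e₁ = z • φ (permOut (Equiv.swap 1 2)) e₂ := ⟨_, rfl⟩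
  have b022 : φ (permOut (Equiv.swap 0 2)) e₂ = z • e₀ := by rw [he₀, smul_smul, hzz, one_smul]
  have b122 : φ (permOut (Equiv.swap 1 2)) e₂ = z • e₁ := by rw [he₁, smul_smul, hzz, one_smul]
  have hcyc : φ (permOut (Equiv.swap 0 1)) (φ (permOut (Equiv.swap 0 2)) e₂) =
      φ (permOut (Equiv.swap 1 2)) (φ (permOut (Equiv.swap 0 1)) e₂) := by
    rw [permOut_permOut, permOut_permOut]
    congr 3
    decide
  have hcyc' : φ (permOut (Equiv.swap 0 2)) (φ (permOut (Equiv.swap 1 2)) e₂) =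
      φ (permOut (Equiv.swap 1 2)) (φ (permOut (Equiv.swap 0 1)) e₂) := by
    rw [permOut_permOut, permOut_permOut]
    congr 3
    decide
  have hcyc'' : φ (permOut (Equiv.swap 1 2)) (φ (permOut (Equiv.swap 0 2)) e₂) =
      φ (permOut (Equiv.swap 0 2)) (φ (permOut (Equiv.swap 0 1)) e₂) := by
    rw [permOut_permOut, permOut_permOut]
    congr 3
    decide
  have b010 : φ (permOut (Equiv.swap 0 1)) e₀ = z • e₁ := by
    rw [he₀, map_smul, hcyc, hz, map_smul, b122, smul_smul, hzz, one_smul]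
  have b021 : φ (permOut (Equiv.swap 0 2)) e₁ = z • e₁ := by
    rw [he₁, map_smul, hcyc', hz, map_smul, smul_smul, hzz, one_smul, b122, he₁]
  have b120 : φ (permOut (Equiv.swap 1 2)) e₀ = z • e₀ := by
    rw [he₀, map_smul, hcyc'', hz, map_smul, smul_smul, hzz, one_smul, b022, he₀]
  have b020 : φ (permOut (Equiv.swap 0 2)) e₀ = z • e₂ := by
    rw [he₀, map_smul, swap_swap_apply]
  have b121 : φ (permOut (Equiv.swap 1 2)) e₁ = z • e₂ := by
    rw [he₁, map_smul, swap_swap_apply]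
  have b011 : φ (permOut (Equiv.swap 0 1)) e₁ = z • e₀ := by
    have : e₁ = z • φ (permOut (Equiv.swap 0 1)) e₀ := by rw [b010, smul_smul, hzz, one_smul]
    rw [this, map_smul, swap_swap_apply]
  have m₀ : e₀ ∈ eigen φ {0} := by
    have := permOut_mem_eigen φ (Equiv.swap 0 2) m₂
    rw [show ({2} : Finset (Fin 3)).map (Equiv.swap (0 : Fin 3) 2).toEmbedding = {0} by decide]
      at this
    exact he₀ ▸ Submodule.smul_mem _ z this
  have m₁ : e₁ ∈ eigen φ {1} := by
    have := permOut_mem_eigen φ (Equiv.swap 1 2) m₂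
    rw [show ({2} : Finset (Fin 3)).map (Equiv.swap (1 : Fin 3) 2).toEmbedding = {1} by decide]
      at this
    exact he₁ ▸ Submodule.smul_mem _ z this
  have n₀ : e₀ ≠ 0 := by
    rintro rfl
    rw [map_zero] at b020
    exact smul_ne_zero hz0 n₂ b020.symm
  have n₁ : e₁ ≠ 0 := by
    rintro rfl
    rw [map_zero] at b121
    exact smul_ne_zero hz0 n₂ b121.symm
  refine ⟨e₀, e₁, e₂, z, m₀, m₁, m₂, indepFrame_of_mem φ h2 m₀ m₁ m₂ n₀ n₁ n₂, fun v => ?_, hzz,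
    b010, b011, hz, b020, b021, b022, b120, b121, b122⟩
  have hzero : ∀ I : Finset (Fin 3), I.card = 2 → eigenProj φ I v = 0 := by
    intro I hI
    have h1 := Submodule.finrank_eq_zero.mp (hd2 I hI)
    have h2 := eigenProj_mem φ I v
    rwa [h1, Submodule.mem_bot] at h2
  have hsum := sum_eigenProj φ h2 v
  rw [sum_finset_fin_three, hzero {0, 1} (by decide), hzero {0, 2} (by decide),
    hzero {1, 2} (by decide)] at hsum
  obtain ⟨a, ha⟩ := hmul (by simp) m₀ n₀ (eigenProj_mem φ {0} v)
  obtain ⟨b, hb⟩ := hmul (by simp) m₁ n₁ (eigenProj_mem φ {1} v)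
  obtain ⟨c, hc⟩ := hmul (by simp) m₂ n₂ (eigenProj_mem φ {2} v)
  refine ⟨eigenProj φ ∅ v, eigenProj_mem φ ∅ v, a, b, c, eigenProj φ Finset.univ v,
    eigenProj_mem φ _ v, ?_⟩
  rw [← ha, ← hb, ← hc]
  conv_lhs => rw [← hsum]
  abel

end IsFrame

section Dimension

variable {K V : Type*} [Field K] [AddCommGroup V] [Module K V]

theorem exists_smul_of_finrank_le_one [FiniteDimensional K V] {W : Submodule K V}
    (hW : Module.finrank K W ≤ 1) {g g' : V} (hg : g ∈ W) (hg' : g' ∈ W) (hg0 : g ≠ 0) :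
    ∃ c : K, g' = c • g := by
  obtain ⟨v, hv⟩ := finrank_le_one_iff.mp hW
  obtain ⟨a, ha⟩ := hv ⟨g, hg⟩
  obtain ⟨b, hb⟩ := hv ⟨g', hg'⟩
  have ha' : a • (v : V) = g := congrArg Subtype.val ha
  have hb' : b • (v : V) = g' := congrArg Subtype.val hb
  have ha0 : a ≠ 0 := by
    rintro rfl
    rw [zero_smul] at ha'
    exact hg0 ha'.symm
  refine ⟨b * a⁻¹, ?_⟩
  rw [← ha', ← hb', smul_smul, mul_assoc, inv_mul_cancel₀ ha0, mul_one]

theorem span_pair_of_finrank_le_two [FiniteDimensional K V] {W : Submodule K V}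
    (hW : Module.finrank K W ≤ 2) {g g' : V} (hg : g ∈ W) (hg' : g' ∈ W) (hg0 : g ≠ 0)
    (h : ¬∃ c : K, g' = c • g) :
    Module.finrank K W = 2 ∧ ∀ u ∈ W, ∃ a b : K, u = a • g + b • g' := by
  have hli : LinearIndependent K ![(⟨g, hg⟩ : W), ⟨g', hg'⟩] := by
    rw [LinearIndependent.pair_iff' (fun h => hg0 (congrArg Subtype.val h))]
    intro a ha
    exact h ⟨a, (congrArg Subtype.val ha).symm⟩
  have hcard := hli.fintype_card_le_finrank
  rw [Fintype.card_fin] at hcard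
  have h2 : Module.finrank K W = 2 := le_antisymm hW hcard
  refine ⟨h2, fun u hu => ?_⟩
  have htop := hli.span_eq_top_of_card_eq_finrank' (by rw [Fintype.card_fin, h2])
  have hmem : (⟨u, hu⟩ : W) ∈ Submodule.span K (Set.range ![(⟨g, hg⟩ : W), ⟨g', hg'⟩]) := by
    rw [htop]
    trivial
  rw [Matrix.range_cons, Matrix.range_cons, Matrix.range_empty, Set.union_empty,
    Set.singleton_union, Submodule.mem_span_pair] at hmem
  obtain ⟨a, b, hab⟩ := hmem
  exact ⟨a, b, (congrArg Subtype.val hab).symm⟩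

end Dimension

/-! ### The matrix of a transvection on a frame. -/

section Action

variable {K V : Type*} [Field K] [AddCommGroup V] [Module K V]
  {φ : Representation K (OutF 3) V} {e₀ e₁ e₂ : V} {z : K}

theorem rep_injective (φ : Representation K (OutF 3) V) (g : OutF 3) {a b : V}
    (h : φ g a = φ g b) : a = b := by
  have h' := congrArg (φ g⁻¹) h
  simpa only [← Module.End.mul_apply, ← map_mul, inv_mul_cancel, map_one,
    Module.End.one_apply] using h'

namespace IsFrame

theorem eps_two_apply (h : IsFrame φ e₀ e₁ e₂ z) {w g : V} (hw : w ∈ eigen φ ∅)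
    (hg : g ∈ eigen φ Finset.univ) (a b c : K) :
    φ (eps 2) (w + a • e₀ + b • e₁ + c • e₂ + g) = w + a • e₀ + b • e₁ - c • e₂ - g := by
  simp only [map_add, map_smul, eps_apply_of_notMem φ hw (i := 2) (by simp),
    eps_apply_of_notMem φ h.mem₀ (i := 2) (by simp),
    eps_apply_of_notMem φ h.mem₁ (i := 2) (by simp), eps_apply_of_mem φ h.mem₂ (i := 2) (by simp),
    eps_apply_of_mem φ hg (i := 2) (by simp)]
  module

theorem epsAll_comb (h : IsFrame φ e₀ e₁ e₂ z) {w g : V} (hw : w ∈ eigen φ ∅)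
    (hg : g ∈ eigen φ Finset.univ) (a b c : K) :
    φ epsAll (w + a • e₀ + b • e₁ + c • e₂ + g) = w - a • e₀ - b • e₁ - c • e₂ - g := by
  rw [epsAll_apply, h.eps_two_apply hw hg]
  simp only [map_add, map_sub, map_smul, map_neg, eps_apply_of_notMem φ hw (i := 0) (by simp),
    eps_apply_of_notMem φ hw (i := 1) (by simp),
    eps_apply_of_mem φ h.mem₀ (i := 0) (by simp), eps_apply_of_notMem φ h.mem₀ (i := 1) (by simp),
    eps_apply_of_notMem φ h.mem₁ (i := 0) (by simp), eps_apply_of_mem φ h.mem₁ (i := 1) (by simp),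
    eps_apply_of_notMem φ h.mem₂ (i := 0) (by simp),
    eps_apply_of_notMem φ h.mem₂ (i := 1) (by simp),
    eps_apply_of_mem φ hg (i := 0) (by simp), eps_apply_of_mem φ hg (i := 1) (by simp)]
  module

theorem eq_of_eps_two_fixed (h2 : (2 : K) ≠ 0) (h : IsFrame φ e₀ e₁ e₂ z) {v : V}
    (hv : φ (eps 2) v = v) : ∃ w ∈ eigen φ ∅, ∃ a b : K, v = w + a • e₀ + b • e₁ := by
  obtain ⟨w, hw, a, b, c, g, hg, rfl⟩ := h.dec v
  rw [h.eps_two_apply hw hg] at hv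
  obtain ⟨-, -, -, hc, hg0⟩ := h.ind 0 0 0 (2 * c) ((2 : K) • g) (Submodule.zero_mem _)
    (Submodule.smul_mem _ _ hg) (by linear_combination (norm := module) -hv)
  refine ⟨w, hw, a, b, ?_⟩
  rw [(mul_eq_zero.mp hc).resolve_left h2, (smul_eq_zero.mp hg0).resolve_left h2]
  module

theorem eq_of_eps_two_neg (h2 : (2 : K) ≠ 0) (h : IsFrame φ e₀ e₁ e₂ z) {v : V}
    (hv : φ (eps 2) v = -v) : ∃ c : K, ∃ g ∈ eigen φ Finset.univ, v = c • e₂ + g := by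
  obtain ⟨w, hw, a, b, c, g, hg, rfl⟩ := h.dec v
  rw [h.eps_two_apply hw hg] at hv
  obtain ⟨hw0, ha, hb, -, -⟩ := h.ind ((2 : K) • w) (2 * a) (2 * b) 0 0
    (Submodule.smul_mem _ _ hw) (Submodule.zero_mem _)
    (by linear_combination (norm := module) hv)
  refine ⟨c, g, hg, ?_⟩
  rw [(mul_eq_zero.mp ha).resolve_left h2, (mul_eq_zero.mp hb).resolve_left h2,
    (smul_eq_zero.mp hw0).resolve_left h2]
  module

/-- `epsAll` acts on V_k by (-1)^k, and a frame excludes V_2, so V_0 is all that is fixed. -/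
theorem mem_of_epsAll_fixed (h2 : (2 : K) ≠ 0) (h : IsFrame φ e₀ e₁ e₂ z) {v : V}
    (hv : φ epsAll v = v) : v ∈ eigen φ ∅ := by
  obtain ⟨w, hw, a, b, c, g, hg, rfl⟩ := h.dec v
  rw [h.epsAll_comb hw hg] at hv
  obtain ⟨-, ha, hb, hc, hg0⟩ := h.ind 0 (2 * a) (2 * b) (2 * c) ((2 : K) • g)
    (Submodule.zero_mem _) (Submodule.smul_mem _ _ hg)
    (by linear_combination (norm := module) -hv)
  rw [(mul_eq_zero.mp ha).resolve_left h2, (mul_eq_zero.mp hb).resolve_left h2,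
    (mul_eq_zero.mp hc).resolve_left h2, (smul_eq_zero.mp hg0).resolve_left h2]
  simpa using hw

theorem eq_of_epsAll_neg (h2 : (2 : K) ≠ 0) (h : IsFrame φ e₀ e₁ e₂ z) {v : V}
    (hv : φ epsAll v = -v) :
    ∃ a b c : K, ∃ g ∈ eigen φ Finset.univ, v = a • e₀ + b • e₁ + c • e₂ + g := by
  obtain ⟨w, hw, a, b, c, g, hg, rfl⟩ := h.dec v
  rw [h.epsAll_comb hw hg] at hv
  obtain ⟨hw0, -⟩ := h.ind ((2 : K) • w) 0 0 0 0
    (Submodule.smul_mem _ _ hw) (Submodule.zero_mem _)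
    (by linear_combination (norm := module) hv)
  refine ⟨a, b, c, g, hg, ?_⟩
  rw [(smul_eq_zero.mp hw0).resolve_left h2]
  module

theorem epsAll_fixed (h : IsFrame φ e₀ e₁ e₂ z) {w : V} (hw : w ∈ eigen φ ∅) :
    φ epsAll w = w := by
  have := h.epsAll_comb hw (Submodule.zero_mem _) 0 0 0
  simpa using this

/-- A transvection maps the fixed space of the `ε_i` to the fixed space of `ε₀` and `ε₂`. -/
theorem trans_fixed (h2 : (2 : K) ≠ 0) (h : IsFrame φ e₀ e₁ e₂ z) {w : V} (hw : w ∈ eigen φ ∅) :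
    ∃ w' ∈ eigen φ ∅, ∃ b : K, φ trans w = w' + b • e₁ := by
  obtain ⟨u, hu1, hu2⟩ := exists_trans_trans21_eq φ (v := w) (c := 1)
    (by rw [one_smul, h.epsAll_fixed hw])
  rw [one_smul] at hu2
  have hu := h.mem_of_epsAll_fixed h2 hu2
  -- The inverse of `trans` is its conjugate by ε_1. As `trans21` commutes with ε_0 and u lies in
  -- V_0, this identity transfers the invariance under ε_0 to the image of w.
  have h21 : φ trans21 u = φ (eps 1) (φ trans w) := by
    apply rep_injective φ trans
    rw [hu1, trans_eps_one_trans, eps_apply_of_notMem φ hw (by simp)]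
  have h0 : φ (eps 0) (φ trans w) = φ trans w := by
    have h1 : φ (eps 0) (φ trans21 u) = φ trans21 u := by
      rw [← trans21_eps_zero, eps_apply_of_notMem φ hu (by simp)]
    rw [h21, eps_eps_comm] at h1
    have := congrArg (φ (eps 1)) h1
    rwa [eps_eps, eps_eps] at this
  obtain ⟨w', hw', a, b, hab⟩ := h.eq_of_eps_two_fixed h2
    (v := φ trans w) (by rw [← trans_eps_two, eps_apply_of_notMem φ hw (by simp)])
  refine ⟨w', hw', b, ?_⟩
  rw [hab, map_add, map_add, map_smul, map_smul, eps_apply_of_notMem φ hw' (by simp),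
    eps_apply_of_mem φ h.mem₀ (by simp), eps_apply_of_notMem φ h.mem₁ (by simp)] at h0
  have := (h.ind 0 (2 * a) 0 0 0 (Submodule.zero_mem _) (Submodule.zero_mem _)
    (by linear_combination (norm := module) -h0)).2.1
  rw [hab, (mul_eq_zero.mp this).resolve_left h2]
  module

/-- The preimage u of e_0 under `trans21` is negated by ε_0. So u plus its image under `epsAll` lies
in V_0 and is negated by ε_0, hence is zero. Thus u, and with it the image of e_0 under `trans`, is
odd for `epsAll`, which excludes a component in V_0. -/
theorem trans_e₀ (h2 : (2 : K) ≠ 0) (h : IsFrame φ e₀ e₁ e₂ z) :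
    ∃ p r : K, φ trans e₀ = p • e₀ + r • e₁ := by
  obtain ⟨w, hw, a, b, hab⟩ := h.eq_of_eps_two_fixed h2
    (v := φ trans e₀) (by rw [← trans_eps_two, eps_apply_of_notMem φ h.mem₀ (by simp)])
  -- a preimage of `e₀` under the second transvection
  obtain ⟨u, hu⟩ : ∃ u, φ trans21 u = e₀ := ⟨φ trans21⁻¹ e₀, by
    rw [← Module.End.mul_apply, ← map_mul]
    simp⟩
  have hu0 : φ (eps 0) u = -u := rep_injective φ trans21 (by
    rw [trans21_eps_zero, hu, eps_apply_of_mem φ h.mem₀ (by simp), map_neg, hu])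
  have hfix : u + φ epsAll u = 0 := by
    have h1 : φ epsAll (u + φ epsAll u) = u + φ epsAll u := by
      have : φ epsAll (φ epsAll u) = u := by
        rw [epsAll_apply, epsAll_apply, eps_eps_comm φ 2 0, eps_eps_comm φ 1 0, eps_eps,
          eps_eps_comm φ 2 1, eps_eps, eps_eps]
      rw [map_add, this, add_comm]
    have h3 := eps_apply_of_notMem φ (h.mem_of_epsAll_fixed h2 h1) (i := 0) (by simp)
    have h4 : φ (eps 0) (φ epsAll u) = -φ epsAll u := by
      have h5 : φ epsAll u = -φ (eps 1) (φ (eps 2) u) := by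
        rw [epsAll_apply, eps_eps_comm φ 0 1, eps_eps_comm φ 0 2, hu0, map_neg, map_neg]
      rw [epsAll_apply, eps_eps, ← epsAll_apply, h5, neg_neg]
    rw [map_add, hu0, h4] at h3
    have : (2 : K) • (u + φ epsAll u) = 0 := by linear_combination (norm := module) -h3
    exact (smul_eq_zero.mp this).resolve_left h2
  have hneg : φ epsAll (φ trans e₀) = -φ trans e₀ := by
    rw [← hu, ← trans_trans21_epsAll, eq_neg_of_add_eq_zero_right hfix, map_neg, map_neg]
  obtain ⟨p, r, c, g, hg, heq⟩ := h.eq_of_epsAll_neg h2 hneg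
  obtain ⟨-, -, -, hc, hg0⟩ := h.ind (-w) (p - a) (r - b) c g (Submodule.neg_mem _ hw) hg (by
    linear_combination (norm := module) hab - heq)
  refine ⟨p, r, ?_⟩
  rw [heq, hc, hg0]
  module

/-- The matrix of a transvection on the first level. -/
theorem trans_apply (h2 : (2 : K) ≠ 0) (h3 : (3 : K) ≠ 0) [FiniteDimensional K V]
    (h : IsFrame φ e₀ e₁ e₂ z)
    (hd : Module.finrank K (eigen φ ∅) + Module.finrank K (eigen φ Finset.univ) = 2) :
    z = 1 ∧ ∃ q r : K, φ trans e₀ = e₀ + r • e₁ ∧ φ trans e₁ = q • e₀ + e₁ ∧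
      φ trans e₂ = e₂ ∧ q * r = 0 ∧ r - q = -1 := by
  obtain ⟨p, r, hT0⟩ := h.trans_e₀ h2
  obtain ⟨v, hv, q, s, hT1⟩ := h.eq_of_eps_two_fixed h2
    (v := φ trans e₁) (by rw [← trans_eps_two, eps_apply_of_notMem φ h.mem₁ (by simp)])
  obtain ⟨x, f, hf, hT2⟩ := h.eq_of_eps_two_neg h2
    (v := φ trans e₂) (by rw [← trans_eps_two, eps_apply_of_mem φ h.mem₂ (by simp), map_neg])
  have hTF : ∀ g ∈ eigen φ Finset.univ, ∃ y : K, ∃ g' ∈ eigen φ Finset.univ,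
      φ trans g = y • e₂ + g' := fun g hg => h.eq_of_eps_two_neg h2
    (by rw [← trans_eps_two, eps_apply_of_mem φ hg (by simp), map_neg])
  have m01 := eps_apply_of_notMem φ h.mem₀ (i := 1) (by simp)
  have m11 := eps_apply_of_mem φ h.mem₁ (i := 1) (by simp)
  have m21 := eps_apply_of_notMem φ h.mem₂ (i := 1) (by simp)
  have mv1 := eps_apply_of_notMem φ hv (i := 1) (by simp)
  have mf1 := eps_apply_of_mem φ hf (i := 1) (by simp)
  have hperm : ∀ (κ : Equiv.Perm (Fin 3)) (w : V), w ∈ eigen φ ∅ →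
      φ (permOut κ) w ∈ eigen φ ∅ := fun κ w hw => by
    simpa using permOut_mem_eigen φ κ hw
  have hperm' : ∀ (κ : Equiv.Perm (Fin 3)) (w : V), w ∈ eigen φ Finset.univ →
      φ (permOut κ) w ∈ eigen φ Finset.univ := fun κ w hw => by
    simpa using permOut_mem_eigen φ κ hw
  have hconj : ∀ (a b c : Equiv.Perm (Fin 3)), c = a * b * a →
      ∀ w, φ (permOut c) w = φ (permOut a) (φ (permOut b) (φ (permOut a) w)) := by
    intro a b c hc w
    rw [permOut_permOut, permOut_permOut, hc, mul_assoc]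
  have hz := h.sq
  have hA : φ trans (p • e₀ - r • e₁) = e₀ := by
    have h1 : φ (eps 1) (φ trans e₀) = p • e₀ - r • e₁ := by
      rw [hT0, map_add, map_smul, map_smul, m01, m11]
      module
    rw [← h1, trans_eps_one_trans, m01]
  have hB : φ trans (v + q • e₀ - s • e₁) = -e₁ := by
    have h1 : φ (eps 1) (φ trans e₁) = v + q • e₀ - s • e₁ := by
      rw [hT1, map_add, map_add, map_smul, map_smul, m01, m11, mv1]
      module
    rw [← h1, trans_eps_one_trans, m11]
  have hC : φ trans (x • e₂ - f) = e₂ := by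
    have h1 : φ (eps 1) (φ trans e₂) = x • e₂ - f := by
      rw [hT2, map_add, map_smul, m21, mf1]
      module
    rw [← h1, trans_eps_one_trans, m21]
  have hD : z • (-(p • φ trans e₁) + r • φ trans e₀) =
      -(z • φ (permOut (Equiv.swap 0 1)) v) - q • e₁ - s • e₀ := by
    have h1 : φ (eps 1) (φ (permOut (Equiv.swap 0 1)) (φ trans (φ (eps 1) e₀))) =
        z • (-(p • e₁) + r • e₀) := by
      rw [m01, hT0]
      simp only [map_add, map_smul, h.swap₀₁₀, h.swap₀₁₁, m01, m11]
      module
    have h4 : φ (eps 1) (φ (permOut (Equiv.swap 0 1)) e₀) = -(z • e₁) := by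
      rw [h.swap₀₁₀, map_smul, m11, smul_neg]
    have h5 := trans_braid_apply φ e₀
    rw [h1, h4, map_smul, map_add, map_neg, map_smul, map_smul] at h5
    rw [h5, map_neg, map_smul, hT1]
    simp only [map_add, map_smul, map_neg, h.swap₀₁₀, h.swap₀₁₁]
    linear_combination (norm := module)
      -(q • congrArg (fun t => t • e₁) hz) - s • congrArg (fun t => t • e₀) hz
  have hbr : (x * z) • φ trans e₂ - φ trans (φ (permOut (Equiv.swap 0 1)) f) =
      x • e₂ + z • φ (permOut (Equiv.swap 0 1)) f := by
    have h1 : φ (eps 1) (φ (permOut (Equiv.swap 0 1)) (φ trans (φ (eps 1) e₂))) =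
        (x * z) • e₂ - φ (permOut (Equiv.swap 0 1)) f := by
      rw [m21, hT2]
      simp only [map_add, map_smul, h.swap₀₁₂, m21,
        eps_apply_of_mem φ (hperm' (Equiv.swap 0 1) f hf) (i := 1) (by simp)]
      module
    have h4 : φ (eps 1) (φ (permOut (Equiv.swap 0 1)) e₂) = z • e₂ := by
      rw [h.swap₀₁₂, map_smul, m21]
    have h5 := trans_braid_apply φ e₂
    rw [h1, h4, map_smul, map_sub, map_smul] at h5
    rw [h5, hT2]
    simp only [map_add, map_smul, h.swap₀₁₂]
    linear_combination (norm := module) x • congrArg (fun t => t • e₂) hz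
  have h21₁ : φ trans21 e₁ = z • φ (permOut (Equiv.swap 0 2)) v + q • e₂ + s • e₁ := by
    rw [trans21_apply, h.swap₀₂₁, map_smul, hT1]
    simp only [map_add, map_smul, h.swap₀₂₀, h.swap₀₂₁]
    linear_combination (norm := module)
      q • congrArg (fun t => t • e₂) hz + s • congrArg (fun t => t • e₁) hz
  have h21₀ : φ trans21 e₀ = x • e₀ + z • φ (permOut (Equiv.swap 0 2)) f := by
    rw [trans21_apply, h.swap₀₂₀, map_smul, hT2]
    simp only [map_add, map_smul, h.swap₀₂₂]
    linear_combination (norm := module) x • congrArg (fun t => t • e₀) hz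
  have h02₂ : φ trans02 e₂ = z • φ (permOut (Equiv.swap 1 2)) v + q • e₀ + s • e₂ := by
    rw [trans02_apply, h.swap₁₂₂, map_smul, hT1]
    simp only [map_add, map_smul, h.swap₁₂₀, h.swap₁₂₁]
    linear_combination (norm := module)
      q • congrArg (fun t => t • e₀) hz + s • congrArg (fun t => t • e₂) hz
  have h02₁ : φ trans02 e₁ = x • e₁ + z • φ (permOut (Equiv.swap 1 2)) f := by
    rw [trans02_apply, h.swap₁₂₁, map_smul, hT2]
    simp only [map_add, map_smul, h.swap₁₂₂]
    linear_combination (norm := module) x • congrArg (fun t => t • e₁) hz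
  have h02₀ : φ trans02 e₀ = p • e₀ + r • e₂ := by
    rw [trans02_apply, h.swap₁₂₀, map_smul, hT0]
    simp only [map_add, map_smul, h.swap₁₂₀, h.swap₁₂₁]
    linear_combination (norm := module)
      p • congrArg (fun t => t • e₀) hz + r • congrArg (fun t => t • e₂) hz
  have m00 := eps_apply_of_mem φ h.mem₀ (i := 0) (by simp)
  have m10 := eps_apply_of_notMem φ h.mem₁ (i := 0) (by simp)
  have m20 := eps_apply_of_notMem φ h.mem₂ (i := 0) (by simp)
  have m02 := eps_apply_of_notMem φ h.mem₀ (i := 2) (by simp)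
  have m12 := eps_apply_of_notMem φ h.mem₁ (i := 2) (by simp)
  have m22 := eps_apply_of_mem φ h.mem₂ (i := 2) (by simp)
  have mF0 : ∀ g ∈ eigen φ Finset.univ, φ (eps 0) g = -g := fun g hg =>
    eps_apply_of_mem φ hg (by simp)
  have mF2 : ∀ g ∈ eigen φ Finset.univ, φ (eps 2) g = -g := fun g hg =>
    eps_apply_of_mem φ hg (by simp)
  have mE0 : ∀ g ∈ eigen φ ∅, φ (eps 0) g = g := fun g hg => eps_apply_of_notMem φ hg (by simp)
  have mE2 : ∀ g ∈ eigen φ ∅, φ (eps 2) g = g := fun g hg => eps_apply_of_notMem φ hg (by simp)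
  have hv0 : v = 0 := by
    refine fixed_component_eq_zero (T := φ trans) (s₀₁ := φ (permOut (Equiv.swap 0 1)))
      (s₀₂ := φ (permOut (Equiv.swap 0 2))) (s₁₂ := φ (permOut (Equiv.swap 1 2)))
      h2 h3 h.ind hz hv hf hT0 hT1 hT2 (fun w hw => h.trans_fixed h2 hw) hA hB hC hD hbr
      h.swap₀₂₁ h.swap₀₂₂ (hperm _) (hperm _) (hperm _) (hperm' _) (hperm' _)
      (swap_swap_apply φ 0 1) (swap_swap_apply φ 0 2) (hconj _ _ _ (by decide))
      (hconj _ _ _ (by decide)) ?_ ?_ h.swap₀₂₀ ?_ ?_ ?_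
    -- Commutation with `epsAll` keeps the image of e_1 odd, hence inside V_1 + V_3.
    · rw [← h21₁]
      apply h.eq_of_epsAll_neg h2
      rw [← trans_trans21_epsAll]
      have : φ epsAll e₁ = -e₁ := by rw [epsAll_apply, m12, m11, map_neg, m10]
      rw [this, map_neg, map_neg]
    · rw [← h21₁, trans_trans21, ← hT1, trans21_apply]
    -- This is the commutation with a_0 ↦ a_2⁻¹ a_0, evaluated at e_2.
    · obtain ⟨y, g, hg, hy⟩ := hTF _ (hperm' (Equiv.swap 1 2) f hf)
      refine ⟨y * z, φ (permOut (Equiv.swap 1 2)) g, hperm' _ g hg, ?_⟩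
      have h4 := trans_left_trans02 φ e₂
      have hl2 : φ (eps 0) (φ (eps 2) (φ trans02 (φ (eps 0) (φ (eps 2) e₂)))) =
          -(z • φ (permOut (Equiv.swap 1 2)) v) + q • e₀ + s • e₂ := by
        rw [m22, map_neg, m20, map_neg, h02₂]
        simp only [map_add, map_smul, map_neg, m02, m22, m00, m20, mE2 _ (hperm _ v hv),
          mE0 _ (hperm _ v hv)]
        module
      have hlf : φ (eps 0) (φ (eps 2) (φ trans02 (φ (eps 0) (φ (eps 2) f)))) =
          (y * z) • e₁ + φ (permOut (Equiv.swap 1 2)) g := by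
        rw [mF2 f hf, map_neg, mF0 f hf, neg_neg, trans02_apply, hy]
        simp only [map_add, map_smul, map_neg, h.swap₁₂₂, m12, m10, mF2 _ (hperm' _ g hg),
          mF0 _ (hperm' _ g hg)]
        module
      rw [hl2, hT2] at h4
      simp only [map_add, map_smul] at h4 hl2 hlf ⊢
      rw [h4, hl2, hlf]
      module
    · intro hv0 g hg g' hg' hg0
      refine exists_smul_of_finrank_le_one ?_ hg hg' hg0
      have : Module.finrank K (eigen φ ∅) ≠ 0 := by
        intro h0
        rw [Submodule.finrank_eq_zero.mp h0, Submodule.mem_bot] at hv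
        exact hv0 hv
      omega
    · intro w hw w' hw' hw0 hnot
      obtain ⟨h4, h5⟩ := span_pair_of_finrank_le_two (by omega) hw hw' hw0 hnot
      refine ⟨h5, fun g hg => ?_⟩
      rw [Submodule.finrank_eq_zero.mp (by omega : Module.finrank K (eigen φ Finset.univ) = 0)] at hg
      exact (Submodule.mem_bot K).mp hg
  subst hv0
  rw [zero_add] at hT1 hB
  rw [map_zero, smul_zero, neg_zero, zero_sub, ← neg_smul q] at hD
  rw [map_zero, smul_zero, zero_add] at h21₁ h02₂
  obtain ⟨rfl, rfl, rfl, rfl, hqr, hrq⟩ := top_component_eq_zero (T := φ trans)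
    (s₀₁ := φ (permOut (Equiv.swap 0 1))) (s₀₂ := φ (permOut (Equiv.swap 0 2)))
    (s₁₂ := φ (permOut (Equiv.swap 1 2))) h3 h.ind hz hf hT0 hT1 hT2 hTF
    (fun g hg hTg => by
      have := trans_eps_one_trans φ g
      rw [eps_apply_of_mem φ hTg (by simp), eps_apply_of_mem φ hg (by simp), map_neg] at this
      exact neg_injective this)
    hA hB hC hD hbr (hperm' _) (hperm' _) (hperm' _) (swap_swap_apply φ 0 1)
    (hconj _ _ _ (by decide))
    (by rw [← h21₀, ← h21₁, trans_trans21, hT0, map_add, map_smul, map_smul])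
    (by
      have h4 := trans_left_trans02 φ e₁
      have hl1 : φ (eps 0) (φ (eps 2) (φ trans02 (φ (eps 0) (φ (eps 2) e₁)))) =
          x • e₁ + z • φ (permOut (Equiv.swap 1 2)) f := by
        rw [m12, m10, h02₁]
        simp only [map_add, map_smul, map_neg, m12, m10, mF2 _ (hperm' _ f hf),
          mF0 _ (hperm' _ f hf), neg_neg]
      have hl0 : φ (eps 0) (φ (eps 2) (φ trans02 (φ (eps 0) (φ (eps 2) e₀)))) =
          p • e₀ + r • e₂ := by
        rw [m02, m00, map_neg, h02₀]
        simp only [map_add, map_smul, map_neg, m02, m00, m22, m20]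
        module
      rw [← hl1, ← hl0, h4, hT1]
      simp only [map_add, map_smul])
    (fun g hg g' hg' hg0 hnot =>
      (span_pair_of_finrank_le_two (by omega) hg hg' hg0 hnot).2)
  rw [add_zero] at hT2
  rw [map_zero, smul_zero, add_zero] at h02₁
  have hz1 := sign_eq_one (T := φ trans) (T' := φ trans21) (T'' := φ trans02) h.ind hz hT1 hT2 h21₁
    h02₁ h02₂ (trans_trans21_trans02 φ e₁)
  rw [hz1, one_smul] at hT0 hT1 hT2
  rw [hz1] at hrq
  exact ⟨hz1, q, r, hT0, hT1, hT2, hqr, hrq⟩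

end IsFrame

end Action

/-! ### Invariance of the levels. -/

section Levels

variable {K V : Type*} [Field K] [AddCommGroup V] [Module K V]
  (φ : Representation K (OutF 3) V)

/-- `V` may be infinite-dimensional here, so preserving `U` does not pass to inverses by itself. The
subgroup asks it of g and of g⁻¹, and the inverses of the generators are again products of
generators. -/
theorem le_comap_of_generators {U : Submodule K V} (he : ∀ i, U ≤ U.comap (φ (eps i)))
    (hs : ∀ i j, U ≤ U.comap (φ (permOut (Equiv.swap i j)))) (ht : U ≤ U.comap (φ trans))
    (g : OutF 3) : U ≤ U.comap (φ g) := by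
  let H : Subgroup (OutF 3) :=
    { carrier := {g | (∀ u ∈ U, φ g u ∈ U) ∧ ∀ u ∈ U, φ g⁻¹ u ∈ U}
      one_mem' := by simp
      mul_mem' := by
        rintro a b ⟨ha, ha'⟩ ⟨hb, hb'⟩
        refine ⟨fun u hu => ?_, fun u hu => ?_⟩
        · rw [map_mul]
          exact ha _ (hb u hu)
        · rw [mul_inv_rev, map_mul]
          exact hb' _ (ha' u hu)
      inv_mem' := by
        rintro a ⟨ha, ha'⟩
        exact ⟨ha', by rwa [inv_inv]⟩ }
  have hinv : (trans : OutF 3)⁻¹ = eps 1 * trans * eps 1 := by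
    apply inv_eq_of_mul_eq_one_right
    rw [← mul_assoc, ← mul_assoc, trans_mul_eps_one_mul_trans, eps_mul_self]
  refine fun u hu => (outF_three_generation H (fun i => ⟨fun u hu => he i hu, fun u hu => ?_⟩)
    (fun i j => ⟨fun u hu => hs i j hu, fun u hu => ?_⟩) ⟨fun u hu => ht hu, fun u hu => ?_⟩ g).1 u hu
  · rw [inv_eq_of_mul_eq_one_right (eps_mul_self i)]
    exact he i hu
  · rw [← map_inv, Equiv.swap_inv]
    exact hs i j hu
  · rw [hinv, map_mul, map_mul]
    exact he 1 (ht (he 1 hu))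

theorem eps_mem_eigen (i : Fin 3) {I : Finset (Fin 3)} {v : V} (hv : v ∈ eigen φ I) :
    φ (eps i) v ∈ eigen φ I := by
  rw [(mem_eigen φ).mp hv i]
  exact Submodule.smul_mem _ _ hv

theorem level_le_comap {k : ℕ} (ht : level φ k ≤ (level φ k).comap (φ trans)) (g : OutF 3) :
    level φ k ≤ (level φ k).comap (φ g) := by
  refine le_comap_of_generators φ (fun i => ?_) (fun i j => ?_) ht g
  · exact iSup_le fun I v hv => Submodule.mem_iSup_of_mem I (eps_mem_eigen φ i hv)
  · exact iSup_le fun I v hv => Submodule.mem_iSup_of_mem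
      ⟨I.1.map (Equiv.swap i j).toEmbedding, by rw [Finset.card_map, I.2]⟩
      (permOut_mem_eigen φ _ hv)

theorem level_zero : level φ 0 = eigen φ ∅ := by
  refine le_antisymm (iSup_le fun I => ?_) (le_iSup_of_le ⟨∅, rfl⟩ le_rfl)
  rw [Finset.card_eq_zero.mp I.2]

theorem level_three : level φ 3 = eigen φ Finset.univ := by
  refine le_antisymm (iSup_le fun I => ?_) (le_iSup_of_le ⟨Finset.univ, rfl⟩ le_rfl)
  rw [(Finset.card_eq_iff_eq_univ I.1).mp I.2]

theorem level_eq_bot {k : ℕ} (h : ∀ I : Finset (Fin 3), I.card = k → eigen φ I = ⊥) :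
    level φ k = ⊥ :=
  le_bot_iff.mp (iSup_le fun I => (h I I.2).le)

theorem isInternal_level (h2 : (2 : K) ≠ 0) :
    DirectSum.IsInternal (fun k : Fin 4 => level φ k) := by
  refine DirectSum.isInternal_submodule_of_iSupIndep_of_iSup_eq_top ?_ ?_
  · intro k
    have h := (iSupIndep_eigen φ h2).disjoint_biSup_biSup (s := {I : Finset (Fin 3) | I.card = (k : ℕ)})
      (t := {I : Finset (Fin 3) | I.card ≠ (k : ℕ)}) (Set.disjoint_left.mpr fun I h h' => h' h)
    refine h.mono (iSup_le fun I => le_biSup (eigen φ) I.2)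
      (iSup₂_le fun j hj => iSup_le fun I => le_biSup (eigen φ) ?_)
    intro h
    exact hj (Fin.ext (I.2.symm.trans h))
  · rw [eq_top_iff, ← (isInternal_eigen φ h2).submodule_iSup_eq_top]
    refine iSup_le fun I => ?_
    have hI : I.card < 4 := Nat.lt_succ_of_le (by simpa using Finset.card_le_univ I)
    exact le_iSup_of_le (⟨I.card, hI⟩ : Fin 4) (le_iSup_of_le ⟨I, rfl⟩ le_rfl)

end Levels

/-! ### The first level, and its complement by duality. -/

section FirstLevel

variable {K V : Type*} [Field K] [AddCommGroup V] [Module K V]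
  {φ : Representation K (OutF 3) V}

/-- The first level is spanned by a frame. -/
theorem IsFrame.level_one [FiniteDimensional K V] {e₀ e₁ e₂ : V} {z : K}
    (h : IsFrame φ e₀ e₁ e₂ z)
    (hd1 : ∀ I : Finset (Fin 3), I.card = 1 → Module.finrank K (eigen φ I) = 1) :
    level φ 1 = Submodule.span K {e₀, e₁, e₂} := by
  refine le_antisymm (iSup_le fun I v hv => ?_) (Submodule.span_le.mpr ?_)
  · have key : ∀ e ∈ ({e₀, e₁, e₂} : Set V), e ∈ eigen φ I → e ≠ 0 →
        v ∈ Submodule.span K {e₀, e₁, e₂} := by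
      intro e he hm h0
      obtain ⟨c, rfl⟩ := exists_smul_of_finrank_le_one (hd1 I I.2).le hm hv h0
      exact Submodule.smul_mem _ _ (Submodule.subset_span he)
    have h01 : (1 : K) ≠ 0 := one_ne_zero
    obtain ⟨i, hi⟩ := Finset.card_eq_one.mp I.2
    rw [hi] at key
    fin_cases i
    · refine key e₀ (by simp) h.mem₀ fun h0 => h01 ?_
      exact (h.ind 0 1 0 0 0 (Submodule.zero_mem _) (Submodule.zero_mem _) (by simp [h0])).2.1
    · refine key e₁ (by simp) h.mem₁ fun h0 => h01 ?_
      exact (h.ind 0 0 1 0 0 (Submodule.zero_mem _) (Submodule.zero_mem _) (by simp [h0])).2.2.1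
    · refine key e₂ (by simp) h.mem₂ fun h0 => h01 ?_
      exact (h.ind 0 0 0 1 0 (Submodule.zero_mem _) (Submodule.zero_mem _) (by simp [h0])).2.2.2.1
  · rintro v (rfl | rfl | rfl)
    · exact Submodule.mem_iSup_of_mem (ι := {I : Finset (Fin 3) // I.card = 1}) ⟨{0}, rfl⟩ h.mem₀
    · exact Submodule.mem_iSup_of_mem (ι := {I : Finset (Fin 3) // I.card = 1}) ⟨{1}, rfl⟩ h.mem₁
    · exact Submodule.mem_iSup_of_mem (ι := {I : Finset (Fin 3) // I.card = 1}) ⟨{2}, rfl⟩ h.mem₂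

/-- The dimensions for which the levels `0`, `1`, `3` exhaust `V` and the first one is
three-dimensional. -/
structure HasFirstLevel (φ : Representation K (OutF 3) V) : Prop where
  one : ∀ I : Finset (Fin 3), I.card = 1 → Module.finrank K (eigen φ I) = 1
  two : ∀ I : Finset (Fin 3), I.card = 2 → Module.finrank K (eigen φ I) = 0
  rest : Module.finrank K (eigen φ ∅) + Module.finrank K (eigen φ Finset.univ) = 2

theorem HasFirstLevel.exists_frame [FiniteDimensional K V] (h2 : (2 : K) ≠ 0) (h3 : (3 : K) ≠ 0)
    (h : HasFirstLevel φ) : ∃ (e₀ e₁ e₂ : V) (q r : K), IsFrame φ e₀ e₁ e₂ 1 ∧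
      φ trans e₀ = e₀ + r • e₁ ∧ φ trans e₁ = q • e₀ + e₁ ∧ φ trans e₂ = e₂ ∧
      q * r = 0 ∧ r - q = -1 := by
  obtain ⟨e₀, e₁, e₂, z, hf⟩ := exists_isFrame φ h2 h.one h.two
  obtain ⟨rfl, q, r, ht⟩ := hf.trans_apply h2 h3 h.rest
  exact ⟨e₀, e₁, e₂, q, r, hf, ht⟩

theorem HasFirstLevel.level_one_le_comap [FiniteDimensional K V] (h2 : (2 : K) ≠ 0)
    (h3 : (3 : K) ≠ 0) (h : HasFirstLevel φ) (g : OutF 3) :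
    level φ 1 ≤ (level φ 1).comap (φ g) := by
  refine level_le_comap φ ?_ g
  obtain ⟨e₀, e₁, e₂, q, r, hf, h0, h1, h2, -⟩ := h.exists_frame h2 h3
  rw [hf.level_one h.one, Submodule.span_le]
  have m₀ : e₀ ∈ Submodule.span K {e₀, e₁, e₂} := Submodule.subset_span (by simp)
  have m₁ : e₁ ∈ Submodule.span K {e₀, e₁, e₂} := Submodule.subset_span (by simp)
  have m₂ : e₂ ∈ Submodule.span K {e₀, e₁, e₂} := Submodule.subset_span (by simp)
  rintro v (rfl | rfl | rfl)
  · simpa only [SetLike.mem_coe, Submodule.mem_comap, h0] using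
      Submodule.add_mem _ m₀ (Submodule.smul_mem _ r m₁)
  · simpa only [SetLike.mem_coe, Submodule.mem_comap, h1] using
      Submodule.add_mem _ (Submodule.smul_mem _ q m₀) m₁
  · simpa only [SetLike.mem_coe, Submodule.mem_comap, h2] using m₂

theorem HasFirstLevel.dual [FiniteDimensional K V] (h2 : (2 : K) ≠ 0) (h : HasFirstLevel φ) :
    HasFirstLevel φ.dual where
  one I hI := by rw [finrank_eigen_dual φ h2, h.one I hI]
  two I hI := by rw [finrank_eigen_dual φ h2, h.two I hI]
  rest := by rw [finrank_eigen_dual φ h2, finrank_eigen_dual φ h2, h.rest]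

/-- The involution ε_i acts on `f` and on `u` by opposite signs, so f u = -f u. -/
theorem dual_eigen_apply (h2 : (2 : K) ≠ 0) {I J : Finset (Fin 3)} {i : Fin 3}
    (hi : ¬(i ∈ I ↔ i ∈ J)) {f : Module.Dual K V} (hf : f ∈ eigen φ.dual I) {u : V}
    (hu : u ∈ eigen φ J) : f u = 0 := by
  have hinv : (eps i : OutF 3)⁻¹ = eps i := inv_eq_of_mul_eq_one_right (eps_mul_self i)
  have h1 := congrArg (fun t : Module.Dual K V => t u) ((mem_eigen φ.dual).mp hf i)
  simp only [Representation.dual_apply, hinv, Module.Dual.transpose_apply, LinearMap.comp_apply,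
    (mem_eigen φ).mp hu i, map_smul, LinearMap.smul_apply, smul_eq_mul] at h1
  have h4 : (2 : K) * f u = 0 := by
    by_cases hI : i ∈ I <;> by_cases hJ : i ∈ J <;> simp [hI, hJ] at hi h1
    · linear_combination h1
    · linear_combination -h1
  exact (mul_eq_zero.mp h4).resolve_left h2

/-- The sum of the levels `0` and `3` is a submodule, by duality. -/
theorem HasFirstLevel.sup_le_comap [FiniteDimensional K V] (h2 : (2 : K) ≠ 0)
    (h3 : (3 : K) ≠ 0) (h : HasFirstLevel φ) (g : OutF 3) :
    eigen φ ∅ ⊔ eigen φ Finset.univ ≤ (eigen φ ∅ ⊔ eigen φ Finset.univ).comap (φ g) := by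
  intro u hu
  have hdual := (h.dual h2).level_one_le_comap h2 h3 g⁻¹
  -- V_0 + V_3 is annihilated by the first level of the dual. That level is invariant, so it
  -- annihilates the translate of u as well, and the components of the translate in V_1 vanish.
  have hkill : ∀ f ∈ level φ.dual 1, f u = 0 := by
    have : level φ.dual 1 ≤ LinearMap.ker (Module.Dual.eval K V u) := by
      refine iSup_le fun I f hf => ?_
      rw [LinearMap.mem_ker, Module.Dual.eval_apply]
      obtain ⟨w, hw, g, hg, rfl⟩ := Submodule.mem_sup.mp hu
      obtain ⟨i, hi⟩ := Finset.card_eq_one.mp I.2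
      rw [hi] at hf
      have hj : ∃ j, j ≠ i := exists_ne i
      obtain ⟨j, hj⟩ := hj
      rw [map_add, dual_eigen_apply h2 (i := i) (by simp) hf hw,
        dual_eigen_apply h2 (i := j) (by simpa using hj) hf hg, add_zero]
    exact fun f hf => this hf
  have hone : ∀ i : Fin 3, eigenProj φ {i} (φ g u) = 0 := by
    intro i
    rw [← Module.forall_dual_apply_eq_zero_iff K]
    intro f
    have hm : eigenProj φ.dual {i} f ∈ level φ.dual 1 :=
      Submodule.mem_iSup_of_mem (ι := {I : Finset (Fin 3) // I.card = 1}) ⟨{i}, rfl⟩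
        (eigenProj_mem φ.dual {i} f)
    have h4 := hkill _ (hdual hm)
    rw [Representation.dual_apply, inv_inv, Module.Dual.transpose_apply, eigenProj_dual] at h4
    exact h4
  have hzero : ∀ I : Finset (Fin 3), I.card = 2 → eigenProj φ I (φ g u) = 0 := by
    intro I hI
    have h4 := eigenProj_mem φ I (φ g u)
    rwa [Submodule.finrank_eq_zero.mp (h.two I hI), Submodule.mem_bot] at h4
  have hsum := sum_eigenProj φ h2 (φ g u)
  rw [sum_finset_fin_three, hzero {0, 1} (by decide), hzero {0, 2} (by decide),
    hzero {1, 2} (by decide), hone, hone, hone] at hsum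
  simp only [zero_add] at hsum
  rw [Submodule.mem_comap, ← hsum]
  exact Submodule.add_mem_sup (eigenProj_mem φ _ _) (eigenProj_mem φ _ _)

theorem HasFirstLevel.finrank_sup_le [FiniteDimensional K V] (h : HasFirstLevel φ) :
    Module.finrank K ↥(eigen φ ∅ ⊔ eigen φ Finset.univ) ≤ 2 :=
  (Submodule.finrank_add_le_finrank_add_finrank _ _).trans h.rest.le

end FirstLevel

/-! ### Transvections act trivially on the complementary plane. -/

section Plane

variable {K V : Type*} [Field K] [AddCommGroup V] [Module K V]
  {φ : Representation K (OutF 3) V}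

/-- On an invariant subspace of dimension at most two on which the `ε_i` agree, the transvections
act trivially. -/
theorem trans_apply_of_finrank_le_two [FiniteDimensional K V] (h2 : (2 : K) ≠ 0)
    {D : Submodule K V} (hD : ∀ g, D ≤ D.comap (φ g)) (hdim : Module.finrank K D ≤ 2)
    (heps : ∀ u ∈ D, ∀ i j, φ (eps i) u = φ (eps j) u) {u : V} (hu : u ∈ D) :
    φ trans u = u := by
  have hinv : ∀ u ∈ D, φ trans (φ trans u) = u := by
    intro u hu
    have h4 := trans_eps_one_trans φ u
    rw [heps (φ trans u) (hD _ hu) 1 2, trans_eps_two, heps u hu 1 2] at h4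
    exact rep_injective φ (eps 2) h4
  have hee : ∀ u ∈ D, φ (eps 0) (φ (eps 2) u) = u := by
    intro u hu
    rw [heps _ (hD _ hu) 0 2, eps_eps]
  -- On `D` the product ε_0 ε_2 is trivial, so the left and the right transvection of a_0 by a_2
  -- coincide.
  have h02 : ∀ u ∈ D, φ trans (φ trans02 u) = φ trans02 (φ trans u) := by
    intro u hu
    have h4 := trans_left_trans02 φ u
    rwa [hee u hu, hee _ (hD _ hu), hee _ (hD _ hu), hee _ (hD _ (hD _ hu))] at h4
  let W : Submodule K V := D ⊓ LinearMap.ker (φ trans + 1)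
  have hW : ∀ {v}, v ∈ W ↔ v ∈ D ∧ φ trans v = -v := by
    intro v
    rw [Submodule.mem_inf, LinearMap.mem_ker, LinearMap.add_apply, Module.End.one_apply,
      add_eq_zero_iff_eq_neg]
  -- On a common eigenvector of `trans21` and `trans02` the Steinberg relation says that `trans`
  -- acts by 1, whereas on `W` it acts by -1.
  have hcontra : ∀ v, v ∈ W → (∃ a : K, φ trans21 v = a • v) → (∃ b : K, φ trans02 v = b • v) →
      v = 0 := by
    rintro v hv ⟨a, ha⟩ ⟨b, hb⟩
    have h4 := trans_trans21_trans02 φ v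
    rw [hb, map_smul, ha, map_smul, map_smul, map_smul, (hW.mp hv).2, hb] at h4
    have h5 : (2 : K) • b • a • v = 0 := by linear_combination (norm := module) -h4
    have h6 := (smul_eq_zero.mp h5).resolve_left h2
    have h7 : φ trans02 (φ trans21 v) = φ trans02 0 := by
      rw [ha, map_smul, hb, map_zero, smul_comm, h6]
    have h8 := rep_injective φ trans02 h7
    exact rep_injective φ trans21 (h8.trans (map_zero _).symm)
  have hbot : W = ⊥ := by
    rw [eq_bot_iff]
    intro v hv
    rw [Submodule.mem_bot]
    -- If `W` is at most a line, the other two transvections preserve it because they commute with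
    -- `trans` on `D`. If `W` is all of `D`, they are conjugate to -1, hence equal to -1.
    by_cases hle : Module.finrank K W ≤ 1
    · by_contra hv0
      refine hv0 (hcontra v hv (exists_smul_of_finrank_le_one hle hv ?_ hv0)
        (exists_smul_of_finrank_le_one hle hv ?_ hv0))
      · refine hW.mpr ⟨hD _ (hW.mp hv).1, ?_⟩
        rw [trans_trans21, (hW.mp hv).2, map_neg]
      · refine hW.mpr ⟨hD _ (hW.mp hv).1, ?_⟩
        rw [h02 v (hW.mp hv).1, (hW.mp hv).2, map_neg]
    · have hWD : W = D := Submodule.eq_of_le_of_finrank_le inf_le_left (by omega)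
      have hneg : ∀ v ∈ D, φ trans v = -v := fun v hv => (hW.mp (hWD ▸ hv)).2
      have hvD := (hW.mp hv).1
      refine hcontra v hv ⟨-1, ?_⟩ ⟨-1, ?_⟩
      · rw [trans21_apply, hneg _ (hD _ hvD), map_neg, swap_swap_apply, neg_one_smul]
      · rw [trans02_apply, hneg _ (hD _ hvD), map_neg, swap_swap_apply, neg_one_smul]
  have hmem : u - φ trans u ∈ W :=
    hW.mpr ⟨Submodule.sub_mem _ hu (hD _ hu), by rw [map_sub, hinv u hu, neg_sub]⟩
  rw [hbot, Submodule.mem_bot, sub_eq_zero] at hmem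
  exact hmem.symm

end Plane

/-! ### Direct sums of representations of symmetric groups. -/

section SymmetricGroup

variable {K U W : Type*} [Field K] [AddCommGroup U] [Module K U] [AddCommGroup W] [Module K W]

theorem isSumOf_of_linearEquiv {G : Type*} [Group G] {σ : Representation K G U}
    {τ : Representation K G W} (e : U ≃ₗ[K] W) (he : ∀ g u, e (σ g u) = τ g (e u)) :
    IsSumOf σ τ := by
  refine ⟨1, ⟨Representation.Equiv.mk (e.trans (DirectSum.lid K W (Fin 1)).symm) fun g => ?_⟩⟩
  ext u : 1
  apply (DirectSum.lid K W (Fin 1)).injective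
  simp only [LinearMap.comp_apply, LinearEquiv.coe_coe, LinearEquiv.trans_apply,
    LinearEquiv.apply_symm_apply, he]
  have : ∀ x, DirectSum.lid K W (Fin 1) (Representation.directSum (fun _ : Fin 1 => τ) g x) =
      τ g (DirectSum.lid K W (Fin 1) x) := by
    intro x
    obtain ⟨w, rfl⟩ := (DirectSum.lid K W (Fin 1)).symm.surjective x
    change DirectSum.lid K W (Fin 1) (DirectSum.lmap (fun _ => τ g) (DirectSum.lof K (Fin 1) _ _ w)) =
      τ g (DirectSum.lid K W (Fin 1) (DirectSum.lof K (Fin 1) _ _ w))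
    have hl : ∀ w : W, DirectSum.lid K W (Fin 1) (DirectSum.lof K (Fin 1) (fun _ => W) default w) =
        w := (DirectSum.lid K W (Fin 1)).apply_symm_apply
    rw [DirectSum.lmap_lof, hl, hl]
  rw [this, LinearEquiv.apply_symm_apply]

theorem isSumOf_of_subsingleton {G : Type*} [Group G] [Subsingleton U] (σ : Representation K G U)
    (τ : Representation K G W) : IsSumOf σ τ :=
  ⟨0, ⟨Representation.Equiv.mk
    { toFun := fun _ => 0
      invFun := fun _ => 0
      map_add' := fun _ _ => (add_zero 0).symm
      map_smul' := fun c _ => (smul_zero c).symm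
      left_inv := fun _ => Subsingleton.elim _ _
      right_inv := fun _ => Subsingleton.elim _ _ } fun g => by
    ext u : 1
    exact Subsingleton.elim _ _⟩⟩

theorem isSumOf_trivRep {m : ℕ} [FiniteDimensional K U]
    {σ : Representation K (Equiv.Perm (Fin m)) U} (h : ∀ g u, σ g u = u) :
    IsSumOf σ (trivRep K m) := by
  refine ⟨Module.finrank K U, ⟨Representation.Equiv.mk ((Module.finBasis K U).equivFun.trans
    (DirectSum.linearEquivFunOnFintype K _ (fun _ => K)).symm) fun g => ?_⟩⟩
  have h1 : σ g = LinearMap.id := LinearMap.ext (h g)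
  have h2 : Representation.directSum (fun _ : Fin (Module.finrank K U) => trivRep K m) g =
      LinearMap.id := by
    change DirectSum.lmap (fun _ => trivRep K m g) = _
    have : trivRep K m g = LinearMap.id := rfl
    rw [this]
    exact DirectSum.lmap_id
  rw [h1, h2, LinearMap.comp_id, LinearMap.id_comp]

theorem signK_mul_self {m : ℕ} (g : Equiv.Perm (Fin m)) : signK K m g * signK K m g = 1 := by
  rw [← map_mul]
  rcases Int.units_eq_one_or (Equiv.Perm.sign g) with h | h <;> simp [signK, h]

theorem signTwist_signTwist {m : ℕ} (τ : Representation K (Equiv.Perm (Fin m)) W) :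
    signTwist (signTwist τ) = τ := by
  ext g w
  change (signK K m g • signK K m g • τ g) w = _
  rw [smul_smul, signK_mul_self, one_smul]

theorem IsSumOf.signTwist {m : ℕ} {σ : Representation K (Equiv.Perm (Fin m)) U}
    {τ : Representation K (Equiv.Perm (Fin m)) W} (h : IsSumOf σ τ) :
    IsSumOf (signTwist σ) (signTwist τ) := by
  obtain ⟨d, ⟨e⟩⟩ := h
  refine ⟨d, ⟨Representation.Equiv.mk e.toLinearEquiv fun g => ?_⟩⟩
  have h1 : Representation.directSum (fun _ : Fin d => OutFree.signTwist τ) g =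
      signK K m g • Representation.directSum (fun _ : Fin d => τ) g := by
    ext i w : 2
    change DirectSum.lmap (fun _ => signK K m g • τ g) _ =
      (signK K m g • DirectSum.lmap (fun _ => τ g)) _
    simp
  rw [h1]
  change _ ∘ₗ (signK K m g • σ g) = _
  rw [LinearMap.comp_smul, LinearMap.smul_comp]
  congr 1
  exact e.toIntertwiningMap.isIntertwining' g

/-- These are the transpositions whose action on a frame is computed explicitly. -/
theorem perm_four_induction {H : Subgroup (Equiv.Perm (Fin 4))}
    (h01 : Equiv.swap 0 1 ∈ H) (h02 : Equiv.swap 0 2 ∈ H) (h12 : Equiv.swap 1 2 ∈ H)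
    (h13 : Equiv.swap 1 3 ∈ H) (π : Equiv.Perm (Fin 4)) : π ∈ H := by
  have h : ∀ i j : Fin 3, Equiv.swap i.castSucc j.castSucc ∈ H := by
    intro i j
    have : ∀ i j : Fin 3, Equiv.swap i.castSucc j.castSucc = 1 ∨
        Equiv.swap i.castSucc j.castSucc = Equiv.swap 0 1 ∨
        Equiv.swap i.castSucc j.castSucc = Equiv.swap 0 2 ∨
        Equiv.swap i.castSucc j.castSucc = Equiv.swap 1 2 := by decide
    rcases this i j with h | h | h | h <;> rw [h]
    exacts [H.one_mem, h01, h02, h12]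
  have hlast : ∀ i : Fin 3, Equiv.swap i.castSucc (Fin.last 3) ∈ H := by
    intro i
    have : Equiv.swap i.castSucc (Fin.last 3) = Equiv.swap i.castSucc (1 : Fin 3).castSucc *
        Equiv.swap 1 3 * Equiv.swap i.castSucc (1 : Fin 3).castSucc := by
      revert i
      decide
    rw [this]
    exact H.mul_mem (H.mul_mem (h i 1) h13) (h i 1)
  induction π using Equiv.Perm.swap_induction_on with
  | one => exact H.one_mem
  | swap_mul f x y _ hf =>
    refine H.mul_mem ?_ hf
    induction x using Fin.lastCases with
    | last =>
      induction y using Fin.lastCases with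
      | last =>
        rw [Equiv.swap_self]
        exact H.one_mem
      | cast j =>
        rw [Equiv.swap_comm]
        exact hlast j
    | cast i =>
      induction y using Fin.lastCases with
      | last => exact hlast i
      | cast j => exact h i j

end SymmetricGroup

/-! ### Twisting by the determinant. -/

section Twist

variable {K V : Type*} [Field K] [AddCommGroup V] [Module K V]
  (φ : Representation K (OutF 3) V)

/-- The product of a representation of `Out(F_3)` with the determinant character. -/
def detTwist : Representation K (OutF 3) V where
  toFun g := ((detOut g : ℤ) : K) • φ g
  map_one' := by simp
  map_mul' g h := by
    rw [map_mul, map_mul, Units.val_mul, Int.cast_mul, smul_mul_smul_comm]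

theorem detTwist_apply (g : OutF 3) (v : V) : detTwist φ g v = ((detOut g : ℤ) : K) • φ g v := rfl

/-- Each ε_i has determinant -1, so the twist reverses all signs. This is what exchanges V_1 with
V_2 and V_0 with V_3. -/
theorem eigen_detTwist (I : Finset (Fin 3)) : eigen (detTwist φ) I = eigen φ Iᶜ := by
  ext v
  rw [mem_eigen, mem_eigen]
  refine forall_congr' fun i => ?_
  rw [detTwist_apply, detOut_eps]
  by_cases hi : i ∈ I <;> simp [hi, neg_eq_iff_eq_neg]

theorem level_detTwist {k l : ℕ} (h : k + l = 3) : level (detTwist φ) k = level φ l := by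
  refine le_antisymm (iSup_le fun I => ?_) (iSup_le fun I => ?_)
  · rw [eigen_detTwist]
    refine le_iSup_of_le (ι := {I : Finset (Fin 3) // I.card = l}) ⟨I.1ᶜ, ?_⟩ le_rfl
    rw [Finset.card_compl, I.2, Fintype.card_fin]
    omega
  · refine le_iSup_of_le (ι := {I : Finset (Fin 3) // I.card = k}) ⟨I.1ᶜ, ?_⟩ ?_
    · rw [Finset.card_compl, I.2, Fintype.card_fin]
      omega
    · rw [eigen_detTwist, compl_compl]

/-- The subspace `U` is invariant, and a sum of copies of `τ` for the symmetric group. -/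
def IsIsotypic {W : Type*} [AddCommGroup W] [Module K W] (U : Submodule K V)
    (τ : Representation K (Equiv.Perm (Fin 4)) W) : Prop :=
  ∃ hU : ∀ g, U ≤ U.comap (φ g), IsSumOf (symRestrict φ U hU) τ

theorem IsIsotypic.of_detTwist {W : Type*} [AddCommGroup W] [Module K W] {U : Submodule K V}
    {τ : Representation K (Equiv.Perm (Fin 4)) W} (h : IsIsotypic (detTwist φ) U τ) :
    IsIsotypic φ U (signTwist τ) := by
  obtain ⟨hU, hs⟩ := h
  have hU' : ∀ g, U ≤ U.comap (φ g) := by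
    intro g u hu
    have h1 : ((detOut g : ℤ) : K) • φ g u ∈ U := hU g hu
    rcases Int.units_eq_one_or (detOut g) with h | h <;> simpa [h] using h1
  refine ⟨hU', ?_⟩
  have : symRestrict φ U hU' = signTwist (symRestrict (detTwist φ) U hU) := by
    rw [eq_comm, ← signTwist_signTwist (symRestrict φ U hU')]
    congr 1
    ext π u
    change ((detOut (symOut 3 π) : ℤ) : K) • φ (symOut 3 π) u =
      signK K 4 π • φ (symOut 3 π) u
    rw [detOut_symOut]
    rfl
  rw [this]
  exact hs.signTwist

theorem isIsotypic_bot {W : Type*} [AddCommGroup W] [Module K W]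
    (τ : Representation K (Equiv.Perm (Fin 4)) W) : IsIsotypic φ ⊥ τ :=
  ⟨fun _ => bot_le, isSumOf_of_subsingleton _ _⟩

/-- An invariant subspace on which one transposition acts trivially is a sum of trivial
representations. -/
theorem isIsotypic_trivRep [FiniteDimensional K V] {U : Submodule K V}
    (hU : ∀ g, U ≤ U.comap (φ g))
    (h : ∀ u ∈ U, φ (symOut 3 (Equiv.swap 1 3)) u = u) : IsIsotypic φ U (trivRep K 4) := by
  refine ⟨hU, isSumOf_trivRep fun π u => Subtype.ext ?_⟩
  change φ (symOut 3 π) u = u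
  obtain ⟨u, hu⟩ := u
  induction π using Equiv.Perm.swap_induction_on with
  | one => simp
  | swap_mul f x y hxy hf =>
    rw [map_mul, map_mul, Module.End.mul_apply, hf]
    -- All transpositions are conjugate, and `U` is invariant, so triviality of one carries over to
    -- all.
    obtain ⟨κ, hκ⟩ := isConj_iff.mp (Equiv.Perm.isConj_swap (show (1 : Fin 4) ≠ 3 by decide) hxy)
    rw [← hκ, map_mul, map_mul, map_mul, map_mul, Module.End.mul_apply, Module.End.mul_apply,
      h _ (hU _ hu), ← Module.End.mul_apply, ← map_mul, ← map_mul, mul_inv_cancel, map_one,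
      map_one, Module.End.one_apply]

theorem isIsotypic_detRep [FiniteDimensional K V] {U : Submodule K V}
    (hU : ∀ g, U ≤ U.comap (φ g))
    (h : ∀ u ∈ U, φ (symOut 3 (Equiv.swap 1 3)) u = -u) : IsIsotypic φ U (detRep K 4) := by
  refine IsIsotypic.of_detTwist φ (isIsotypic_trivRep (detTwist φ)
    (fun g u hu => Submodule.smul_mem _ _ (hU g hu)) fun u hu => ?_)
  rw [detTwist_apply, detOut_symOut, h u hu, Equiv.Perm.sign_swap (by decide)]
  simp

end Twist

/-! ### The first level is the standard representation. -/

section Standard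

variable {K V : Type*} [Field K] [AddCommGroup V] [Module K V]
  {φ : Representation K (OutF 3) V} {e₀ e₁ e₂ : V}

theorem mem_sumZero_four {x : Fin 4 → K} : x ∈ sumZero K 4 ↔ x 0 + x 1 + x 2 + x 3 = 0 := by
  simp [sumZero, Fin.sum_univ_four]

theorem stdRep_apply {m : ℕ} (π : Equiv.Perm (Fin m)) (x : sumZero K m) (i : Fin m) :
    (stdRep K m π x : Fin m → K) i = (x : Fin m → K) (π⁻¹ i) := rfl

/-- The linear map sending `x` to the combination of the `e_i` with coefficients `x_i - q x_3`. -/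
def frameMap (q : K) (e₀ e₁ e₂ : V) : sumZero K 4 →ₗ[K] V where
  toFun x := (x.1 0 - q * x.1 3) • e₀ + (x.1 1 - q * x.1 3) • e₁ + (x.1 2 - q * x.1 3) • e₂
  map_add' x y := by
    simp only [Submodule.coe_add, Pi.add_apply]
    module
  map_smul' c x := by
    simp only [Submodule.coe_smul, Pi.smul_apply, smul_eq_mul, RingHom.id_apply]
    module

theorem frameMap_apply (q : K) (x : sumZero K 4) : frameMap q e₀ e₁ e₂ x =
    (x.1 0 - q * x.1 3) • e₀ + (x.1 1 - q * x.1 3) • e₁ + (x.1 2 - q * x.1 3) • e₂ := rfl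

theorem IsFrame.frameMap_injective (h : IsFrame φ e₀ e₁ e₂ 1) {q : K} (hq : 1 + 3 * q ≠ 0) :
    Function.Injective (frameMap q e₀ e₁ e₂) := by
  rw [← LinearMap.ker_eq_bot, LinearMap.ker_eq_bot']
  intro x hx
  rw [frameMap_apply] at hx
  obtain ⟨-, h0, h1, h2, -⟩ := h.ind 0 (x.1 0 - q * x.1 3) (x.1 1 - q * x.1 3) (x.1 2 - q * x.1 3) 0
    (Submodule.zero_mem _) (Submodule.zero_mem _) (by rw [zero_add, add_zero, hx])
  have hs := mem_sumZero_four.mp x.2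
  have h3 : x.1 3 = 0 := by
    refine (mul_eq_zero.mp (?_ : (1 + 3 * q) * x.1 3 = 0)).resolve_left hq
    linear_combination hs - h0 - h1 - h2
  rw [h3, mul_zero, sub_zero] at h0 h1 h2
  ext i
  fin_cases i
  exacts [h0, h1, h2, h3]

theorem range_frameMap {q : K} (hq : 1 + 3 * q ≠ 0) :
    LinearMap.range (frameMap q e₀ e₁ e₂) = Submodule.span K {e₀, e₁, e₂} := by
  refine le_antisymm ?_ ?_
  · rintro _ ⟨x, rfl⟩
    rw [frameMap_apply]
    exact Submodule.add_mem _ (Submodule.add_mem _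
      (Submodule.smul_mem _ _ (Submodule.subset_span (by simp)))
      (Submodule.smul_mem _ _ (Submodule.subset_span (by simp))))
      (Submodule.smul_mem _ _ (Submodule.subset_span (by simp)))
  · intro v hv
    obtain ⟨a, b, c, rfl⟩ := Submodule.mem_span_triple.mp hv
    have ht : (1 + 3 * q) * (-(a + b + c) / (1 + 3 * q)) = -(a + b + c) := mul_div_cancel₀ _ hq
    generalize -(a + b + c) / (1 + 3 * q) = t at ht
    refine ⟨⟨![a + q * t, b + q * t, c + q * t, t], mem_sumZero_four.mpr ?_⟩, ?_⟩
    · simp only [Matrix.cons_val]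
      linear_combination ht
    · rw [frameMap_apply]
      simp only [Matrix.cons_val]
      module

/-- The conditions leave (q, r) = (0, -1), the homology representation, or (1, 0), its dual. The
coefficients x_i - q x_3 cover both: in the dual case the fourth basis vector of K⁴ goes to -(e_0 +
e_1 + e_2), and in the homology case to 0. -/
theorem IsFrame.symOut_frameMap (h : IsFrame φ e₀ e₁ e₂ 1) {q r : K}
    (hT0 : φ trans e₀ = e₀ + r • e₁) (hT1 : φ trans e₁ = q • e₀ + e₁) (hT2 : φ trans e₂ = e₂)
    (hqr : q * r = 0) (hrq : r - q = -1) (π : Equiv.Perm (Fin 4)) (x : sumZero K 4) :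
    φ (symOut 3 π) (frameMap q e₀ e₁ e₂ x) = frameMap q e₀ e₁ e₂ (stdRep K 4 π x) := by
  let H : Subgroup (Equiv.Perm (Fin 4)) :=
    { carrier := {π | ∀ x, φ (symOut 3 π) (frameMap q e₀ e₁ e₂ x) =
        frameMap q e₀ e₁ e₂ (stdRep K 4 π x)}
      one_mem' := fun x => by simp
      mul_mem' := fun {a b} ha hb x => by
        rw [map_mul, map_mul, map_mul, Module.End.mul_apply, hb, ha, Module.End.mul_apply]
      inv_mem' := fun {a} ha x => by
        apply rep_injective φ (symOut 3 a)
        rw [ha, ← Module.End.mul_apply, ← map_mul, ← map_mul, ← Module.End.mul_apply, ← map_mul,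
          mul_inv_cancel]
        simp }
  have h01 : symOut 3 (Equiv.swap 0 1) = permOut (Equiv.swap 0 1) := symOut_swap 0 1
  have h02 : symOut 3 (Equiv.swap 0 2) = permOut (Equiv.swap 0 2) := symOut_swap 0 2
  have h12 : symOut 3 (Equiv.swap 1 2) = permOut (Equiv.swap 1 2) := symOut_swap 1 2
  refine perm_four_induction (H := H) (fun x => ?_) (fun x => ?_) (fun x => ?_) (fun x => ?_) π x
  · rw [h01, frameMap_apply, frameMap_apply]
    simp only [map_add, map_smul, h.swap₀₁₀, h.swap₀₁₁, h.swap₀₁₂, stdRep_apply, Equiv.swap_inv]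
    rw [show Equiv.swap (0 : Fin 4) 1 0 = 1 by decide, show Equiv.swap (0 : Fin 4) 1 1 = 0 by decide,
      show Equiv.swap (0 : Fin 4) 1 2 = 2 by decide, show Equiv.swap (0 : Fin 4) 1 3 = 3 by decide]
    module
  · rw [h02, frameMap_apply, frameMap_apply]
    simp only [map_add, map_smul, h.swap₀₂₀, h.swap₀₂₁, h.swap₀₂₂, stdRep_apply, Equiv.swap_inv]
    rw [show Equiv.swap (0 : Fin 4) 2 0 = 2 by decide, show Equiv.swap (0 : Fin 4) 2 1 = 1 by decide,
      show Equiv.swap (0 : Fin 4) 2 2 = 0 by decide, show Equiv.swap (0 : Fin 4) 2 3 = 3 by decide]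
    module
  · rw [h12, frameMap_apply, frameMap_apply]
    simp only [map_add, map_smul, h.swap₁₂₀, h.swap₁₂₁, h.swap₁₂₂, stdRep_apply, Equiv.swap_inv]
    rw [show Equiv.swap (1 : Fin 4) 2 0 = 0 by decide, show Equiv.swap (1 : Fin 4) 2 1 = 2 by decide,
      show Equiv.swap (1 : Fin 4) 2 2 = 1 by decide, show Equiv.swap (1 : Fin 4) 2 3 = 3 by decide]
    module
  · have h21₀ : φ trans21 e₀ = e₀ := by
      rw [trans21_apply, h.swap₀₂₀, one_smul, hT2, h.swap₀₂₂, one_smul]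
    have h21₁ : φ trans21 e₁ = q • e₂ + e₁ := by
      rw [trans21_apply, h.swap₀₂₁, one_smul, hT1, map_add, map_smul, h.swap₀₂₀, h.swap₀₂₁,
        one_smul, one_smul]
    have h21₂ : φ trans21 e₂ = e₂ + r • e₁ := by
      rw [trans21_apply, h.swap₀₂₂, one_smul, hT0, map_add, map_smul, h.swap₀₂₀, h.swap₀₂₁,
        one_smul, one_smul]
    have hs := mem_sumZero_four.mp x.2
    rw [symOut_swap_one_last, frameMap_apply, frameMap_apply]
    simp only [map_mul, Module.End.mul_apply, map_add, map_smul, map_neg,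
      eps_apply_of_notMem φ h.mem₀ (i := 1) (by simp), eps_apply_of_mem φ h.mem₁ (i := 1) (by simp),
      eps_apply_of_notMem φ h.mem₂ (i := 1) (by simp), h21₀, h21₁, h21₂, hT0, hT1, hT2,
      stdRep_apply, Equiv.swap_inv]
    rw [show Equiv.swap (1 : Fin 4) 3 0 = 0 by decide, show Equiv.swap (1 : Fin 4) 3 1 = 3 by decide,
      show Equiv.swap (1 : Fin 4) 3 2 = 2 by decide, show Equiv.swap (1 : Fin 4) 3 3 = 1 by decide]
    have hr : r = q - 1 := by linear_combination hrq
    subst hr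
    linear_combination (norm := module)
      (x.1 3 + x.1 2 - q * x.1 3) • congrArg (fun t => t • e₀) hqr +
        (q - 1) • congrArg (fun t => t • e₁) hs - (2 * x.1 3) • congrArg (fun t => t • e₁) hqr +
        x.1 3 • congrArg (fun t => t • e₂) hqr

theorem HasFirstLevel.isIsotypic_one [FiniteDimensional K V] (h2 : (2 : K) ≠ 0) (h3 : (3 : K) ≠ 0)
    (h : HasFirstLevel φ) : IsIsotypic φ (level φ 1) (stdRep K 4) := by
  refine ⟨h.level_one_le_comap h2 h3, ?_⟩
  obtain ⟨e₀, e₁, e₂, q, r, hf, hT0, hT1, hT2, hqr, hrq⟩ := h.exists_frame h2 h3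
  have hq : 1 + 3 * q ≠ 0 := by
    intro h0
    have h4 : (2 : K) * 2 = 0 := by
      -- The conditions give q² = q, so (4 - 3q)(1 + 3q) = 4.
      linear_combination (4 - 3 * q) * h0 + 9 * hqr - 9 * q * hrq
    exact mul_ne_zero h2 h2 h4
  let e := (LinearEquiv.ofInjective _ (hf.frameMap_injective hq)).trans
    (LinearEquiv.ofEq _ _ ((range_frameMap hq).trans (hf.level_one h.one).symm))
  have he : ∀ x, (e x : V) = frameMap q e₀ e₁ e₂ x := fun x => rfl
  refine isSumOf_of_linearEquiv e.symm fun π u => ?_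
  obtain ⟨x, rfl⟩ := e.surjective u
  rw [LinearEquiv.symm_apply_apply, LinearEquiv.symm_apply_eq]
  apply Subtype.ext
  rw [he, ← hf.symOut_frameMap hT0 hT1 hT2 hqr hrq, ← he]
  rfl

end Standard

/-! ### Assembly: dimension count and reduction by the twist. -/

section Main

variable {K V : Type*} [Field K] [AddCommGroup V] [Module K V] [FiniteDimensional K V]
  {φ : Representation K (OutF 3) V}

theorem HasFirstLevel.isIsotypic (h2 : (2 : K) ≠ 0) (h3 : (3 : K) ≠ 0) (h : HasFirstLevel φ) :
    IsIsotypic φ (level φ 0) (trivRep K 4) ∧ IsIsotypic φ (level φ 1) (stdRep K 4) ∧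
      IsIsotypic φ (level φ 2) (signedStdRep K 4) ∧ IsIsotypic φ (level φ 3) (detRep K 4) := by
  have hE : eigen φ ∅ ≤ eigen φ ∅ ⊔ eigen φ Finset.univ := le_sup_left
  have hF : eigen φ Finset.univ ≤ eigen φ ∅ ⊔ eigen φ Finset.univ := le_sup_right
  have hD := h.sup_le_comap h2 h3
  have htrans : ∀ u ∈ eigen φ ∅ ⊔ eigen φ Finset.univ, φ trans u = u := by
    intro u hu
    refine trans_apply_of_finrank_le_two h2 hD h.finrank_sup_le (fun u hu i j => ?_) hu
    obtain ⟨w, hw, g, hg, rfl⟩ := Submodule.mem_sup.mp hu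
    simp only [map_add, (mem_eigen φ).mp hw, (mem_eigen φ).mp hg, Finset.notMem_empty,
      Finset.mem_univ]
  -- This transposition is `trans` times `trans21` times ε_1, and both transvections act trivially
  -- on the plane.
  have hsym : ∀ u ∈ eigen φ ∅ ⊔ eigen φ Finset.univ,
      φ (symOut 3 (Equiv.swap 1 3)) u = φ (eps 1) u := by
    intro u hu
    rw [symOut_swap_one_last, map_mul, map_mul, Module.End.mul_apply, Module.End.mul_apply,
      trans21_apply, htrans _ (hD _ (hD _ hu)), swap_swap_apply, htrans _ (hD _ hu)]
  refine ⟨isIsotypic_trivRep φ (level_le_comap φ ?_) ?_, h.isIsotypic_one h2 h3, ?_,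
    isIsotypic_detRep φ (level_le_comap φ ?_) ?_⟩
  · rw [level_zero]
    intro u hu
    rwa [Submodule.mem_comap, htrans u (hE hu)]
  · rw [level_zero]
    intro u hu
    rw [hsym u (hE hu), eps_apply_of_notMem φ hu (by simp)]
  · rw [level_eq_bot φ fun I hI => Submodule.finrank_eq_zero.mp (h.two I hI)]
    exact isIsotypic_bot φ _
  · rw [level_three]
    intro u hu
    rwa [Submodule.mem_comap, htrans u (hF hu)]
  · rw [level_three]
    intro u hu
    rw [hsym u (hF hu), eps_apply_of_mem φ hu (by simp)]

/-- The equation d_0 + 3d_1 + 3d_2 + d_3 = 5 allows at most one of d_1, d_2 to be nonzero, and then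
it equals 1. If it is d_2, the twist moves it to the first level. -/
theorem hasFirstLevel_or (h2 : (2 : K) ≠ 0) (hV : Module.finrank K V = 5)
    (hne : level φ 0 ⊔ level φ 3 ≠ ⊤) : HasFirstLevel φ ∨ HasFirstLevel (detTwist φ) := by
  have hsum := sum_finrank_eigen φ h2
  have hc : ∀ I J : Finset (Fin 3), I.card = J.card →
      Module.finrank K (eigen φ I) = Module.finrank K (eigen φ J) :=
    fun I J h => finrank_eigen_of_card_eq φ h
  rw [hV, sum_finset_fin_three, hc {1} {0} rfl, hc {2} {0} rfl, hc {0, 2} {0, 1} (by decide),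
    hc {1, 2} {0, 1} (by decide)] at hsum
  by_cases h0 : Module.finrank K (eigen φ {0}) = 0 ∧ Module.finrank K (eigen φ {0, 1}) = 0
  · refine absurd (eq_top_iff.mpr ?_) hne
    rw [← (isInternal_level φ h2).submodule_iSup_eq_top]
    refine iSup_le fun k => ?_
    fin_cases k
    · exact le_sup_left
    · refine (level_eq_bot φ fun I hI => Submodule.finrank_eq_zero.mp ?_).le.trans bot_le
      rw [hc I {0} hI, h0.1]
    · refine (level_eq_bot φ fun I hI => Submodule.finrank_eq_zero.mp ?_).le.trans bot_le
      rw [hc I {0, 1} hI, h0.2]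
    · exact le_sup_right
  by_cases h1 : Module.finrank K (eigen φ {0, 1}) = 0
  · left
    refine ⟨fun I hI => ?_, fun I hI => ?_, ?_⟩
    · rw [hc I {0} hI]
      omega
    · rw [hc I {0, 1} hI]
      omega
    · omega
  · right
    refine ⟨fun I hI => ?_, fun I hI => ?_, ?_⟩
    · rw [eigen_detTwist, hc Iᶜ {0, 1} (by rw [Finset.card_compl, hI]; rfl)]
      omega
    · rw [eigen_detTwist, hc Iᶜ {0} (by rw [Finset.card_compl, hI]; rfl)]
      omega
    · rw [eigen_detTwist, eigen_detTwist, Finset.compl_empty, Finset.compl_univ]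
      omega

theorem isIsotypic_level (h2 : (2 : K) ≠ 0) (h3 : (3 : K) ≠ 0) (hV : Module.finrank K V = 5)
    (hne : level φ 0 ⊔ level φ 3 ≠ ⊤) :
    IsIsotypic φ (level φ 0) (trivRep K 4) ∧ IsIsotypic φ (level φ 1) (stdRep K 4) ∧
      IsIsotypic φ (level φ 2) (signedStdRep K 4) ∧ IsIsotypic φ (level φ 3) (detRep K 4) := by
  rcases hasFirstLevel_or h2 hV hne with h | h
  · exact h.isIsotypic h2 h3
  · obtain ⟨i0, i1, i2, i3⟩ := h.isIsotypic h2 h3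
    rw [level_detTwist φ (rfl : 0 + 3 = 3)] at i0
    rw [level_detTwist φ (rfl : 1 + 2 = 3)] at i1
    rw [level_detTwist φ (rfl : 2 + 1 = 3)] at i2
    rw [level_detTwist φ (rfl : 3 + 0 = 3)] at i3
    have j0 := i3.of_detTwist
    have j1 := i2.of_detTwist
    rw [detRep, signTwist_signTwist] at j0
    rw [signedStdRep, signTwist_signTwist] at j1
    exact ⟨j0, j1, i1.of_detTwist, i0.of_detTwist⟩

end Main

end OutFree

theorem mainTheorem4 {K V : Type*} [Field K] [AddCommGroup V] [Module K V]
    (hK2 : ringChar K ≠ 2) (hK3 : ringChar K ≠ 3)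
    (hV : Module.finrank K V = 5)
    (φ : Representation K (OutFree.OutF 3) V)
    (hne : OutFree.level φ 0 ⊔ OutFree.level φ 3 ≠ ⊤) :
    DirectSum.IsInternal (fun k : Fin 4 => OutFree.level φ k) ∧
    ∃ hinv : ∀ (k : Fin 4) (g : OutFree.OutF 3),
        OutFree.level φ k ≤ (OutFree.level φ k).comap (φ g),
      OutFree.IsSumOf (OutFree.symRestrict φ (OutFree.level φ (0 : Fin 4)) (hinv 0))
        (OutFree.trivRep K 4) ∧
      OutFree.IsSumOf (OutFree.symRestrict φ (OutFree.level φ (1 : Fin 4)) (hinv 1))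
        (OutFree.stdRep K 4) ∧
      OutFree.IsSumOf (OutFree.symRestrict φ (OutFree.level φ (2 : Fin 4)) (hinv 2))
        (OutFree.signedStdRep K 4) ∧
      OutFree.IsSumOf (OutFree.symRestrict φ (OutFree.level φ (3 : Fin 4)) (hinv 3))
        (OutFree.detRep K 4) := by
  have h2 : (2 : K) ≠ 0 := Ring.two_ne_zero hK2
  have h3 : (3 : K) ≠ 0 := by
    intro h
    have hdvd : ringChar K ∣ 3 := (ringChar.spec K 3).mp (by exact_mod_cast h)
    rcases (Nat.dvd_prime Nat.prime_three).mp hdvd with h1 | h1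
    · exact CharP.ringChar_ne_one h1
    · exact hK3 h1
  have : FiniteDimensional K V := FiniteDimensional.of_finrank_pos (by omega)
  obtain ⟨⟨u0, i0⟩, ⟨u1, i1⟩, ⟨u2, i2⟩, ⟨u3, i3⟩⟩ := OutFree.isIsotypic_level h2 h3 hV hne
  refine ⟨OutFree.isInternal_level φ h2, fun k => ?_, i0, i1, i2, i3⟩
  fin_cases k
  exacts [u0, u1, u2, u3]
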